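/- **Setting.** Let $\Omega\subset\mathbb R^2$ be a bounded open polygonal set, exactly triangulated by a conforming mesh $\mathcal T_h$ of nondegenerate triangles (two triangles meet at most in a common vertex or a common edge). Let $h_K$ be the diameter of $K\in\mathcal T_h$ and $\rho_K$ the diameter of the largest disk contained in $K$; the mesh is regular in the sense that $h_K/\rho_K\le\gamma_0$ for all $K\in\mathcal T_h$. The boundary edges of the mesh are divided into a nonempty set of Dirichlet edges, with union $\Gamma_D$, and the Neumann edges, with union $\Gamma_N$. Let $\mathbb A$ be a measurable symmetric matrix field on $\Omega$ with $a_{\min}|\xi|^2\le \mathbb A(x)\xi\cdot\xi\le a_{\max}|\xi|^2$ for all $\xi\in\mathbb R^2$ and a.e. $x\in\Omega$, where $0<a_{\min}\le a_{\max}$. Put $V=\{v\in H^1(\Omega):\ v=0\text{ on }\Gamma_D\}$, and let $u\in V$ satisfy $$\int_\Omega \mathbb A\nabla u\cdot\nabla v=\int_\Omega f\,v+\int_{\Gamma_N} g\,v\qquad\text{for all } v\in V .$$ Let $V_h\subset V$ be the space of the continuous functions that are affine on each triangle and vanish on $\Gamma_D$, let $u_h\in V_h$ satisfy the same equation for all $v\in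 V_h$, and put $\boldsymbol q_h=\mathbb A\nabla u_h$. Write $\phi_i$ for the P1 (hat) function of the vertex $i$ and $\boldsymbol n_K$ for the outer unit normal of $K$. **Assumptions.** On each triangle $K$: $\operatorname{div}(\mathbb A\nabla u_h)=0$; on each edge of $K$ the normal flux $\boldsymbol q_{h|K}\cdot\boldsymbol n_K$ is constant; $f$ is constant on $K$. On each Neumann edge, $g$ is affine. **Construction of $\widehat{\boldsymbol q}_h$ (hybrid-flux technique).** 1. For each vertex $i$, each edge $\Gamma$ having $i$ as an endpoint, and each triangle $K$ having $\Gamma$ as an edge, a number $\widehat b_{K,\Gamma}(i)$ is determined as follows. The constraints are: $\widehat b_{K,\Gamma}(i)=-\widehat b_{J,\Gamma}(i)$ if $\Gamma$ separates $K$ and $J$; $\widehat b_{K,\Gamma}(i)=\int_\Gamma g\,\phi_i$ if $\Gamma\subset\Gamma_N$; and, for each triangle $K$ having $i$ as a vertex, $$\sum_{\Gamma\subset\partial K,\ i\in\Gamma}\widehat b_{K,\Gamma}(i)=\int_K\big(\boldsymbol q_h\cdot\nabla\phi_i-f\,\phi_i\big).$$ Among all solutions of these constraints, $\widehat b(i)$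 is the one that minimizes $\sum_{\Gamma\ni i}|\Gamma|^{-2}\big(\widehat b_{K,\Gamma}(i)-b^m_{K,\Gamma}(i)\big)^2$, with one term per edge $\Gamma$, for either choice of the triangle $K$ containing $\Gamma$. Here $b^m_{K,\Gamma}(i)=\frac12\int_\Gamma\phi_i\,(\boldsymbol q_{h|K}+\boldsymbol q_{h|J})\cdot\boldsymbol n_K$ if $\Gamma$ separates $K$ and $J$, and $b^m_{K,\Gamma}(i)=\int_\Gamma\phi_i\,\boldsymbol q_{h|K}\cdot\boldsymbol n_K$ if $\Gamma$ is a boundary edge. 2. For each triangle $K$ and each edge $\Gamma$ of $K$, with endpoints $\ell,m$: $\widehat g_K=g$ on $\Gamma$ if $\Gamma\subset\Gamma_N$; otherwise $\widehat g_K$ is, on $\Gamma$, the linear combination of $\phi_\ell,\phi_m$ such that $\int_\Gamma\widehat g_K\,\phi_i=\widehat b_{K,\Gamma}(i)$ for $i=\ell,m$. 3. On each triangle $K$, $\widehat{\boldsymbol q}_{h|K}$ minimizes $\int_K\mathbb A^{-1}(\boldsymbol p-\boldsymbol q_h)\cdot(\boldsymbol p-\boldsymbol q_h)$ among the $\boldsymbol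 p\in L^2(K)^2$ with $-\operatorname{div}\boldsymbol p=f$ in $K$ and $\boldsymbol p\cdot\boldsymbol n_K=\widehat g_K$ on $\partial K$. **Theorem.** There is a constant $C$ that depends only on $\gamma_0$, $a_{\min}$ and $a_{\max}$ (in particular, not on $h$) such that, for every such problem, mesh and equilibrated flux $\widehat{\boldsymbol q}_h$, $$E^2_{\rm CRE}(u_h,\widehat{\boldsymbol q}_h):=\frac12\int_\Omega\mathbb A^{-1}(\widehat{\boldsymbol q}_h-\mathbb A\nabla u_h)\cdot(\widehat{\boldsymbol q}_h-\mathbb A\nabla u_h)\ \le\ C\int_\Omega\mathbb A\nabla(u-u_h)\cdot\nabla(u-u_h)=C\,|||u-u_h|||^2 .$$ -/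

import Mathlib

open MeasureTheory
open scoped ContDiff RealInnerProductSpace

noncomputable section

namespace HybridFlux

/-- The Euclidean plane. -/
abbrev Plane := EuclideanSpace ℝ (Fin 2)

/-! ### Triangles, edges, affine shape functions, normals

A (closed) triangle or edge is represented by the finite set of its vertices; the point set is the
convex hull of the vertices. -/

/-- The closed triangle or edge with the given vertices. -/
def hull (s : Finset Plane) : Set Plane := convexHull ℝ (s : Set Plane)

/-- The three edges of a triangle. -/
def edgesOf (K : Finset Plane) : Finset (Finset Plane) := K.powersetCard 2

/-- The length of an edge. -/
def edgeLength (e : Finset Plane) : ℝ := Metric.diam (e : Set Plane)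

/-- The arc length measure on an edge. -/
def edgeMeasure (e : Finset Plane) : Measure Plane := (Measure.hausdorffMeasure 1).restrict (hull e)

open Classical in
/-- The affine function equal to `1` at the vertex `i` of `K` and to `0` at the other vertices. On
the triangle `K` it is the P1 basis function of the node `i`. -/
def shape (K : Finset Plane) (i : Plane) : Plane →ᵃ[ℝ] ℝ :=
  if h : ∃ ℓ : Plane →ᵃ[ℝ] ℝ, ∀ j ∈ K, ℓ j = if j = i then 1 else 0 then h.choose else 0

/-- The (constant) gradient of `shape K i`. -/
def shapeGrad (K : Finset Plane) (i : Plane) : Plane := gradient (fun x => shape K i x) 0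

open Classical in
/-- The unit normal on the edge `e` of the triangle `K`, pointing out of `K`: the normalized opposite
of the gradient of the affine function that vanishes on `e` and is `1` at the opposite vertex. -/
def outerNormal (K e : Finset Plane) : Plane :=
  -((‖∑ i ∈ K \ e, shapeGrad K i‖)⁻¹ • ∑ i ∈ K \ e, shapeGrad K i)

open Classical in
theorem shape_apply {K : Finset Plane} (hK : AffineIndependent ℝ ((↑) : K → Plane))
    (i : Plane) {j : Plane} (hj : j ∈ K) : shape K i j = if j = i then 1 else 0 := by
  have h : ∃ ℓ : Plane →ᵃ[ℝ] ℝ, ∀ j ∈ K, ℓ j = if j = i then 1 else 0 := by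
    by_cases hi : i ∈ K
    · obtain ⟨t, hst, ht, htop⟩ := exists_subset_affineIndependent_affineSpan_eq_top
        (k := ℝ) (V := Plane) (P := Plane) (s := (K : Set Plane)) hK
      let b : AffineBasis t ℝ Plane := ⟨(↑), ht, by simpa using htop⟩
      refine ⟨b.coord ⟨i, hst hi⟩, fun k hk => ?_⟩
      have := b.coord_apply ⟨i, hst hi⟩ ⟨k, hst hk⟩
      have hb : b ⟨k, hst hk⟩ = k := rfl
      rw [hb] at this
      rw [this]
      by_cases hki : k = i
      · simp [hki]
      · have : i ≠ k := fun h => hki h.symm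
        simp [hki, this]
    · refine ⟨0, fun k hk => ?_⟩
      have : k ≠ i := fun h => hi (h ▸ hk)
      simp [this]
  unfold shape
  rw [dif_pos h]
  exact h.choose_spec j hj

theorem inner_shapeGrad (K : Finset Plane) (i x y : Plane) :
    ⟪shapeGrad K i, x - y⟫ = shape K i x - shape K i y := by
  have hd : HasFDerivAt (fun x => shape K i x)
      ((shape K i).linear.toContinuousLinearMap) (0 : Plane) := by
    have := ((shape K i).linear.toContinuousLinearMap).hasFDerivAt (x := (0 : Plane))
    have h2 := this.add_const (shape K i 0)
    refine h2.congr_of_eventuallyEq (Filter.Eventually.of_forall fun z => ?_)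
    have := (shape K i).linearMap_vsub z 0
    simp only [vsub_eq_sub, sub_zero] at this
    simp [this]
  rw [shapeGrad, inner_gradient_left, hd.fderiv]
  have := (shape K i).linearMap_vsub x y
  simpa using this

/-- `outerNormal K e` has norm one, is orthogonal to the edge, and points away from the third
vertex. -/
theorem outerNormal_spec {a b c : Plane} (hab : a ≠ b) (hac : a ≠ c) (hbc : b ≠ c)
    (K e : Finset Plane) (hKe : ∀ x, x ∈ K ↔ x = a ∨ x = b ∨ x = c)
    (he : ∀ x, x ∈ e ↔ x = a ∨ x = b) (hK : AffineIndependent ℝ ((↑) : K → Plane)) :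
    ‖outerNormal K e‖ = 1 ∧ ⟪outerNormal K e, b - a⟫ = 0 ∧ ⟪outerNormal K e, c - a⟫ < 0 := by
  classical
  have hs : K \ e = {c} := by
    ext x
    simp only [Finset.mem_sdiff, hKe, he, Finset.mem_singleton]
    constructor
    · rintro ⟨h | h | h, h'⟩ <;> simp_all
    · rintro rfl
      exact ⟨Or.inr (Or.inr rfl), fun h => h.elim (fun h => hac h.symm) (fun h => hbc h.symm)⟩
  have hn : outerNormal K e = -((‖shapeGrad K c‖)⁻¹ • shapeGrad K c) := by
    unfold outerNormal
    rw [hs, Finset.sum_singleton]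
  have h1 : shape K c a = 0 := by
    rw [shape_apply hK c ((hKe a).2 (Or.inl rfl)), if_neg hac]
  have h2 : shape K c b = 0 := by
    rw [shape_apply hK c ((hKe b).2 (Or.inr (Or.inl rfl))), if_neg hbc]
  have h3 : shape K c c = 1 := by
    rw [shape_apply hK c ((hKe c).2 (Or.inr (Or.inr rfl))), if_pos rfl]
  have hca := inner_shapeGrad K c c a
  have hba := inner_shapeGrad K c b a
  rw [h3, h1] at hca
  rw [h2, h1] at hba
  have hne : shapeGrad K c ≠ 0 := by
    intro h
    rw [h] at hca
    simp at hca
  have hpos : 0 < ‖shapeGrad K c‖ := norm_pos_iff.2 hne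
  rw [hn]
  refine ⟨?_, ?_, ?_⟩
  · rw [norm_neg, norm_smul, norm_inv, norm_norm, inv_mul_cancel₀ hpos.ne']
  · rw [inner_neg_left, real_inner_smul_left, hba]
    simp
  · rw [inner_neg_left, real_inner_smul_left, hca]
    have := inv_pos.2 hpos
    linarith

/-! ### Triangular meshes -/

/-- A conforming triangular mesh: a finite set of nondegenerate triangles, two of which meet at most
in a common vertex or a common edge. -/
structure TriMesh where
  /-- the elements of the mesh -/
  elems : Finset (Finset Plane)
  card_eq : ∀ K ∈ elems, K.card = 3
  indep : ∀ K ∈ elems, AffineIndependent ℝ ((↑) : K → Plane)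
  conforming : ∀ K ∈ elems, ∀ J ∈ elems,
    hull K ∩ hull J ⊆ convexHull ℝ ((K : Set Plane) ∩ (J : Set Plane))

/-- The open set that is partitioned by the mesh. -/
def TriMesh.domain (T : TriMesh) : Set Plane := interior (⋃ K ∈ T.elems, hull K)

open Classical in
/-- The edges of the mesh. -/
def TriMesh.edges (T : TriMesh) : Finset (Finset Plane) := T.elems.biUnion edgesOf

open Classical in
/-- The elements that have `e` as an edge. -/
def TriMesh.adj (T : TriMesh) (e : Finset Plane) : Finset (Finset Plane) :=
  {K ∈ T.elems | e ∈ edgesOf K}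

open Classical in
/-- The edges on the boundary of the domain: those that belong to a single element. -/
def TriMesh.boundaryEdges (T : TriMesh) : Finset (Finset Plane) :=
  {e ∈ T.edges | (T.adj e).card = 1}

/-- The diameter of the largest disk contained in the triangle `K`. -/
def inDiam (K : Finset Plane) : ℝ :=
  sSup {d : ℝ | 0 ≤ d ∧ ∃ c : Plane, Metric.closedBall c (d / 2) ⊆ hull K}

/-- Mesh regularity: `h_K / ρ_K ≤ γ₀` for every element, `h_K` being the diameter of `K` and `ρ_K`
the diameter of its largest inscribed disk. -/
def TriMesh.IsRegular (T : TriMesh) (γ₀ : ℝ) : Prop :=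
  ∀ K ∈ T.elems, Metric.diam (hull K) ≤ γ₀ * inDiam K

/-! ### Sobolev functions, traces, weak divergence, normal traces -/

/-- `G` is the weak gradient of `v` on the open set `U`. -/
def HasWeakGradient (U : Set Plane) (v : Plane → ℝ) (G : Plane → Plane) : Prop :=
  ∀ ψ : Plane → ℝ, ContDiff ℝ ∞ ψ → HasCompactSupport ψ → tsupport ψ ⊆ U → ∀ c : Plane,
    ∫ x in U, v x * fderiv ℝ ψ x c = -∫ x in U, ⟪G x, c⟫ * ψ x

/-- A function of `H¹(U)` together with its weak gradient. -/
structure H1 (U : Set Plane) where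
  /-- the function -/
  val : Plane → ℝ
  /-- its weak gradient -/
  grad : Plane → Plane
  memLp_val : MemLp val 2 (volume.restrict U)
  memLp_grad : MemLp grad 2 (volume.restrict U)
  weak : HasWeakGradient U val grad

/-- `t ∈ L²(∂Ω)` is the trace on `∂Ω` of `v ∈ H¹(Ω)`, `Ω` being the domain of the mesh. The trace is
characterized by Green's formula
`∫_Ω (v ∂_c ψ + (∇v · c) ψ) = ∫_{∂Ω} t ψ (c · n)` for smooth `ψ` and constant vectors `c`. For a
boundary edge `e`, the inner sum has one term: the element that contains `e`. -/
def IsTrace (T : TriMesh) (v : H1 T.domain) (t : Plane → ℝ) : Prop :=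
  (∀ e ∈ T.boundaryEdges, MemLp t 2 (edgeMeasure e)) ∧
  ∀ ψ : Plane → ℝ, ContDiff ℝ ∞ ψ → ∀ c : Plane,
    ∫ x in T.domain, (v.val x * fderiv ℝ ψ x c + ⟪v.grad x, c⟫ * ψ x) =
      ∑ e ∈ T.boundaryEdges, ∑ K ∈ T.adj e,
        ∫ x, t x * ψ x * ⟪c, outerNormal K e⟫ ∂(edgeMeasure e)

/-- `div q = d` in the interior of the triangle `K`, in the weak sense. -/
def HasWeakDiv (K : Finset Plane) (q : Plane → Plane) (d : Plane → ℝ) : Prop :=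
  ∀ ψ : Plane → ℝ, ContDiff ℝ ∞ ψ → HasCompactSupport ψ → tsupport ψ ⊆ interior (hull K) →
    ∫ x in hull K, ⟪q x, gradient ψ x⟫ = -∫ x in hull K, d x * ψ x

/-- The field `q ∈ H(div, K)` with `div q = d` satisfies `q · n_K = t e` on each edge `e` of the
triangle `K`. The normal trace is characterized by Green's formula
`∫_K (q · ∇ψ + (div q) ψ) = ∫_{∂K} (q · n_K) ψ` for smooth `ψ`. -/
def HasNormalTrace (K : Finset Plane) (q : Plane → Plane) (d : Plane → ℝ)
    (t : Finset Plane → Plane → ℝ) : Prop :=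
  ∀ ψ : Plane → ℝ, ContDiff ℝ ∞ ψ →
    ∫ x in hull K, (⟪q x, gradient ψ x⟫ + d x * ψ x) =
      ∑ e ∈ edgesOf K, ∫ x, t e x * ψ x ∂(edgeMeasure e)

/-! ### The diffusion problem and its P1 approximation

`ΓD` and `ΓN` are sets of boundary edges; their unions are the Dirichlet and Neumann parts of the
boundary. -/

/-- The Neumann edges: the boundary edges that are not Dirichlet edges. -/
def TriMesh.neumannEdges (T : TriMesh) (ΓD : Finset (Finset Plane)) : Finset (Finset Plane) :=
  open Classical in T.boundaryEdges \ ΓD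

/-- `A` is a measurable symmetric matrix field on `U`, with
`a_min |ξ|² ≤ A(x) ξ · ξ ≤ a_max |ξ|²` almost everywhere. -/
structure IsDiffusionTensor (U : Set Plane) (aMin aMax : ℝ) (A : Plane → Plane →L[ℝ] Plane) :
    Prop where
  meas : AEStronglyMeasurable A (volume.restrict U)
  symm : ∀ᵐ x ∂(volume.restrict U), ∀ ξ η : Plane, ⟪A x ξ, η⟫ = ⟪ξ, A x η⟫
  lower : ∀ᵐ x ∂(volume.restrict U), ∀ ξ : Plane, aMin * ‖ξ‖ ^ 2 ≤ ⟪A x ξ, ξ⟫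
  upper : ∀ᵐ x ∂(volume.restrict U), ∀ ξ : Plane, ⟪A x ξ, ξ⟫ ≤ aMax * ‖ξ‖ ^ 2

/-- `f` is constant on each triangle. -/
def IsElementwiseConstant (T : TriMesh) (f : Plane → ℝ) : Prop :=
  ∀ K ∈ T.elems, ∃ c : ℝ, ∀ᵐ x ∂(volume.restrict (hull K)), f x = c

/-- `g` is affine on each edge of the given set. -/
def IsEdgewiseAffine (S : Finset (Finset Plane)) (g : Plane → ℝ) : Prop :=
  ∀ e ∈ S, ∃ ℓ : Plane →ᵃ[ℝ] ℝ, ∀ᵐ x ∂(edgeMeasure e), g x = ℓ x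

/-- `v` belongs to `V = {v ∈ H¹(Ω), v = 0 on ΓD}`, and `t` is its trace. -/
def MemV (T : TriMesh) (ΓD : Finset (Finset Plane)) (v : H1 T.domain) (t : Plane → ℝ) : Prop :=
  IsTrace T v t ∧ ∀ e ∈ ΓD, ∀ᵐ x ∂(edgeMeasure e), t x = 0

/-- `u ∈ V` and `∫_Ω A∇u · ∇v = ∫_Ω f v + ∫_ΓN g v` for all `v ∈ V`. -/
def IsWeakSolution (T : TriMesh) (ΓD : Finset (Finset Plane)) (A : Plane → Plane →L[ℝ] Plane)
    (f g : Plane → ℝ) (u : H1 T.domain) : Prop :=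
  (∃ t, MemV T ΓD u t) ∧
  ∀ (v : H1 T.domain) (t : Plane → ℝ), MemV T ΓD v t →
    ∫ x in T.domain, ⟪A x (u.grad x), v.grad x⟫ =
      (∫ x in T.domain, f x * v.val x) +
        ∑ e ∈ T.neumannEdges ΓD, ∫ x, g x * t x ∂(edgeMeasure e)

/-- `v` belongs to the P1 finite element space: it is affine on each closed triangle (hence continuous
on the closure of the domain) and vanishes on the Dirichlet edges. -/
def MemP1 (T : TriMesh) (ΓD : Finset (Finset Plane)) (v : Plane → ℝ) : Prop :=
  (∀ K ∈ T.elems, ∃ ℓ : Plane →ᵃ[ℝ] ℝ, ∀ x ∈ hull K, v x = ℓ x) ∧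
  ∀ e ∈ ΓD, ∀ x ∈ hull e, v x = 0

/-- `u_h` is the P1 finite element solution. The classical gradient of a P1 function exists at
interior points of the triangles, hence almost everywhere. -/
def IsFESolution (T : TriMesh) (ΓD : Finset (Finset Plane)) (A : Plane → Plane →L[ℝ] Plane)
    (f g : Plane → ℝ) (uh : Plane → ℝ) : Prop :=
  MemP1 T ΓD uh ∧
  ∀ v : Plane → ℝ, MemP1 T ΓD v →
    ∫ x in T.domain, ⟪A x (gradient uh x), gradient v x⟫ =
      (∫ x in T.domain, f x * v x) +
        ∑ e ∈ T.neumannEdges ΓD, ∫ x, g x * v x ∂(edgeMeasure e)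

/-- The finite element flux `q_h = A∇u_h`. -/
def feFlux (A : Plane → Plane →L[ℝ] Plane) (uh : Plane → ℝ) (x : Plane) : Plane :=
  A x (gradient uh x)

/-- `‖|p|‖²_{q,S} = ∫_S A⁻¹ p · p`. -/
def fluxNormSq (A : Plane → Plane →L[ℝ] Plane) (S : Set Plane) (p : Plane → Plane) : ℝ :=
  ∫ x in S, ⟪(A x).inverse (p x), p x⟫

/-- `E²_CRE(u_h, q̂) = ½ ‖|q̂ - A∇u_h|‖²_q`. -/
def creSq (T : TriMesh) (A : Plane → Plane →L[ℝ] Plane) (uh : Plane → ℝ) (qhat : Plane → Plane) :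
    ℝ :=
  (1 / 2) * fluxNormSq A T.domain (fun x => qhat x - feFlux A uh x)

/-- `‖|u - u_h|‖² = ∫_Ω A∇(u - u_h) · ∇(u - u_h)`. -/
def energyErrorSq (T : TriMesh) (A : Plane → Plane →L[ℝ] Plane) (u : H1 T.domain)
    (uh : Plane → ℝ) : ℝ :=
  ∫ x in T.domain, ⟪A x (u.grad x - gradient uh x), u.grad x - gradient uh x⟫

/-! ### The hybrid-flux construction -/

/-- `Q_i^K = ∫_K (q_h · ∇φ_i - f φ_i)`. -/
def nodalLoad (A : Plane → Plane →L[ℝ] Plane) (f uh : Plane → ℝ) (K : Finset Plane) (i : Plane) :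
    ℝ :=
  ∫ x in hull K, (⟪feFlux A uh x, shapeGrad K i⟫ - f x * shape K i x)

open Classical in
/-- The local system at the node `i` for the projections `b K e = ∫_e ĝ_K φ_i` of the tractions, `e`
running over the edges attached to `i` and `K` over the elements that contain `e`. The tractions on
the two sides of an interior edge are opposite, they are equal to `g` on Neumann edges, and in each
element attached to `i` the prolongation condition `∑_{e ⊂ ∂K} ∫_e ĝ_K φ_i = Q_i^K` holds (`φ_i`
vanishes on the edge of `K` opposite to `i`). -/
structure IsNodalSolution (T : TriMesh) (ΓD : Finset (Finset Plane))
    (A : Plane → Plane →L[ℝ] Plane) (f g uh : Plane → ℝ) (i : Plane)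
    (b : Finset Plane → Finset Plane → ℝ) : Prop where
  opposite : ∀ e ∈ T.edges, i ∈ e → ∀ K ∈ T.adj e, ∀ J ∈ T.adj e, K ≠ J → b J e = -b K e
  neumann : ∀ e ∈ T.neumannEdges ΓD, i ∈ e → ∀ K ∈ T.adj e,
    b K e = ∫ x, g x * shape K i x ∂(edgeMeasure e)
  prolongation : ∀ K ∈ T.elems, i ∈ K →
    ∑ e ∈ edgesOf K with i ∈ e, b K e = nodalLoad A f uh K i

/-- `b^m_{K,e}(i) = ∫_e φ_i m`, where `m` is the finite element normal flux on `e`, oriented by the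
outer normal of `K`, averaged over the elements that contain `e`: the half sum of the values from the
two sides on an interior edge, the value from `K` on a boundary edge. Here `qn J e` is the
(constant) value of `q_{h|J} · n_J` on `e`; note `n_J = -n_K` for `J ≠ K`. -/
def meanFlux (T : TriMesh) (qn : Finset Plane → Finset Plane → ℝ) (i : Plane)
    (K e : Finset Plane) : ℝ :=
  open Classical in
  ∫ x, shape K i x *
    (((T.adj e).card : ℝ)⁻¹ * ∑ J ∈ T.adj e, if J = K then qn J e else -qn J e) ∂(edgeMeasure e)

open Classical in
/-- The cost `∑_e (b_e - b^m_e(i))² / |e|²`, over the edges attached to the node `i`. For an interior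
edge, the values of `(b K e - b^m_{K,e}(i))²` from the two sides coincide for solutions of the local
system, and the average over the two sides is this common value. -/
def nodalCost (T : TriMesh) (qn : Finset Plane → Finset Plane → ℝ) (i : Plane)
    (b : Finset Plane → Finset Plane → ℝ) : ℝ :=
  ∑ e ∈ T.edges with i ∈ e,
    ((T.adj e).card : ℝ)⁻¹ * ∑ K ∈ T.adj e, (b K e - meanFlux T qn i K e) ^ 2 / edgeLength e ^ 2

/-- The tractions `ghat K e = ĝ_K` on the edges `e` of the elements `K` are the equilibrated tractions
of the hybrid-flux technique: at each node `i`, their projections are the solution of the local system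
that minimizes the cost; `ĝ_K` is equal to `g` on Neumann edges; on the other edges it is the linear
combination of the basis functions of the two endpoints that has the prescribed projections. -/
def IsEquilibratedTraction (T : TriMesh) (ΓD : Finset (Finset Plane))
    (A : Plane → Plane →L[ℝ] Plane) (f g uh : Plane → ℝ) (qn : Finset Plane → Finset Plane → ℝ)
    (ghat : Finset Plane → Finset Plane → Plane → ℝ) : Prop :=
  ∃ b : Plane → Finset Plane → Finset Plane → ℝ,
    (∀ K ∈ T.elems, ∀ i ∈ K, IsNodalSolution T ΓD A f g uh i (b i) ∧
      ∀ b' : Finset Plane → Finset Plane → ℝ, IsNodalSolution T ΓD A f g uh i b' →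
        nodalCost T qn i (b i) ≤ nodalCost T qn i b') ∧
    (∀ e ∈ T.neumannEdges ΓD, ∀ K ∈ T.adj e, ∀ x ∈ hull e, ghat K e x = g x) ∧
    (∀ e ∈ T.edges, e ∉ T.neumannEdges ΓD → ∀ K ∈ T.adj e,
      (∃ c : Plane → ℝ, ∀ x ∈ hull e, ghat K e x = ∑ j ∈ e, c j * shape K j x) ∧
      ∀ i ∈ e, ∫ x, ghat K e x * shape K i x ∂(edgeMeasure e) = b i K e)

/-- The field `p ∈ L²(K)²` solves the local Neumann problem
`-div p = f` in `K`, `p · n_K = ĝ_K` on `∂K`. -/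
def IsAdmissibleFlux (f : Plane → ℝ) (gK : Finset Plane → Plane → ℝ) (K : Finset Plane)
    (p : Plane → Plane) : Prop :=
  MemLp p 2 (volume.restrict (hull K)) ∧ HasWeakDiv K p (fun x => -f x) ∧
    HasNormalTrace K p (fun x => -f x) gK

/-- `qhat` is an equilibrated flux field constructed with the hybrid-flux technique: for some choice
of equilibrated tractions, it minimizes on each element `K` the distance to `q_h` in the norm
`‖|·|‖_{q,K}` among the solutions of the local Neumann problem. -/
def IsHybridFlux (T : TriMesh) (ΓD : Finset (Finset Plane)) (A : Plane → Plane →L[ℝ] Plane)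
    (f g uh : Plane → ℝ) (qn : Finset Plane → Finset Plane → ℝ) (qhat : Plane → Plane) : Prop :=
  ∃ ghat : Finset Plane → Finset Plane → Plane → ℝ,
    IsEquilibratedTraction T ΓD A f g uh qn ghat ∧
    ∀ K ∈ T.elems, IsAdmissibleFlux f (ghat K) K qhat ∧
      ∀ p : Plane → Plane, IsAdmissibleFlux f (ghat K) K p →
        fluxNormSq A (hull K) (fun x => qhat x - feFlux A uh x) ≤
          fluxNormSq A (hull K) (fun x => p x - feFlux A uh x)

end HybridFlux

end

open HybridFlux

/-!
On an element `K`, the flux `q_h` plus a field with affine components whose normal trace on each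
edge is the defect `ĝ_K - q_h · n_K` is admissible in the local minimization, so the distance from
`q̂_h` to `q_h` on `K` is at most the norm of that field, which scales like the moments of the
defect on the edges of `K`. At a node, these moments solve a linear system whose data are residuals
of `u_h` on the patch. By the minimality of the nodal cost they are comparable with any other
solution, and a patch of boundedly many elements has a solution bounded by the data, because the
system takes finitely many combinatorial forms. Testing the variational equation with bubble
functions of elements and edges bounds the residuals by the energy error on the patch. Shape
regularity bounds the number of elements of a patch, so the sum over all elements is at most a
constant times the global energy error.
-/

namespace HybridFlux

/-! ### Affine functions -/

section AffineFunctions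

variable {E : Type*} [NormedAddCommGroup E] [InnerProductSpace ℝ E]

theorem hasGradientAt_mul [CompleteSpace E] {f g : E → ℝ} {f' g' x : E}
    (hf : HasGradientAt f f' x) (hg : HasGradientAt g g' x) :
    HasGradientAt (fun y => f y * g y) (f x • g' + g x • f') x := by
  rw [hasGradientAt_iff_hasFDerivAt] at *
  rw [map_add, map_smul, map_smul]
  exact hf.mul hg

variable [FiniteDimensional ℝ E]

theorem hasFDerivAt_affineMap (l : E →ᵃ[ℝ] ℝ) (x : E) :
    HasFDerivAt (fun y => l y) l.linear.toContinuousLinearMap x := by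
  rw [show (fun y => l y) = fun y => l.linear.toContinuousLinearMap y + l 0 from l.decomp]
  exact l.linear.toContinuousLinearMap.hasFDerivAt.add_const (l 0)

theorem contDiff_affineMap (l : E →ᵃ[ℝ] ℝ) : ContDiff ℝ ∞ fun y => l y := by
  rw [show (fun y => l y) = fun y => l.linear.toContinuousLinearMap y + l 0 from l.decomp]
  fun_prop

theorem hasGradientAt_affineMap [CompleteSpace E] (l : E →ᵃ[ℝ] ℝ) (x : E) :
    HasGradientAt (fun y => l y)
      ((InnerProductSpace.toDual ℝ E).symm l.linear.toContinuousLinearMap) x :=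
  (hasFDerivAt_affineMap l x).hasGradientAt

end AffineFunctions

theorem hasGradientAt_shape (K : Finset Plane) (i x : Plane) :
    HasGradientAt (fun y => shape K i y) (shapeGrad K i) x := by
  rw [shapeGrad, (hasGradientAt_affineMap (shape K i) 0).gradient]
  exact hasGradientAt_affineMap _ x

theorem gradient_shape (K : Finset Plane) (i x : Plane) :
    gradient (fun y => shape K i y) x = shapeGrad K i :=
  (hasGradientAt_shape K i x).gradient

theorem contDiff_shape (K : Finset Plane) (i : Plane) : ContDiff ℝ ∞ fun x => shape K i x :=
  contDiff_affineMap _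

theorem continuous_shape (K : Finset Plane) (i : Plane) : Continuous fun x => shape K i x :=
  (contDiff_shape K i).continuous

theorem isCompact_hull (K : Finset Plane) : IsCompact (hull K) :=
  K.finite_toSet.isCompact_convexHull (𝕜 := ℝ)

theorem measurableSet_hull (K : Finset Plane) : MeasurableSet (hull K) :=
  (isCompact_hull K).isClosed.measurableSet

theorem integrableOn_hull_of_continuous {F : Plane → ℝ} (hF : Continuous F) (K : Finset Plane) :
    IntegrableOn F (hull K) :=
  hF.continuousOn.integrableOn_compact (isCompact_hull K)

/-! ### Barycentric coordinates -/

theorem real_inner_plane (x y : Plane) : ⟪x, y⟫ = x 0 * y 0 + x 1 * y 1 := by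
  simp only [PiLp.inner_apply, Fin.sum_univ_two, Real.inner_apply]

theorem norm_sq_plane (x : Plane) : ‖x‖ ^ 2 = x 0 ^ 2 + x 1 ^ 2 := by
  rw [EuclideanSpace.real_norm_sq_eq, Fin.sum_univ_two]

/-- The determinant of two vectors of the plane. -/
def cross (u v : Plane) : ℝ := u 0 * v 1 - u 1 * v 0

theorem exists_eq_smul_add_smul_of_cross_ne_zero {u v : Plane} (h : cross u v ≠ 0) (z : Plane) :
    ∃ s t : ℝ, z = s • u + t • v := by
  refine ⟨cross z v / cross u v, cross u z / cross u v, ?_⟩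
  ext i
  simp only [PiLp.add_apply, PiLp.smul_apply, smul_eq_mul]
  rw [div_mul_eq_mul_div, div_mul_eq_mul_div, ← add_div, eq_div_iff h]
  fin_cases i <;> simp only [cross, Fin.zero_eta, Fin.mk_one] <;> ring

/-- `K` is a nondegenerate triangle with vertices `a`, `b`, `c`. Naming the vertices in a chosen
order makes it possible to state facts for one edge or vertex and to obtain the others by
`IsTri.rotate` and `IsTri.swap`. -/
structure IsTri (K : Finset Plane) (a b c : Plane) : Prop where
  mem : ∀ x, x ∈ K ↔ x = a ∨ x = b ∨ x = c
  indep : AffineIndependent ℝ ((↑) : K → Plane)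
  ab : a ≠ b
  ac : a ≠ c
  bc : b ≠ c

theorem exists_isTri {K : Finset Plane} (h3 : K.card = 3)
    (hK : AffineIndependent ℝ ((↑) : K → Plane)) : ∃ a b c, IsTri K a b c := by
  obtain ⟨a, b, c, hab, hac, hbc, rfl⟩ := Finset.card_eq_three.1 h3
  exact ⟨a, b, c, by simp, hK, hab, hac, hbc⟩

/-- The point with barycentric coordinates `(1 - s - t, s, t)`. -/
def baryPoint (a b c : Plane) (s t : ℝ) : Plane := a + s • (b - a) + t • (c - a)

theorem continuous_baryPoint (a b c : Plane) :
    Continuous fun p : ℝ × ℝ => baryPoint a b c p.1 p.2 := by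
  unfold baryPoint; fun_prop

theorem apply_baryPoint (l : Plane →ᵃ[ℝ] ℝ) (a b c : Plane) (s t : ℝ) :
    l (baryPoint a b c s t) = (1 - s - t) * l a + s * l b + t * l c := by
  have h (x : Plane) : l x = l.linear x + l 0 := congrFun l.decomp x
  rw [h, h a, h b, h c, baryPoint]
  simp only [map_add, map_smul, map_sub, smul_eq_mul]
  ring

namespace IsTri

variable {K : Finset Plane} {a b c : Plane}

theorem rotate (h : IsTri K a b c) : IsTri K b c a :=
  ⟨fun x => by rw [h.mem x]; tauto, h.indep, h.bc, h.ab.symm, h.ac.symm⟩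

theorem swap (h : IsTri K a b c) : IsTri K b a c :=
  ⟨fun x => by rw [h.mem x]; tauto, h.indep, h.ab.symm, h.bc, h.ac⟩

theorem flip (h : IsTri K a b c) : IsTri K a c b := h.rotate.swap.rotate.rotate

theorem mem_a (h : IsTri K a b c) : a ∈ K := (h.mem a).2 (Or.inl rfl)

theorem mem_b (h : IsTri K a b c) : b ∈ K := h.rotate.mem_a

theorem mem_c (h : IsTri K a b c) : c ∈ K := h.rotate.rotate.mem_a

theorem eq (h : IsTri K a b c) : K = {a, b, c} := by
  ext x; simp [h.mem x]

theorem sum_eq {M : Type*} [AddCommMonoid M] (h : IsTri K a b c) (F : Plane → M) :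
    ∑ i ∈ K, F i = F a + (F b + F c) := by
  rw [h.eq, Finset.sum_insert (by simp [h.ab, h.ac]), Finset.sum_pair h.bc]

theorem shape_aa (h : IsTri K a b c) : shape K a a = 1 := by
  rw [shape_apply h.indep a h.mem_a, if_pos rfl]

theorem shape_ab (h : IsTri K a b c) : shape K a b = 0 := by
  rw [shape_apply h.indep a h.mem_b, if_neg h.ab.symm]

theorem shape_ac (h : IsTri K a b c) : shape K a c = 0 := by
  rw [shape_apply h.indep a h.mem_c, if_neg h.ac.symm]

theorem shape_a_bary (h : IsTri K a b c) (s t : ℝ) :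
    shape K a (baryPoint a b c s t) = 1 - s - t := by
  rw [apply_baryPoint, h.shape_aa, h.shape_ab, h.shape_ac]; ring

theorem shape_b_bary (h : IsTri K a b c) (s t : ℝ) :
    shape K b (baryPoint a b c s t) = s := by
  rw [apply_baryPoint, h.rotate.shape_aa, h.rotate.shape_ac, h.rotate.shape_ab]; ring

theorem shape_c_bary (h : IsTri K a b c) (s t : ℝ) :
    shape K c (baryPoint a b c s t) = t := by
  have h' := h.rotate.rotate
  rw [apply_baryPoint, h'.shape_aa, h'.shape_ab, h'.shape_ac]; ring

theorem shapeGrad_mul_cross (h : IsTri K a b c) :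
    shapeGrad K c 0 * cross (b - a) (c - a) = -(b - a) 1 ∧
      shapeGrad K c 1 * cross (b - a) (c - a) = (b - a) 0 := by
  have hba : ⟪shapeGrad K c, b - a⟫ = 0 := by
    rw [inner_shapeGrad, h.rotate.rotate.shape_ac, h.rotate.rotate.shape_ab, sub_self]
  have hca : ⟪shapeGrad K c, c - a⟫ = 1 := by
    rw [inner_shapeGrad, h.rotate.rotate.shape_aa, h.rotate.rotate.shape_ab, sub_zero]
  rw [real_inner_plane] at hba hca
  unfold cross
  constructor
  · linear_combination (c - a) 1 * hba - (b - a) 1 * hca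
  · linear_combination -(c - a) 0 * hba + (b - a) 0 * hca

theorem cross_ne_zero (h : IsTri K a b c) : cross (b - a) (c - a) ≠ 0 := by
  intro h0
  obtain ⟨h1, h2⟩ := h.shapeGrad_mul_cross
  rw [h0, mul_zero] at h1 h2
  refine h.ab (sub_eq_zero.1 ?_).symm
  ext i
  fin_cases i
  · exact h2.symm
  · exact neg_eq_zero.1 h1.symm

theorem exists_eq_smul_add_smul (h : IsTri K a b c) (z : Plane) :
    ∃ s t : ℝ, z = s • (b - a) + t • (c - a) :=
  exists_eq_smul_add_smul_of_cross_ne_zero h.cross_ne_zero z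

theorem norm_shapeGrad (h : IsTri K a b c) :
    ‖shapeGrad K c‖ * |cross (b - a) (c - a)| = ‖b - a‖ := by
  obtain ⟨h1, h2⟩ := h.shapeGrad_mul_cross
  refine (pow_left_inj₀ (by positivity) (by positivity) two_ne_zero).1 ?_
  rw [mul_pow, sq_abs, norm_sq_plane, norm_sq_plane, add_mul, ← mul_pow, ← mul_pow, h1, h2]
  ring

theorem mem_hull_iff (h : IsTri K a b c) {x : Plane} :
    x ∈ hull K ↔ ∃ s t : ℝ, 0 ≤ s ∧ 0 ≤ t ∧ s + t ≤ 1 ∧ baryPoint a b c s t = x := by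
  unfold hull
  rw [Finset.mem_convexHull']
  constructor
  · rintro ⟨w, hw, h1, rfl⟩
    rw [h.sum_eq] at h1
    refine ⟨w b, w c, hw b h.mem_b, hw c h.mem_c, ?_, ?_⟩
    · linarith [hw a h.mem_a]
    · rw [h.sum_eq, baryPoint]
      have : w a = 1 - w b - w c := by linarith
      rw [this]; module
  · rintro ⟨s, t, hs, ht, hst, rfl⟩
    classical
    have hb := h.ab.symm
    have hc := h.ac.symm
    have hcb := h.bc.symm
    refine ⟨fun x => if x = a then 1 - s - t else if x = b then s else t, ?_, ?_, ?_⟩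
    · intro y _
      dsimp only
      split_ifs <;> linarith
    · rw [h.sum_eq]; simp [hb, hc, hcb]
    · rw [h.sum_eq]; simp only [hb, hc, hcb, if_true, if_false, baryPoint]; module

end IsTri

/-! ### Integration on triangles -/

/-- The triangle of the parameters `(s, t)` for which `baryPoint a b c s t` lies in the triangle
`a b c`. -/
def refTri : Set (ℝ × ℝ) := {p | 0 ≤ p.1 ∧ 0 ≤ p.2 ∧ p.1 + p.2 ≤ 1}

theorem isClosed_refTri : IsClosed refTri :=
  (isClosed_le continuous_const continuous_fst).inter
    ((isClosed_le continuous_const continuous_snd).inter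
      (isClosed_le (continuous_fst.add continuous_snd) continuous_const))

theorem isCompact_refTri : IsCompact refTri := by
  refine (isCompact_Icc (a := ((0 : ℝ), (0 : ℝ))) (b := (1, 1))).of_isClosed_subset
    isClosed_refTri ?_
  rintro ⟨s, t⟩ ⟨h1, h2, h3⟩
  dsimp only at h1 h2 h3
  exact ⟨⟨h1, h2⟩, ⟨by simp only; linarith, by simp only; linarith⟩⟩

theorem indicator_refTri (H : ℝ × ℝ → ℝ) (s t : ℝ) :
    refTri.indicator H (s, t) =
      (Set.Icc 0 1).indicator (fun s => (Set.Icc 0 (1 - s)).indicator (fun t => H (s, t)) t) s := by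
  classical
  have hmem : (s, t) ∈ refTri ↔ s ∈ Set.Icc 0 1 ∧ t ∈ Set.Icc 0 (1 - s) := by
    simp only [refTri, Set.mem_ofPred_eq, Set.mem_Icc]
    constructor
    · rintro ⟨h1, h2, h3⟩
      exact ⟨⟨h1, by linarith⟩, h2, by linarith⟩
    · rintro ⟨⟨h1, _⟩, h2, h3⟩
      exact ⟨h1, h2, by linarith⟩
  simp only [Set.indicator_apply, hmem, ite_and]

theorem setIntegral_refTri {H : ℝ × ℝ → ℝ} (hH : Continuous H) :
    ∫ p in refTri, H p = ∫ s in (0 : ℝ)..1, ∫ t in (0 : ℝ)..(1 - s), H (s, t) := by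
  have hint : Integrable (refTri.indicator H) (volume.prod volume) := by
    rw [← Measure.volume_eq_prod, integrable_indicator_iff isClosed_refTri.measurableSet]
    exact hH.continuousOn.integrableOn_compact isCompact_refTri
  rw [← integral_indicator isClosed_refTri.measurableSet, Measure.volume_eq_prod,
    integral_prod _ hint, intervalIntegral.integral_of_le zero_le_one,
    ← integral_Icc_eq_integral_Ioc, ← integral_indicator measurableSet_Icc]
  congr 1 with s
  by_cases hs : s ∈ Set.Icc (0 : ℝ) 1
  · simp only [indicator_refTri, Set.indicator_of_mem hs]
    rw [intervalIntegral.integral_of_le (sub_nonneg.2 hs.2), ← integral_Icc_eq_integral_Ioc,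
      integral_indicator measurableSet_Icc]
  · simp only [indicator_refTri, Set.indicator_of_notMem hs, integral_zero]

/-- The measurable equivalence of `ℝ × ℝ` with the Euclidean plane. -/
def toPlane : ℝ × ℝ ≃ᵐ Plane :=
  MeasurableEquiv.finTwoArrow.symm.trans (MeasurableEquiv.toLp 2 (Fin 2 → ℝ))

theorem measurePreserving_toPlane : MeasurePreserving toPlane :=
  (EuclideanSpace.volume_preserving_symm_measurableEquiv_toLp (Fin 2)).symm.comp
    (volume_preserving_finTwoArrow ℝ).symm

/-- The linear map that sends the canonical basis to `u`, `v`. -/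
noncomputable def frameMap (u v : Plane) : Plane →L[ℝ] Plane :=
  (EuclideanSpace.proj (0 : Fin 2) : Plane →L[ℝ] ℝ).smulRight u +
    (EuclideanSpace.proj (1 : Fin 2) : Plane →L[ℝ] ℝ).smulRight v

theorem det_frameMap (u v : Plane) : (frameMap u v).det = cross u v := by
  have : (frameMap u v : Plane →ₗ[ℝ] Plane) =
      Matrix.toLin (EuclideanSpace.basisFun (Fin 2) ℝ).toBasis
        (EuclideanSpace.basisFun (Fin 2) ℝ).toBasis !![u 0, v 0; u 1, v 1] := by
    apply (EuclideanSpace.basisFun (Fin 2) ℝ).toBasis.ext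
    intro i
    rw [Matrix.toLin_self]
    ext j
    fin_cases i <;> fin_cases j <;> simp [frameMap]
  rw [ContinuousLinearMap.det, this, LinearMap.det_toLin, Matrix.det_fin_two_of, cross]
  ring

namespace IsTri

variable {K : Finset Plane} {a b c : Plane}

theorem hull_eq_image (h : IsTri K a b c) :
    hull K = (fun p => baryPoint a b c (p 0) (p 1)) '' (toPlane.symm ⁻¹' refTri) := by
  ext x
  rw [h.mem_hull_iff]
  constructor
  · rintro ⟨s, t, hs, ht, hst, rfl⟩
    exact ⟨toPlane (s, t), by simpa using ⟨hs, ht, hst⟩, rfl⟩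
  · rintro ⟨p, ⟨h1, h2, h3⟩, rfl⟩
    exact ⟨p 0, p 1, h1, h2, h3, rfl⟩

theorem injective_baryPoint (h : IsTri K a b c) :
    Function.Injective fun p : Plane => baryPoint a b c (p 0) (p 1) := by
  intro p q hpq
  have h1 := congrArg (shape K b) hpq
  have h2 := congrArg (shape K c) hpq
  simp only [h.shape_b_bary, h.shape_c_bary] at h1 h2
  ext i
  fin_cases i
  exacts [h1, h2]

theorem setIntegral_hull (h : IsTri K a b c) {F : Plane → ℝ} (hF : Continuous F) :
    ∫ x in hull K, F x = |cross (b - a) (c - a)| *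
      ∫ s in (0 : ℝ)..1, ∫ t in (0 : ℝ)..(1 - s), F (baryPoint a b c s t) := by
  have hderiv (p : Plane) : HasFDerivAt (fun p : Plane => baryPoint a b c (p 0) (p 1))
      (frameMap (b - a) (c - a)) p := by
    have := ((frameMap (b - a) (c - a)).hasFDerivAt (x := p)).const_add a
    simpa [baryPoint, frameMap, add_assoc] using this
  have hreference := setIntegral_refTri (hF.comp (continuous_baryPoint a b c))
  simp only [Function.comp_apply] at hreference
  rw [h.hull_eq_image, integral_image_eq_integral_abs_det_fderiv_smul volume
    (toPlane.symm.measurable isClosed_refTri.measurableSet)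
    (fun p _ => (hderiv p).hasFDerivWithinAt) h.injective_baryPoint.injOn]
  simp only [det_frameMap, smul_eq_mul]
  rw [integral_const_mul, ← hreference, ← measurePreserving_toPlane.setIntegral_preimage_emb
    toPlane.measurableEmbedding, ← Set.preimage_comp]
  simp only [MeasurableEquiv.symm_comp_self, Set.preimage_id]
  rfl

theorem two_mul_volume_hull (h : IsTri K a b c) :
    2 * volume.real (hull K) = |cross (b - a) (c - a)| := by
  have hint : ∫ s in (0 : ℝ)..1, (1 - s) = 1 / 2 := by
    rw [intervalIntegral.integral_sub (by simp) (by simp), intervalIntegral.integral_const,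
      integral_id]
    norm_num
  have := h.setIntegral_hull (F := fun _ => (1 : ℝ)) continuous_const
  simp only [setIntegral_const, smul_eq_mul, mul_one, intervalIntegral.integral_const,
    sub_zero, hint] at this
  rw [this]
  ring

theorem volume_hull_pos (h : IsTri K a b c) : 0 < volume.real (hull K) := by
  linarith [h.two_mul_volume_hull, abs_pos.2 h.cross_ne_zero]

end IsTri

/-! ### Integration on edges -/

theorem isometry_arcLength {E : Type*} [NormedAddCommGroup E] [NormedSpace ℝ E] {a b : E}
    (hab : a ≠ b) : Isometry fun s : ℝ => a + s • (‖b - a‖⁻¹ • (b - a)) := by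
  refine Isometry.of_dist_eq fun s t => ?_
  rw [dist_eq_norm, add_sub_add_left_eq_sub, ← sub_smul, norm_smul, norm_smul, norm_inv, norm_norm,
    inv_mul_cancel₀ (norm_ne_zero_iff.2 (sub_ne_zero.2 hab.symm)), mul_one, Real.dist_eq,
    Real.norm_eq_abs]

theorem hull_pair_eq_image {a b : Plane} (hab : a ≠ b) :
    hull {a, b} = (fun s : ℝ => a + s • (‖b - a‖⁻¹ • (b - a))) '' Set.Icc 0 ‖b - a‖ := by
  have hL : 0 < ‖b - a‖ := norm_pos_iff.2 (sub_ne_zero.2 hab.symm)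
  rw [hull, Finset.coe_pair, convexHull_pair, segment_eq_image']
  ext x
  constructor
  · rintro ⟨θ, ⟨h0, h1⟩, rfl⟩
    refine ⟨θ * ‖b - a‖, ⟨by positivity, by nlinarith⟩, ?_⟩
    simp only [smul_smul]
    rw [mul_assoc, mul_inv_cancel₀ hL.ne', mul_one]
  · rintro ⟨s, ⟨h0, h1⟩, rfl⟩
    refine ⟨s / ‖b - a‖, ⟨by positivity, by rwa [div_le_one hL]⟩, ?_⟩
    simp only [smul_smul, div_eq_mul_inv]

theorem edgeMeasure_pair {a b : Plane} (hab : a ≠ b) :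
    edgeMeasure {a, b} = Measure.map (fun s : ℝ => a + s • (‖b - a‖⁻¹ • (b - a)))
      (volume.restrict (Set.Icc 0 ‖b - a‖)) := by
  have hiso := isometry_arcLength hab
  have himg := hull_pair_eq_image hab
  set ι : ℝ → Plane := fun s : ℝ => a + s • (‖b - a‖⁻¹ • (b - a))
  have hmeas := measurableSet_hull {a, b}
  have hpre : ι ⁻¹' hull {a, b} = Set.Icc 0 ‖b - a‖ := by
    rw [himg, Set.preimage_image_eq _ hiso.injective]
  rw [← hpre, ← Measure.restrict_map hiso.continuous.measurable hmeas, ← hausdorffMeasure_real,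
    hiso.map_hausdorffMeasure (Or.inl zero_le_one), Measure.restrict_restrict hmeas,
    Set.inter_eq_left.2, edgeMeasure]
  rw [himg]; exact Set.image_subset_range _ _

theorem exists_pair_of_mem_edgesOf {K e : Finset Plane} (he : e ∈ edgesOf K) :
    ∃ a b, a ∈ K ∧ b ∈ K ∧ a ≠ b ∧ e = {a, b} := by
  rw [edgesOf, Finset.mem_powersetCard] at he
  obtain ⟨a, b, hab, rfl⟩ := Finset.card_eq_two.1 he.2
  exact ⟨a, b, he.1 (by simp), he.1 (by simp), hab, by congr!⟩

theorem isFiniteMeasure_edgeMeasure {K e : Finset Plane} (he : e ∈ edgesOf K) :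
    IsFiniteMeasure (edgeMeasure e) := by
  obtain ⟨a, b, _, _, hab, rfl⟩ := exists_pair_of_mem_edgesOf he
  rw [edgeMeasure_pair hab]
  infer_instance

theorem integrable_edgeMeasure {K e : Finset Plane} (he : e ∈ edgesOf K) {F : Plane → ℝ}
    (hF : Continuous F) : Integrable F (edgeMeasure e) := by
  have := isFiniteMeasure_edgeMeasure he
  have h := hF.continuousOn.integrableOn_compact (μ := edgeMeasure e) (isCompact_hull e)
  rwa [IntegrableOn, edgeMeasure, Measure.restrict_restrict (measurableSet_hull e),
    Set.inter_self] at h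

theorem ae_edgeMeasure_mem (e : Finset Plane) : ∀ᵐ x ∂(edgeMeasure e), x ∈ hull e :=
  ae_restrict_mem (measurableSet_hull e)

theorem integral_edge {a b : Plane} (hab : a ≠ b) (F : Plane → ℝ) :
    ∫ x, F x ∂(edgeMeasure {a, b}) = ‖b - a‖ * ∫ s in (0 : ℝ)..1, F (a + s • (b - a)) := by
  have hL : 0 < ‖b - a‖ := norm_pos_iff.2 (sub_ne_zero.2 hab.symm)
  rw [edgeMeasure_pair hab,
    (isometry_arcLength hab).isClosedEmbedding.measurableEmbedding.integral_map,
    integral_Icc_eq_integral_Ioc, ← intervalIntegral.integral_of_le hL.le]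
  have hscale := intervalIntegral.mul_integral_comp_mul_right
    (f := fun s => F (a + s • (‖b - a‖⁻¹ • (b - a)))) (a := 0) (b := 1) ‖b - a‖
  rw [zero_mul, one_mul] at hscale
  rw [← hscale]
  congr 2
  ext s
  rw [smul_smul, mul_assoc, mul_inv_cancel₀ hL.ne', mul_one]

theorem edgeLength_pair (a b : Plane) : edgeLength {a, b} = ‖b - a‖ := by
  rw [edgeLength, Finset.coe_pair, Metric.diam_pair, dist_comm, dist_eq_norm]

theorem integral_edge_eq_zero {e : Finset Plane} {F : Plane → ℝ} (h : ∀ x ∈ hull e, F x = 0) :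
    ∫ x, F x ∂(edgeMeasure e) = 0 := by
  rw [edgeMeasure]
  exact setIntegral_eq_zero_of_forall_eq_zero h

theorem mem_hull_pair_iff {a b : Plane} (c : Plane) {x : Plane} :
    x ∈ hull {a, b} ↔ ∃ s ∈ Set.Icc (0 : ℝ) 1, baryPoint a b c s 0 = x := by
  rw [hull, Finset.coe_pair, convexHull_pair, segment_eq_image']
  simp only [baryPoint, zero_smul, add_zero, Set.mem_image]

namespace IsTri

variable {K : Finset Plane} {a b c : Plane}

theorem edgesOf_eq (h : IsTri K a b c) : edgesOf K = {{a, b}, {b, c}, {a, c}} := by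
  rw [edgesOf, h.eq, Finset.powersetCard_succ_insert (by simp [h.ab, h.ac]),
    Finset.powersetCard_succ_insert (by simp [h.bc])]
  ext e
  simp [Finset.powersetCard_one, Finset.powersetCard_eq_empty.2]

theorem sum_edgesOf {M : Type*} [AddCommMonoid M] (h : IsTri K a b c) (G : Finset Plane → M) :
    ∑ e ∈ edgesOf K, G e = G {a, b} + (G {b, c} + G {a, c}) := by
  have hc : c ∉ ({a, b} : Finset Plane) := by simp [h.ac.symm, h.bc.symm]
  have hb : b ∉ ({a, c} : Finset Plane) := by simp [h.ab.symm, h.bc]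
  rw [h.edgesOf_eq, Finset.sum_insert, Finset.sum_pair]
  · exact fun he => hb (he ▸ by simp)
  · simp only [Finset.mem_insert, Finset.mem_singleton, not_or]
    exact ⟨fun he => hc (he ▸ by simp), fun he => hc (he ▸ by simp)⟩

theorem mem_edgesOf (h : IsTri K a b c) : {a, b} ∈ edgesOf K := by
  rw [h.edgesOf_eq]; simp

theorem norm_sub_pos (h : IsTri K a b c) : 0 < ‖b - a‖ :=
  norm_pos_iff.2 (sub_ne_zero.2 h.ab.symm)

theorem shape_edge (h : IsTri K a b c) {x : Plane} (hx : x ∈ hull {a, b}) : shape K c x = 0 := by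
  obtain ⟨s, _, rfl⟩ := (mem_hull_pair_iff c).1 hx
  exact h.shape_c_bary _ _

end IsTri

/-! ### Gauss' formula on a triangle -/

theorem integral_fderiv_baryPoint {F : Plane → ℝ} (hF : ContDiff ℝ 1 F) (a b c : Plane) (s : ℝ) :
    ∫ t in (0 : ℝ)..(1 - s), fderiv ℝ F (baryPoint a b c s t) (c - a) =
      F (c + s • (b - c)) - F (a + s • (b - a)) := by
  have hderiv (t : ℝ) : HasDerivAt (fun t => F (baryPoint a b c s t))
      (fderiv ℝ F (baryPoint a b c s t) (c - a)) t := by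
    have h1 : HasDerivAt (fun t : ℝ => baryPoint a b c s t) (c - a) t := by
      unfold baryPoint
      simpa using ((hasDerivAt_id t).smul_const (c - a)).const_add (a + s • (b - a))
    exact ((hF.differentiable one_ne_zero _).hasFDerivAt).comp_hasDerivAt t h1
  have hcont : Continuous fun t => fderiv ℝ F (baryPoint a b c s t) (c - a) := by
    have := hF.continuous_fderiv one_ne_zero
    unfold baryPoint
    fun_prop
  rw [intervalIntegral.integral_eq_sub_of_hasDerivAt (fun t _ => hderiv t)
    (hcont.intervalIntegrable _ _)]
  congr 2 <;> unfold baryPoint <;> module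

namespace IsTri

variable {K : Finset Plane} {a b c : Plane}

theorem setIntegral_fderiv_eq_intervalIntegral (h : IsTri K a b c) {F : Plane → ℝ}
    (hF : ContDiff ℝ 1 F) :
    ∫ x in hull K, fderiv ℝ F x (c - a) = 2 * volume.real (hull K) *
      ((∫ s in (0 : ℝ)..1, F (b + s • (c - b))) - ∫ s in (0 : ℝ)..1, F (a + s • (b - a))) := by
  have hFc := hF.continuous
  have hderiv : Continuous fun x => fderiv ℝ F x (c - a) := by
    have := hF.continuous_fderiv one_ne_zero
    fun_prop
  have hreverse : ∫ s in (0 : ℝ)..1, F (c + s • (b - c)) =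
      ∫ s in (0 : ℝ)..1, F (b + s • (c - b)) := by
    have := intervalIntegral.integral_comp_sub_left (fun s => F (c + s • (b - c)))
      (a := 0) (b := 1) 1
    simp only [sub_zero, sub_self] at this
    rw [← this]
    congr 1 with s
    congr 1
    module
  rw [h.setIntegral_hull hderiv, h.two_mul_volume_hull]
  simp only [integral_fderiv_baryPoint hF]
  rw [intervalIntegral.integral_sub (Continuous.intervalIntegrable (by fun_prop) _ _)
    (Continuous.intervalIntegrable (by fun_prop) _ _), hreverse]

theorem setIntegral_fderiv_eq_integral_edge (h : IsTri K a b c) {F : Plane → ℝ}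
    (hF : ContDiff ℝ 1 F) :
    ∫ x in hull K, fderiv ℝ F x (c - a) = 2 * volume.real (hull K) *
      (‖c - b‖⁻¹ * (∫ x, F x ∂(edgeMeasure {b, c})) -
        ‖b - a‖⁻¹ * ∫ x, F x ∂(edgeMeasure {a, b})) := by
  rw [h.setIntegral_fderiv_eq_intervalIntegral hF, integral_edge h.bc, integral_edge h.ab,
    inv_mul_cancel_left₀ h.rotate.norm_sub_pos.ne', inv_mul_cancel_left₀ h.norm_sub_pos.ne']

theorem outerNormal_eq (h : IsTri K a b c) :
    outerNormal K {a, b} = -((‖shapeGrad K c‖)⁻¹ • shapeGrad K c) := by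
  have hs : K \ {a, b} = {c} := by
    ext x
    simp only [Finset.mem_sdiff, h.mem, Finset.mem_insert, Finset.mem_singleton]
    have h1 := h.ac.symm
    have h2 := h.bc.symm
    constructor
    · tauto
    · rintro rfl; tauto
  rw [outerNormal, hs, Finset.sum_singleton]

theorem inner_sub_outerNormal_eq_zero (h : IsTri K a b c) : ⟪b - a, outerNormal K {a, b}⟫ = 0 := by
  have h' := h.rotate.rotate
  rw [h.outerNormal_eq, inner_neg_right, real_inner_smul_right, real_inner_comm, inner_shapeGrad,
    h'.shape_ac, h'.shape_ab, sub_self, mul_zero, neg_zero]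

theorem inner_sub_outerNormal (h : IsTri K a b c) :
    ⟪c - a, outerNormal K {a, b}⟫ = -(2 * volume.real (hull K) * ‖b - a‖⁻¹) := by
  have h' := h.rotate.rotate
  have hL := h.norm_sub_pos
  have hc := abs_pos.2 h.cross_ne_zero
  have hgrad : ‖shapeGrad K c‖ = ‖b - a‖ / |cross (b - a) (c - a)| := by
    rw [eq_div_iff hc.ne', h.norm_shapeGrad]
  rw [h.outerNormal_eq, inner_neg_right, real_inner_smul_right, real_inner_comm, inner_shapeGrad,
    h'.shape_aa, h'.shape_ab, h.two_mul_volume_hull, hgrad]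
  field_simp
  ring

theorem setIntegral_fderiv_sub (h : IsTri K a b c) {F : Plane → ℝ} (hF : ContDiff ℝ 1 F) :
    ∫ x in hull K, fderiv ℝ F x (c - a) =
      ∑ e ∈ edgesOf K, (∫ x, F x ∂(edgeMeasure e)) * ⟪c - a, outerNormal K e⟫ := by
  have hbc : ⟪c - a, outerNormal K {b, c}⟫ = 2 * volume.real (hull K) * ‖c - b‖⁻¹ := by
    rw [← sub_sub_sub_cancel_right c a b, inner_sub_left, h.rotate.inner_sub_outerNormal,
      h.rotate.inner_sub_outerNormal_eq_zero]
    ring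
  rw [h.setIntegral_fderiv_eq_integral_edge hF, h.sum_edgesOf, hbc,
    h.flip.inner_sub_outerNormal_eq_zero, h.inner_sub_outerNormal]
  ring

theorem setIntegral_fderiv (h : IsTri K a b c) {F : Plane → ℝ} (hF : ContDiff ℝ 1 F) (z : Plane) :
    ∫ x in hull K, fderiv ℝ F x z =
      ∑ e ∈ edgesOf K, ∫ x, F x * ⟪z, outerNormal K e⟫ ∂(edgeMeasure e) := by
  obtain ⟨s, t, rfl⟩ := h.exists_eq_smul_add_smul z
  have hint (w : Plane) : IntegrableOn (fun x => fderiv ℝ F x w) (hull K) :=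
    integrableOn_hull_of_continuous
      ((hF.continuous_fderiv one_ne_zero).clm_apply continuous_const) K
  simp only [integral_mul_const]
  simp only [map_add, map_smul, smul_eq_mul, inner_add_left, real_inner_smul_left, mul_add,
    Finset.sum_add_distrib]
  rw [integral_add ((hint _).const_mul _) ((hint _).const_mul _), integral_const_mul,
    integral_const_mul, h.setIntegral_fderiv_sub hF, h.flip.setIntegral_fderiv_sub hF,
    Finset.mul_sum, Finset.mul_sum]
  congr 1 <;> exact Finset.sum_congr rfl fun e _ => by ring

end IsTri

/-! ### Bubble functions -/

/-- A function on the triangle `K` that vanishes on the edges other than `{i, j}` and has the same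
integral as the shape function of `i` against every affine function on the edge `{i, j}`; the
numbers `8` and `2` are forced by this last property. -/
noncomputable def edgeBubble (K : Finset Plane) (i j : Plane) (x : Plane) : ℝ :=
  shape K i x * shape K j x * (8 * shape K i x - 2 * shape K j x)

/-- The cubic bubble function of the triangle with vertices `i`, `j`, `k`, which vanishes on its
boundary. -/
noncomputable def triBubble (K : Finset Plane) (i j k : Plane) (x : Plane) : ℝ :=
  shape K i x * shape K j x * shape K k x

theorem contDiff_edgeBubble (K : Finset Plane) (i j : Plane) :
    ContDiff ℝ ∞ (edgeBubble K i j) := by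
  have h1 := contDiff_shape K i
  have h2 := contDiff_shape K j
  unfold edgeBubble
  fun_prop

theorem contDiff_triBubble (K : Finset Plane) (i j k : Plane) :
    ContDiff ℝ ∞ (triBubble K i j k) := by
  have h1 := contDiff_shape K i
  have h2 := contDiff_shape K j
  have h3 := contDiff_shape K k
  unfold triBubble
  fun_prop

theorem intervalIntegral_eq_of_eq_quartic {F : ℝ → ℝ} (c₀ c₁ c₂ c₃ c₄ : ℝ)
    (hF : ∀ s, F s = c₀ + c₁ * s + c₂ * s ^ 2 + c₃ * s ^ 3 + c₄ * s ^ 4) (x : ℝ) :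
    ∫ s in (0 : ℝ)..x, F s =
      c₀ * x + c₁ / 2 * x ^ 2 + c₂ / 3 * x ^ 3 + c₃ / 4 * x ^ 4 + c₄ / 5 * x ^ 5 := by
  have hderiv (s : ℝ) : HasDerivAt (fun s : ℝ => c₀ * s + c₁ / 2 * s ^ 2 + c₂ / 3 * s ^ 3 +
      c₃ / 4 * s ^ 4 + c₄ / 5 * s ^ 5)
      (c₀ + c₁ * s + c₂ * s ^ 2 + c₃ * s ^ 3 + c₄ * s ^ 4) s := by
    have := (((((hasDerivAt_id s).const_mul c₀).add ((hasDerivAt_pow 2 s).const_mul (c₁ / 2))).add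
      ((hasDerivAt_pow 3 s).const_mul (c₂ / 3))).add
      ((hasDerivAt_pow 4 s).const_mul (c₃ / 4))).add ((hasDerivAt_pow 5 s).const_mul (c₄ / 5))
    convert! this using 1
    norm_num
    ring
  rw [funext hF, intervalIntegral.integral_eq_sub_of_hasDerivAt (fun s _ => hderiv s)
    (Continuous.intervalIntegrable (by fun_prop) _ _)]
  ring

namespace IsTri

variable {K : Finset Plane} {a b c : Plane}

theorem shape_mem_Icc (h : IsTri K a b c) {x : Plane} (hx : x ∈ hull K) :
    shape K a x ∈ Set.Icc (0 : ℝ) 1 := by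
  obtain ⟨s, t, hs, ht, hst, rfl⟩ := h.mem_hull_iff.1 hx
  rw [h.shape_a_bary]
  constructor <;> linarith

theorem integral_shape (h : IsTri K a b c) :
    ∫ x in hull K, shape K a x = volume.real (hull K) / 3 := by
  rw [h.setIntegral_hull (continuous_shape K a), ← h.two_mul_volume_hull]
  simp only [h.shape_a_bary]
  have hinner (s : ℝ) := intervalIntegral_eq_of_eq_quartic (F := fun t => 1 - s - t)
    (1 - s) (-1) 0 0 0 (fun t => by ring) (1 - s)
  simp only [hinner]
  rw [intervalIntegral_eq_of_eq_quartic (1 / 2) (-1) (1 / 2) 0 0 (fun s => by ring)]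
  ring

theorem integral_triBubble (h : IsTri K a b c) :
    ∫ x in hull K, triBubble K a b c x = volume.real (hull K) / 60 := by
  rw [h.setIntegral_hull (contDiff_triBubble K a b c).continuous, ← h.two_mul_volume_hull]
  simp only [triBubble, h.shape_a_bary, h.shape_b_bary, h.shape_c_bary]
  have hinner (s : ℝ) := intervalIntegral_eq_of_eq_quartic (F := fun t => (1 - s - t) * s * t)
    0 ((1 - s) * s) (-s) 0 0 (fun t => by ring) (1 - s)
  simp only [hinner]
  rw [intervalIntegral_eq_of_eq_quartic 0 (1 / 6) (-1 / 2) (1 / 2) (-1 / 6) (fun s => by ring)]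
  ring

theorem integral_edge_eq_baryPoint (h : IsTri K a b c) (F : Plane → ℝ) :
    ∫ x, F x ∂(edgeMeasure {a, b}) =
      ‖b - a‖ * ∫ s in (0 : ℝ)..1, F (baryPoint a b c s 0) := by
  simp only [integral_edge h.ab, baryPoint, zero_smul, add_zero]

theorem integral_edge_affine_shape (h : IsTri K a b c) (l : Plane →ᵃ[ℝ] ℝ) :
    ∫ x, l x * shape K a x ∂(edgeMeasure {a, b}) = ‖b - a‖ * (l a / 3 + l b / 6) := by
  rw [h.integral_edge_eq_baryPoint]
  simp only [h.shape_a_bary, apply_baryPoint]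
  rw [intervalIntegral_eq_of_eq_quartic (l a) (l b - 2 * l a) (l a - l b) 0 0 (fun s => by ring)]
  ring

theorem integral_edge_shape (h : IsTri K a b c) :
    ∫ x, shape K a x ∂(edgeMeasure {a, b}) = ‖b - a‖ / 2 := by
  have := h.integral_edge_affine_shape (AffineMap.const ℝ Plane 1)
  simp only [AffineMap.const_apply, one_mul] at this
  rw [this]
  ring

theorem integral_edge_affine_edgeBubble (h : IsTri K a b c) (l : Plane →ᵃ[ℝ] ℝ) :
    ∫ x, l x * edgeBubble K a b x ∂(edgeMeasure {a, b}) =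
      ∫ x, l x * shape K a x ∂(edgeMeasure {a, b}) := by
  rw [h.integral_edge_affine_shape, h.integral_edge_eq_baryPoint]
  simp only [edgeBubble, h.shape_a_bary, h.shape_b_bary, apply_baryPoint]
  rw [intervalIntegral_eq_of_eq_quartic 0 (8 * l a) (8 * l b - 26 * l a) (28 * l a - 18 * l b)
    (10 * l b - 10 * l a) (fun s => by ring)]
  ring

theorem integral_edge_edgeBubble (h : IsTri K a b c) :
    ∫ x, edgeBubble K a b x ∂(edgeMeasure {a, b}) = ‖b - a‖ / 2 := by
  have := h.integral_edge_affine_edgeBubble (AffineMap.const ℝ Plane 1)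
  simpa only [AffineMap.const_apply, one_mul, h.integral_edge_shape] using this

theorem abs_eight_mul_shape_sub_le (h : IsTri K a b c) {x : Plane} (hx : x ∈ hull K) :
    |8 * shape K a x - 2 * shape K b x| ≤ 8 := by
  obtain ⟨ha0, ha1⟩ := h.shape_mem_Icc hx
  obtain ⟨hb0, hb1⟩ := h.rotate.shape_mem_Icc hx
  rw [abs_le]; constructor <;> linarith

theorem abs_edgeBubble_le (h : IsTri K a b c) {x : Plane} (hx : x ∈ hull K) :
    |edgeBubble K a b x| ≤ 8 := by
  obtain ⟨ha0, ha1⟩ := h.shape_mem_Icc hx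
  obtain ⟨hb0, hb1⟩ := h.rotate.shape_mem_Icc hx
  rw [edgeBubble, abs_mul, abs_mul, abs_of_nonneg ha0, abs_of_nonneg hb0]
  calc shape K a x * shape K b x * |8 * shape K a x - 2 * shape K b x| ≤ 1 * 1 * 8 := by
        gcongr; exact h.abs_eight_mul_shape_sub_le hx
    _ = 8 := by norm_num

theorem norm_shape_smul_add_le (h : IsTri K a b c) {G : ℝ} (ha : ‖shapeGrad K a‖ ≤ G)
    (hb : ‖shapeGrad K b‖ ≤ G) {x : Plane} (hx : x ∈ hull K) :
    ‖shape K a x • shapeGrad K b + shape K b x • shapeGrad K a‖ ≤ 2 * G := by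
  obtain ⟨ha0, ha1⟩ := h.shape_mem_Icc hx
  obtain ⟨hb0, hb1⟩ := h.rotate.shape_mem_Icc hx
  refine (norm_add_le _ _).trans ?_
  rw [norm_smul, norm_smul, Real.norm_of_nonneg ha0, Real.norm_of_nonneg hb0]
  nlinarith [norm_nonneg (shapeGrad K a), norm_nonneg (shapeGrad K b)]

theorem norm_gradient_edgeBubble_le (h : IsTri K a b c) {G : ℝ} (ha : ‖shapeGrad K a‖ ≤ G)
    (hb : ‖shapeGrad K b‖ ≤ G) {x : Plane} (hx : x ∈ hull K) :
    ‖gradient (edgeBubble K a b) x‖ ≤ 26 * G := by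
  obtain ⟨ha0, ha1⟩ := h.shape_mem_Icc hx
  obtain ⟨hb0, hb1⟩ := h.rotate.shape_mem_Icc hx
  have hA := hasGradientAt_shape K a x
  have hB := hasGradientAt_shape K b x
  have hC : HasGradientAt (fun y => 8 * shape K a y - 2 * shape K b y)
      ((8 : ℝ) • shapeGrad K a - (2 : ℝ) • shapeGrad K b) x := by
    rw [hasGradientAt_iff_hasFDerivAt] at *
    rw [map_sub, map_smul, map_smul]
    exact (hA.const_mul 8).sub (hB.const_mul 2)
  have hC_le : ‖(8 : ℝ) • shapeGrad K a - (2 : ℝ) • shapeGrad K b‖ ≤ 10 * G := by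
    refine (norm_sub_le _ _).trans ?_
    rw [norm_smul, norm_smul]
    norm_num
    linarith
  have hgrad : gradient (edgeBubble K a b) x = _ :=
    (hasGradientAt_mul (hasGradientAt_mul hA hB) hC).gradient
  rw [hgrad]
  refine (norm_add_le _ _).trans ?_
  rw [norm_smul, norm_smul, Real.norm_eq_abs, Real.norm_eq_abs, abs_mul, abs_of_nonneg ha0,
    abs_of_nonneg hb0]
  calc _ ≤ 1 * 1 * (10 * G) + 8 * (2 * G) := by
        gcongr
        · exact h.abs_eight_mul_shape_sub_le hx
        · exact h.norm_shape_smul_add_le ha hb hx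
    _ = 26 * G := by ring

theorem norm_gradient_triBubble_le (h : IsTri K a b c) {G : ℝ} (ha : ‖shapeGrad K a‖ ≤ G)
    (hb : ‖shapeGrad K b‖ ≤ G) (hc : ‖shapeGrad K c‖ ≤ G) {x : Plane} (hx : x ∈ hull K) :
    ‖gradient (triBubble K a b c) x‖ ≤ 3 * G := by
  obtain ⟨ha0, ha1⟩ := h.shape_mem_Icc hx
  obtain ⟨hb0, hb1⟩ := h.rotate.shape_mem_Icc hx
  obtain ⟨hc0, hc1⟩ := h.rotate.rotate.shape_mem_Icc hx
  have hgrad : gradient (triBubble K a b c) x = _ :=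
    (hasGradientAt_mul (hasGradientAt_mul (hasGradientAt_shape K a x) (hasGradientAt_shape K b x))
      (hasGradientAt_shape K c x)).gradient
  rw [hgrad]
  refine (norm_add_le _ _).trans ?_
  rw [norm_smul, norm_smul, Real.norm_eq_abs, Real.norm_eq_abs, abs_mul, abs_of_nonneg ha0,
    abs_of_nonneg hb0, abs_of_nonneg hc0]
  calc _ ≤ 1 * 1 * G + 1 * (2 * G) := by gcongr; exact h.norm_shape_smul_add_le ha hb hx
    _ = 3 * G := by ring

/-! ### Shape regularity -/

theorem norm_shapeGrad_mul_volume (h : IsTri K a b c) :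
    ‖shapeGrad K c‖ * (2 * volume.real (hull K)) = ‖b - a‖ := by
  rw [h.two_mul_volume_hull, h.norm_shapeGrad]

theorem norm_sub_le_diam (h : IsTri K a b c) : ‖b - a‖ ≤ Metric.diam (hull K) := by
  rw [← dist_eq_norm]
  exact Metric.dist_le_diam_of_mem (isCompact_hull K).isBounded
    (subset_convexHull ℝ _ h.mem_b) (subset_convexHull ℝ _ h.mem_a)

theorem two_mul_volume_hull_le (h : IsTri K a b c) :
    2 * volume.real (hull K) ≤ ‖b - a‖ * Metric.diam (hull K) := by
  rw [h.two_mul_volume_hull]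
  refine le_trans ?_ (mul_le_mul_of_nonneg_left h.flip.norm_sub_le_diam (norm_nonneg _))
  apply abs_le_of_sq_le_sq _ (by positivity)
  rw [mul_pow, norm_sq_plane, norm_sq_plane, cross]
  nlinarith [sq_nonneg ((b - a) 0 * (c - a) 0 + (b - a) 1 * (c - a) 1)]

theorem diam_hull_le (h : IsTri K a b c) {M : ℝ}
    (hM : Metric.diam (hull K) ^ 2 ≤ M * volume.real (hull K)) :
    Metric.diam (hull K) ≤ M / 2 * ‖b - a‖ := by
  have hvol := h.two_mul_volume_hull_le
  have hvol_pos := h.volume_hull_pos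
  have hdiam : 0 < Metric.diam (hull K) := h.norm_sub_pos.trans_le h.norm_sub_le_diam
  have hM0 : 0 ≤ M := by
    by_contra! hneg
    nlinarith
  by_contra! hlt
  nlinarith [mul_le_mul_of_nonneg_left hvol hM0]

theorem two_le_of_diam_sq_le (h : IsTri K a b c) {M : ℝ}
    (hM : Metric.diam (hull K) ^ 2 ≤ M * volume.real (hull K)) : 2 ≤ M := by
  have hdiam := h.diam_hull_le hM
  have hL := h.norm_sub_pos
  have hL_le := h.norm_sub_le_diam
  by_contra! hlt
  nlinarith

theorem norm_shapeGrad_le (h : IsTri K a b c) {M : ℝ}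
    (hM : Metric.diam (hull K) ^ 2 ≤ M * volume.real (hull K)) :
    ‖shapeGrad K c‖ ≤ √(M / (4 * volume.real (hull K))) := by
  apply Real.le_sqrt_of_sq_le
  have hvol := h.volume_hull_pos
  rw [le_div_iff₀ (by positivity)]
  have hL : ‖b - a‖ ^ 2 ≤ M * volume.real (hull K) :=
    (pow_le_pow_left₀ (norm_nonneg _) h.norm_sub_le_diam 2).trans hM
  rw [← h.norm_shapeGrad_mul_volume] at hL
  refine le_of_mul_le_mul_right (a := volume.real (hull K)) ?_ hvol
  nlinarith

end IsTri

/-- The constant that bounds `h_K² / |K|` when `h_K / ρ_K ≤ γ₀`. All estimates depend on the shape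
of the triangles only through this ratio. -/
noncomputable def areaConst (γ₀ : ℝ) : ℝ := 4 * γ₀ ^ 2 / Real.pi

theorem inDiam_nonneg (K : Finset Plane) : 0 ≤ inDiam K :=
  Real.sSup_nonneg fun _ hd => hd.1

theorem inDiam_sq_le (K : Finset Plane) :
    inDiam K ^ 2 ≤ 4 / Real.pi * volume.real (hull K) := by
  have hpi := Real.pi_pos
  have hbound : ∀ d ∈ {d : ℝ | 0 ≤ d ∧ ∃ c : Plane, Metric.closedBall c (d / 2) ⊆ hull K},
      d ≤ √(4 / Real.pi * volume.real (hull K)) := by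
    rintro d ⟨hd, c, hc⟩
    apply Real.le_sqrt_of_sq_le
    have hvol : volume.real (Metric.closedBall c (d / 2)) ≤ volume.real (hull K) :=
      measureReal_mono hc (isCompact_hull K).measure_lt_top.ne
    have hdisk : volume.real (Metric.closedBall c (d / 2)) = (d / 2) ^ 2 * Real.pi := by
      rw [measureReal_def, EuclideanSpace.volume_closedBall_fin_two]
      simp [ENNReal.toReal_ofReal (by positivity : 0 ≤ d / 2), hpi.le]
    rw [hdisk] at hvol
    rw [div_mul_eq_mul_div, le_div_iff₀ hpi]
    nlinarith
  calc inDiam K ^ 2 ≤ √(4 / Real.pi * volume.real (hull K)) ^ 2 :=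
        pow_le_pow_left₀ (inDiam_nonneg K) (Real.sSup_le hbound (Real.sqrt_nonneg _)) 2
    _ = _ := Real.sq_sqrt (by positivity)

theorem TriMesh.IsRegular.diam_sq_le {T : TriMesh} {γ₀ : ℝ} (h : T.IsRegular γ₀)
    {K : Finset Plane} (hK : K ∈ T.elems) :
    Metric.diam (hull K) ^ 2 ≤ areaConst γ₀ * volume.real (hull K) := by
  calc Metric.diam (hull K) ^ 2 ≤ (γ₀ * inDiam K) ^ 2 :=
        pow_le_pow_left₀ Metric.diam_nonneg (h K hK) 2
    _ = γ₀ ^ 2 * inDiam K ^ 2 := by ring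
    _ ≤ γ₀ ^ 2 * (4 / Real.pi * volume.real (hull K)) := by gcongr; exact inDiam_sq_le K
    _ = _ := by unfold areaConst; ring

/-! ### Conforming meshes -/

theorem exists_isTri_of_mem {K : Finset Plane} (h3 : K.card = 3)
    (hK : AffineIndependent ℝ ((↑) : K → Plane)) {a : Plane} (ha : a ∈ K) :
    ∃ b c, IsTri K a b c := by
  obtain ⟨x, y, z, h⟩ := exists_isTri h3 hK
  rcases (h.mem a).1 ha with rfl | rfl | rfl
  exacts [⟨_, _, h⟩, ⟨_, _, h.rotate⟩, ⟨_, _, h.rotate.rotate⟩]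

theorem exists_isTri_of_pair {K : Finset Plane} (h3 : K.card = 3)
    (hK : AffineIndependent ℝ ((↑) : K → Plane)) {a b : Plane} (ha : a ∈ K) (hb : b ∈ K)
    (hab : a ≠ b) : ∃ c, IsTri K a b c := by
  obtain ⟨y, z, h⟩ := exists_isTri_of_mem h3 hK ha
  rcases (h.mem b).1 hb with rfl | rfl | rfl
  exacts [absurd rfl hab, ⟨_, h⟩, ⟨_, h.flip⟩]

namespace TriMesh

variable {T : TriMesh} {K J e : Finset Plane}

theorem exists_isTri (T : TriMesh) (hK : K ∈ T.elems) : ∃ a b c, IsTri K a b c :=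
  HybridFlux.exists_isTri (T.card_eq K hK) (T.indep K hK)

theorem mem_adj : K ∈ T.adj e ↔ K ∈ T.elems ∧ e ∈ edgesOf K := by
  simp [adj]

theorem mem_edges : e ∈ T.edges ↔ ∃ K ∈ T.elems, e ∈ edgesOf K := by
  simp [edges]

theorem mem_boundaryEdges : e ∈ T.boundaryEdges ↔ e ∈ T.edges ∧ (T.adj e).card = 1 := by
  simp [boundaryEdges]

theorem exists_isTri_of_mem_adj {a b : Plane} (hab : a ≠ b) (hK : K ∈ T.adj {a, b}) :
    ∃ c, IsTri K a b c := by
  obtain ⟨hK, he⟩ := mem_adj.1 hK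
  have hsub := (Finset.mem_powersetCard.1 he).1
  exact exists_isTri_of_pair (T.card_eq K hK) (T.indep K hK) (hsub (by simp)) (hsub (by simp)) hab

theorem isOpen_domain (T : TriMesh) : IsOpen T.domain := isOpen_interior

theorem hull_le_domain (hK : K ∈ T.elems) : hull K ≤ᵐ[volume] T.domain := by
  have h0 : volume (frontier (hull K)) = 0 := (convex_convexHull ℝ _).addHaar_frontier volume
  rw [ae_le_set]
  refine measure_mono_null (fun x hx => ?_) h0
  refine ⟨subset_closure hx.1, fun hi => hx.2 ?_⟩
  exact interior_mono (Set.subset_biUnion_of_mem (u := fun K => hull K) hK) hi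

theorem restrict_hull_le (hK : K ∈ T.elems) :
    volume.restrict (hull K) ≤ volume.restrict T.domain :=
  Measure.restrict_mono_ae (hull_le_domain hK)

theorem domain_ae_eq (T : TriMesh) : (T.domain : Set Plane) =ᵐ[volume] ⋃ K : T.elems, hull K := by
  refine Filter.EventuallyLE.antisymm ?_ ?_
  · rw [Set.iUnion_subtype]
    exact LE.le.eventuallyLE (interior_subset (X := Plane))
  · have hle : ∀ K : T.elems, hull (K : Finset Plane) ≤ᵐ[volume] T.domain :=
      fun K => hull_le_domain K.2
    filter_upwards [ae_all_iff.2 hle] with x hx hmem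
    obtain ⟨K, hxK⟩ := Set.mem_iUnion.1 hmem
    exact hx K hxK

end TriMesh

theorem volume_shape_eq_zero {K : Finset Plane} {a b c : Plane} (h : IsTri K a b c) :
    volume {x | shape K a x = 0} = 0 := by
  set H : AffineSubspace ℝ Plane := (AffineSubspace.mk' (0 : ℝ) ⊥).comap (shape K a)
  have hH : {x | shape K a x = 0} = (H : Set Plane) := by
    ext x; simp [H]
  rw [hH]
  apply Measure.addHaar_affineSubspace
  intro htop
  have ha : a ∈ H := htop ▸ AffineSubspace.mem_top ℝ Plane a
  simp [H, h.shape_aa] at ha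

theorem convex_shape_eq_zero (K : Finset Plane) (a : Plane) :
    Convex ℝ {x | shape K a x = 0} :=
  (convex_singleton (𝕜 := ℝ) (0 : ℝ)).affine_preimage (shape K a)

namespace TriMesh

variable {T : TriMesh} {K J e : Finset Plane}

theorem shape_eq_zero_of_notMem (hK : K ∈ T.elems) (hJ : J ∈ T.elems) {i x : Plane}
    (hi : i ∉ J) (hx : x ∈ hull K ∩ hull J) : shape K i x = 0 := by
  refine convexHull_min ?_ (convex_shape_eq_zero K i) (T.conforming K hK J hJ hx)
  rintro y ⟨hyK, hyJ⟩
  have hyi : y ≠ i := fun h => hi (h ▸ hyJ)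
  exact (shape_apply (T.indep K hK) i hyK).trans (if_neg hyi)

theorem volume_inter (hK : K ∈ T.elems) (hJ : J ∈ T.elems) (hne : K ≠ J) :
    volume (hull K ∩ hull J) = 0 := by
  have hsub : ¬ K ⊆ J := fun hs => hne (Finset.eq_of_subset_of_card_le hs
    (by rw [T.card_eq K hK, T.card_eq J hJ]))
  obtain ⟨a, haK, haJ⟩ := Finset.not_subset.1 hsub
  obtain ⟨b, c, h⟩ := exists_isTri_of_mem (T.card_eq K hK) (T.indep K hK) haK
  exact measure_mono_null (fun x hx => shape_eq_zero_of_notMem hK hJ haJ hx)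
    (volume_shape_eq_zero h)

theorem integral_domain {F : Plane → ℝ} (hF : ∀ K ∈ T.elems, IntegrableOn F (hull K)) :
    ∫ x in T.domain, F x = ∑ K ∈ T.elems, ∫ x in hull K, F x := by
  rw [setIntegral_congr_set (domain_ae_eq T), integral_iUnion_ae, tsum_fintype,
    Finset.sum_coe_sort T.elems fun K => ∫ x in hull K, F x]
  · exact fun K => (measurableSet_hull _).nullMeasurableSet
  · intro K J hne
    exact volume_inter K.2 J.2 fun h => hne (Subtype.ext h)
  · exact integrableOn_finite_iUnion.2 fun K => hF K K.2

theorem integral_domain_indicator (hK : K ∈ T.elems) (F : Plane → ℝ) :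
    ∫ x in T.domain, (hull K).indicator F x = ∫ x in hull K, F x := by
  rw [setIntegral_indicator (measurableSet_hull K)]
  apply setIntegral_congr_set
  refine Filter.EventuallyLE.antisymm (Filter.Eventually.of_forall fun x hx => hx.2) ?_
  filter_upwards [hull_le_domain hK] with x hx h
  exact ⟨hx h, h⟩

end TriMesh

/-! ### Elements sharing an edge -/

theorem IsTri.exists_baryPoint_mem_inter {K J : Finset Plane} {a b c d : Plane}
    (h : IsTri K a b c) (h' : IsTri J a b d) (hd : 0 ≤ shape K c d) :
    ∃ s ε : ℝ, 0 < ε ∧ baryPoint a b d s ε ∈ hull K ∩ hull J := by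
  obtain ⟨s, t, hst⟩ := h.exists_eq_smul_add_smul (d - a)
  obtain rfl : d = baryPoint a b c s t := by
    rw [baryPoint, add_assoc, ← hst, add_sub_cancel]
  rw [h.shape_c_bary] at hd
  set ε : ℝ := (2 * (1 + |s| + |t|))⁻¹ with hε
  have hε0 : 0 < ε := by positivity
  have hε1 : ε * (1 + |s| + |t|) = 1 / 2 := by
    have : 0 < 1 + |s| + |t| := by positivity
    rw [hε]; field_simp
  have hs := abs_le.1 (le_refl |s|)
  have ht := abs_le.1 (le_refl |t|)
  have hle : ε ≤ 1 / 2 := by nlinarith [abs_nonneg s, abs_nonneg t]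
  have hx : baryPoint a b (baryPoint a b c s t) ((1 - ε) / 2) ε =
      baryPoint a b c ((1 - ε) / 2 + ε * s) (ε * t) := by
    unfold baryPoint; module
  refine ⟨(1 - ε) / 2, ε, hε0, ?_, ?_⟩
  · rw [hx]
    exact h.mem_hull_iff.2 ⟨_, _, by nlinarith [abs_nonneg s, abs_nonneg t], by positivity,
      by nlinarith [abs_nonneg s, abs_nonneg t], rfl⟩
  · exact h'.mem_hull_iff.2 ⟨_, _, by linarith, hε0.le, by linarith, rfl⟩

theorem IsTri.shapeGrad_eq_smul {K J : Finset Plane} {a b c d : Plane} (h : IsTri K a b c)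
    (h' : IsTri J a b d) : shapeGrad K c = shape K c d • shapeGrad J d := by
  refine ext_inner_right ℝ fun z => ?_
  obtain ⟨s, t, rfl⟩ := h'.exists_eq_smul_add_smul z
  rw [real_inner_smul_left]
  simp only [inner_add_right, real_inner_smul_right, inner_shapeGrad, h.rotate.rotate.shape_ab,
    h.rotate.rotate.shape_ac, h'.rotate.rotate.shape_aa, h'.rotate.rotate.shape_ab,
    h'.rotate.rotate.shape_ac]
  ring

namespace TriMesh

variable {T : TriMesh} {K J e : Finset Plane}

theorem shape_neg_of_adjacent (hK : K ∈ T.elems) (hJ : J ∈ T.elems) (hne : K ≠ J) {a b c d : Plane}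
    (h : IsTri K a b c) (h' : IsTri J a b d) : shape K c d < 0 := by
  by_contra! hd
  obtain ⟨s, ε, hε, hxK, hxJ⟩ := h.exists_baryPoint_mem_inter h' hd
  have hdK : d ∉ K := by
    intro hdK
    rcases (h.mem d).1 hdK with rfl | rfl | rfl
    · exact h'.ac rfl
    · exact h'.bc rfl
    · exact hne (by rw [h.eq, h'.eq])
  have hzero := shape_eq_zero_of_notMem hJ hK hdK ⟨hxJ, hxK⟩
  rw [h'.shape_c_bary] at hzero
  exact hε.ne' hzero

theorem outerNormal_neg (hK : K ∈ T.adj e) (hJ : J ∈ T.adj e) (hne : K ≠ J) :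
    outerNormal J e = -outerNormal K e := by
  obtain ⟨a, b, _, _, hab, rfl⟩ := exists_pair_of_mem_edgesOf (mem_adj.1 hK).2
  obtain ⟨c, h⟩ := exists_isTri_of_mem_adj hab hK
  obtain ⟨d, h'⟩ := exists_isTri_of_mem_adj hab hJ
  have ht := shape_neg_of_adjacent (mem_adj.1 hK).1 (mem_adj.1 hJ).1 hne h h'
  have hcoef : (-shape K c d * ‖shapeGrad J d‖)⁻¹ * shape K c d = -‖shapeGrad J d‖⁻¹ := by
    have := ht.ne
    by_cases h0 : ‖shapeGrad J d‖ = 0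
    · simp [h0]
    · field_simp
  rw [h.outerNormal_eq, h'.outerNormal_eq, h.shapeGrad_eq_smul h', norm_smul, Real.norm_eq_abs,
    abs_of_neg ht, smul_smul, hcoef, neg_smul, neg_neg]

theorem norm_outerNormal (hK : K ∈ T.adj e) : ‖outerNormal K e‖ = 1 := by
  obtain ⟨a, b, _, _, hab, rfl⟩ := exists_pair_of_mem_edgesOf (mem_adj.1 hK).2
  obtain ⟨c, h⟩ := exists_isTri_of_mem_adj hab hK
  exact (outerNormal_spec h.ab h.ac h.bc K _ h.mem (by simp) h.indep).1

theorem card_adj_le (T : TriMesh) (e : Finset Plane) : (T.adj e).card ≤ 2 := by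
  by_contra! h
  obtain ⟨K, hK, J, hJ, I, hI, hKJ, hKI, hJI⟩ := Finset.two_lt_card.1 h
  have hself : outerNormal I e = -outerNormal I e := by
    conv_lhs => rw [outerNormal_neg hJ hI hJI, outerNormal_neg hK hJ hKJ, neg_neg]
    rw [outerNormal_neg hK hI hKI, neg_neg]
  have : IsAddTorsionFree Plane := .of_module_rat Plane
  have hnorm := norm_outerNormal hI
  rw [self_eq_neg.1 hself, norm_zero] at hnorm
  exact zero_ne_one hnorm

/-! ### Edges meeting other simplices of the mesh -/

theorem hull_inter_hull_subset {s t : Finset Plane} (hK : K ∈ T.elems) (hJ : J ∈ T.elems)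
    (hs : s ⊆ K) (ht : t ⊆ J) : hull s ∩ hull t ⊆ hull (s ∩ t) := by
  rintro x ⟨hxs, hxt⟩
  unfold hull at *
  have hKJ : x ∈ convexHull ℝ ((K ∩ J : Finset Plane) : Set Plane) := by
    rw [Finset.coe_inter]
    exact T.conforming K hK J hJ ⟨convexHull_mono (Finset.coe_subset.2 hs) hxs,
      convexHull_mono (Finset.coe_subset.2 ht) hxt⟩
  have hsKJ : x ∈ convexHull ℝ ((s ∩ (K ∩ J) : Finset Plane) : Set Plane) := by
    rw [Finset.coe_inter, (T.indep K hK).convexHull_inter hs Finset.inter_subset_left]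
    exact ⟨hxs, hKJ⟩
  have hall : x ∈ convexHull ℝ (((s ∩ (K ∩ J)) ∩ t : Finset Plane) : Set Plane) := by
    rw [Finset.coe_inter, (T.indep J hJ).convexHull_inter
      (Finset.inter_subset_right.trans Finset.inter_subset_right) ht]
    exact ⟨hsKJ, hxt⟩
  exact convexHull_mono (Finset.coe_subset.2
    (Finset.inter_subset_inter_right Finset.inter_subset_left)) hall

end TriMesh

theorem edgeMeasure_singleton (e : Finset Plane) (x : Plane) : edgeMeasure e {x} = 0 := by
  have := Measure.nullSingletonClass_hausdorff Plane (d := 1) zero_lt_one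
  exact Measure.absolutelyContinuous_of_le Measure.restrict_le_self (measure_singleton x)

namespace TriMesh

variable {T : TriMesh} {K J e : Finset Plane}

theorem ae_notMem_hull_of_card_inter_le_one {s : Finset Plane} (hK : K ∈ T.elems)
    (hJ : J ∈ T.elems) (he : e ⊆ K) (hs : s ⊆ J) (hcard : (e ∩ s).card ≤ 1) :
    ∀ᵐ x ∂(edgeMeasure e), x ∉ hull s := by
  have hnull : edgeMeasure e (hull (e ∩ s)) = 0 := by
    obtain ⟨y, hy⟩ := Finset.card_le_one_iff_subset_singleton.1 hcard
    refine measure_mono_null (convexHull_min ?_ (convex_singleton y)) (edgeMeasure_singleton e y)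
    exact_mod_cast hy
  filter_upwards [ae_edgeMeasure_mem e, measure_eq_zero_iff_ae_notMem.1 hnull] with x hxe hx hxs
  exact hx (hull_inter_hull_subset hK hJ he hs ⟨hxe, hxs⟩)

theorem ae_notMem_hull {e' : Finset Plane} (he : e ∈ T.edges) (he' : e' ∈ T.edges) (hne : e ≠ e') :
    ∀ᵐ x ∂(edgeMeasure e'), x ∉ hull e := by
  obtain ⟨K, hK, heK⟩ := mem_edges.1 he
  obtain ⟨J, hJ, heJ⟩ := mem_edges.1 he'
  rw [edgesOf, Finset.mem_powersetCard] at heK heJ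
  refine ae_notMem_hull_of_card_inter_le_one hJ hK heJ.1 heK.1 ?_
  by_contra! hcard
  have hleft : e' ∩ e = e' := Finset.eq_of_subset_of_card_le Finset.inter_subset_left
    (heJ.2.trans_le hcard)
  have hright : e' ∩ e = e := Finset.eq_of_subset_of_card_le Finset.inter_subset_right
    (heK.2.trans_le hcard)
  exact hne (hright.symm.trans hleft)

theorem ae_notMem_hull_of_notMem_edgesOf (hK : K ∈ T.elems) (hJ : J ∈ T.elems) (he : e ∈ edgesOf K)
    (heJ : e ∉ edgesOf J) : ∀ᵐ x ∂(edgeMeasure e), x ∉ hull J := by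
  rw [edgesOf, Finset.mem_powersetCard] at he heJ
  refine ae_notMem_hull_of_card_inter_le_one hK hJ he.1 Finset.Subset.rfl ?_
  by_contra! hcard
  have heq : e ∩ J = e := Finset.eq_of_subset_of_card_le Finset.inter_subset_left
    (he.2.trans_le hcard)
  exact heJ ⟨Finset.inter_eq_left.1 heq, he.2⟩

theorem hull_mem_nhds_of_forall_notMem {x : Plane} (hx : x ∈ T.domain)
    (hxJ : ∀ J ∈ T.elems, J ≠ K → x ∉ hull J) : hull K ∈ nhds x := by
  have hclosed : IsClosed (⋃ J ∈ T.elems.erase K, hull J) :=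
    Set.Finite.isClosed_biUnion (Finset.finite_toSet _) fun J _ => (isCompact_hull J).isClosed
  have hnot : x ∉ ⋃ J ∈ T.elems.erase K, hull J := by
    simp only [Set.mem_iUnion, not_exists]
    intro J hJ
    exact hxJ J (Finset.mem_of_mem_erase hJ) (Finset.ne_of_mem_erase hJ)
  filter_upwards [hclosed.isOpen_compl.mem_nhds hnot, T.isOpen_domain.mem_nhds hx] with y hy hyT
  obtain ⟨J, hJ, hyJ⟩ := Set.mem_iUnion₂.1 (interior_subset hyT)
  by_cases hJK : J = K
  · exact hJK ▸ hyJ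
  · exact absurd (Set.mem_biUnion (Finset.mem_coe.2 (Finset.mem_erase.2 ⟨hJK, hJ⟩)) hyJ) hy

end TriMesh

theorem IsTri.hull_notMem_nhds {K : Finset Plane} {a b c x : Plane} (h : IsTri K a b c)
    (hx : x ∈ hull {a, b}) : hull K ∉ nhds x := by
  intro hnhds
  have htend : Filter.Tendsto (fun ε : ℝ => x - ε • (c - a)) (nhdsWithin 0 (Set.Ioi 0))
      (nhds x) := by
    refine Filter.Tendsto.mono_left ?_ nhdsWithin_le_nhds
    exact Continuous.tendsto' (by fun_prop) _ _ (by rw [zero_smul, sub_zero])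
  obtain ⟨ε, hmem, hε⟩ := ((htend.eventually hnhds).and self_mem_nhdsWithin).exists
  have hnonneg := (h.rotate.rotate.shape_mem_Icc hmem).1
  have hshift := inner_shapeGrad K c (x - ε • (c - a)) x
  rw [h.shape_edge hx, sub_sub_cancel_left, inner_neg_right, real_inner_smul_right,
    inner_shapeGrad, h.rotate.rotate.shape_aa, h.rotate.rotate.shape_ab] at hshift
  linarith

theorem TriMesh.ae_notMem_domain {T : TriMesh} {e : Finset Plane} (he : e ∈ T.boundaryEdges) :
    ∀ᵐ x ∂(edgeMeasure e), x ∉ T.domain := by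
  obtain ⟨K, hadj⟩ := Finset.card_eq_one.1 (mem_boundaryEdges.1 he).2
  have hKadj : K ∈ T.adj e := by rw [hadj]; exact Finset.mem_singleton_self K
  obtain ⟨hK, heK⟩ := mem_adj.1 hKadj
  have hother : ∀ᵐ x ∂(edgeMeasure e), ∀ J ∈ T.elems, J ≠ K → x ∉ hull J := by
    refine (ae_ball_iff T.elems.countable_toSet).2 fun J hJ => ?_
    by_cases hJK : J = K
    · exact Filter.Eventually.of_forall fun x hne => absurd hJK hne
    have heJ : e ∉ edgesOf J := fun heJ =>
      hJK (Finset.mem_singleton.1 (hadj ▸ mem_adj.2 ⟨hJ, heJ⟩))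
    filter_upwards [ae_notMem_hull_of_notMem_edgesOf hK hJ heK heJ] with x hx _ using hx
  obtain ⟨a, b, _, _, hab, rfl⟩ := exists_pair_of_mem_edgesOf heK
  obtain ⟨c, h⟩ := exists_isTri_of_mem_adj hab hKadj
  filter_upwards [ae_edgeMeasure_mem {a, b}, hother] with x hx hxJ hdom
  exact h.hull_notMem_nhds hx (hull_mem_nhds_of_forall_notMem hdom hxJ)

/-! ### The number of elements at a vertex -/

theorem image_homothety_subset {E : Type*} [AddCommGroup E] [Module ℝ E] {s : Set E}
    (hs : Convex ℝ s) {i : E} (hi : i ∈ s) {r : ℝ} (hr : r ∈ Set.Icc (0 : ℝ) 1) :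
    AffineMap.homothety i r '' s ⊆ s := by
  rintro _ ⟨x, hx, rfl⟩
  rw [AffineMap.homothety_eq_lineMap]
  exact hs.segment_subset hi hx
    (segment_eq_image_lineMap ℝ i x ▸ Set.mem_image_of_mem _ hr)

theorem image_homothety_subset_closedBall {E : Type*} [NormedAddCommGroup E] [NormedSpace ℝ E]
    {s : Set E} (hs : Bornology.IsBounded s) {i : E} (hi : i ∈ s) (hd : 0 < Metric.diam s) {r : ℝ}
    (hr : 0 ≤ r) : AffineMap.homothety i (r / Metric.diam s) '' s ⊆ Metric.closedBall i r := by
  rintro _ ⟨x, hx, rfl⟩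
  rw [Metric.mem_closedBall, dist_homothety_center, Real.norm_of_nonneg (by positivity)]
  calc r / Metric.diam s * dist i x ≤ r / Metric.diam s * Metric.diam s := by
        gcongr; exact Metric.dist_le_diam_of_mem hs hi hx
    _ = r := div_mul_cancel₀ _ hd.ne'

theorem ofReal_le_volume_image_homothety {s : Set Plane} (hs : volume s ≠ ⊤)
    (hd : 0 < Metric.diam s) {M : ℝ} (hM0 : 0 < M)
    (hM : Metric.diam s ^ 2 ≤ M * volume.real s) (i : Plane) {r : ℝ} :
    ENNReal.ofReal (r ^ 2 / M) ≤ volume (AffineMap.homothety i (r / Metric.diam s) '' s) := by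
  simp only [Measure.addHaar_image_homothety, finrank_euclideanSpace, Fintype.card_fin]
  rw [← ENNReal.ofReal_toReal hs, ← ENNReal.ofReal_mul (by positivity)]
  apply ENNReal.ofReal_le_ofReal
  rw [measureReal_def] at hM
  rw [abs_of_nonneg (by positivity), div_pow, div_mul_eq_mul_div,
    div_le_div_iff₀ hM0 (by positivity)]
  nlinarith [sq_nonneg r]

theorem card_mul_le_of_subset_closedBall {ι : Type*} {P : Finset ι} {S : ι → Set Plane} {i : Plane}
    {r v : ℝ} (hr : 0 ≤ r) (hmeas : ∀ k ∈ P, MeasurableSet (S k))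
    (hdisj : (P : Set ι).Pairwise (Function.onFun (AEDisjoint volume) S))
    (hball : ∀ k ∈ P, S k ⊆ Metric.closedBall i r)
    (hvol : ∀ k ∈ P, ENNReal.ofReal v ≤ volume (S k)) : P.card * v ≤ r ^ 2 * Real.pi := by
  have hle : (P.card : ENNReal) * ENNReal.ofReal v ≤ ENNReal.ofReal (r ^ 2 * Real.pi) := by
    calc (P.card : ENNReal) * ENNReal.ofReal v = ∑ _k ∈ P, ENNReal.ofReal v := by
          rw [Finset.sum_const, nsmul_eq_mul]
      _ ≤ ∑ k ∈ P, volume (S k) := Finset.sum_le_sum hvol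
      _ = volume (⋃ k ∈ P, S k) :=
          (measure_biUnion_finset₀ hdisj fun k hk => (hmeas k hk).nullMeasurableSet).symm
      _ ≤ volume (Metric.closedBall i r) := measure_mono (Set.iUnion₂_subset hball)
      _ = ENNReal.ofReal (r ^ 2 * Real.pi) := by
          rw [EuclideanSpace.volume_closedBall_fin_two, ENNReal.ofReal_mul (by positivity),
            ENNReal.ofReal_pow hr]
  rwa [← ENNReal.ofReal_natCast, ← ENNReal.ofReal_mul (by positivity),
    ENNReal.ofReal_le_ofReal_iff (mul_nonneg (sq_nonneg r) Real.pi_pos.le)] at hle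

-- The elements at `i` are shrunk towards `i` to the diameter of the smallest one: their areas are
-- then comparable and they are packed into one disk.
theorem TriMesh.card_le_of_forall_mem {T : TriMesh} {M : ℝ} (hM0 : 0 < M)
    (hM : ∀ K ∈ T.elems, Metric.diam (hull K) ^ 2 ≤ M * volume.real (hull K)) {i : Plane}
    {P : Finset (Finset Plane)} (hP : ∀ K ∈ P, K ∈ T.elems ∧ i ∈ K) :
    (P.card : ℝ) ≤ Real.pi * M := by
  rcases P.eq_empty_or_nonempty with rfl | hne
  · simpa using (mul_pos Real.pi_pos hM0).le
  have hdiam : ∀ K ∈ P, 0 < Metric.diam (hull K) := by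
    intro K hK
    obtain ⟨a, b, c, h⟩ := T.exists_isTri (hP K hK).1
    exact h.norm_sub_pos.trans_le h.norm_sub_le_diam
  have hi : ∀ K ∈ P, i ∈ hull K := fun K hK => subset_convexHull ℝ _ (hP K hK).2
  obtain ⟨K₀, hK₀, hmin⟩ := P.exists_min_image (fun K => Metric.diam (hull K)) hne
  set r := Metric.diam (hull K₀)
  have hr : 0 < r := hdiam K₀ hK₀
  have hsub : ∀ K ∈ P, AffineMap.homothety i (r / Metric.diam (hull K)) '' hull K ⊆ hull K :=
    fun K hK => image_homothety_subset (convex_convexHull ℝ _) (hi K hK)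
      ⟨by positivity, (div_le_one (hdiam K hK)).2 (hmin K hK)⟩
  have hpack : P.card * (r ^ 2 / M) ≤ r ^ 2 * Real.pi := by
    refine card_mul_le_of_subset_closedBall hr.le (fun K _ => ?_) (fun K hK J hJ hKJ => ?_)
      (fun K hK => image_homothety_subset_closedBall (isCompact_hull K).isBounded (hi K hK)
        (hdiam K hK) hr.le)
      (fun K hK => ofReal_le_volume_image_homothety (isCompact_hull K).measure_lt_top.ne
        (hdiam K hK) hM0 (hM K (hP K hK).1) i)
    · exact ((isCompact_hull K).image (AffineMap.homothety_continuous i _)).isClosed.measurableSet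
    · exact measure_mono_null (Set.inter_subset_inter (hsub K hK) (hsub J hJ))
        (volume_inter (hP K hK).1 (hP J hJ).1 hKJ)
  rw [← mul_div_assoc, div_le_iff₀ hM0] at hpack
  exact le_of_mul_le_mul_right (by linarith) (sq_pos_of_pos hr)

/-! ### Square integrable fields -/

section Lp

variable {α E : Type*} {m : MeasurableSpace α} {μ : Measure α} [NormedAddCommGroup E]

theorem integrable_inner_of_memLp [InnerProductSpace ℝ E] {F G : α → E} (hF : MemLp F 2 μ)
    (hG : MemLp G 2 μ) : Integrable (fun x => ⟪F x, G x⟫) μ :=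
  (hF.norm.integrable_mul hG.norm).mono (hF.1.inner hG.1) <| Filter.Eventually.of_forall fun _ =>
    (norm_inner_le_norm _ _).trans (le_abs_self _)

theorem abs_integral_inner_le_sqrt_mul_sqrt [InnerProductSpace ℝ E] {F G : α → E}
    (hF : MemLp F 2 μ) (hG : MemLp G 2 μ) :
    |∫ x, ⟪F x, G x⟫ ∂μ| ≤ √(∫ x, ‖F x‖ ^ 2 ∂μ) * √(∫ x, ‖G x‖ ^ 2 ∂μ) := by
  have hHolder := integral_mul_norm_le_Lp_mul_Lq (μ := μ) (f := F) (g := G)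
    Real.HolderConjugate.two_two (by simpa using hF) (by simpa using hG)
  simp only [Real.rpow_two, ← Real.sqrt_eq_rpow] at hHolder
  calc |∫ x, ⟪F x, G x⟫ ∂μ| ≤ ∫ x, |⟪F x, G x⟫| ∂μ := abs_integral_le_integral_abs
    _ ≤ ∫ x, ‖F x‖ * ‖G x‖ ∂μ :=
        integral_mono (integrable_inner_of_memLp hF hG).abs (hF.norm.integrable_mul hG.norm)
          fun _ => abs_real_inner_le_norm _ _
    _ ≤ _ := hHolder

end Lp

theorem memLp_of_continuous_of_isCompact {X E : Type*} [TopologicalSpace X] [T2Space X]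
    [MeasurableSpace X] [OpensMeasurableSpace X] [NormedAddCommGroup E]
    [SecondCountableTopologyEither X E] {μ : Measure X} [IsFiniteMeasureOnCompacts μ] {S : Set X}
    (hS : IsCompact S) {F : X → E} (hF : Continuous F) (p : ENNReal) :
    MemLp F p (μ.restrict S) := by
  have : IsFiniteMeasure (μ.restrict S) :=
    ⟨by rw [Measure.restrict_apply_univ]; exact hS.measure_lt_top⟩
  obtain ⟨C, hC⟩ := hS.exists_bound_of_continuousOn hF.continuousOn
  refine MemLp.of_bound hF.aestronglyMeasurable C ?_
  exact (ae_restrict_mem hS.measurableSet).mono hC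

theorem TriMesh.memLp_domain_of_continuous {E : Type*} [NormedAddCommGroup E]
    [SecondCountableTopologyEither Plane E] (T : TriMesh) {F : Plane → E} (hF : Continuous F)
    (p : ENNReal) : MemLp F p (volume.restrict T.domain) :=
  (memLp_of_continuous_of_isCompact (T.elems.isCompact_biUnion fun K _ => isCompact_hull K) hF
    p).mono_measure (Measure.restrict_mono interior_subset le_rfl)

/-! ### Diffusion tensors -/

section InnerProductSpace

variable {E : Type*} [NormedAddCommGroup E] [InnerProductSpace ℝ E] {L : E →L[ℝ] E} {m : ℝ}

theorem norm_sq_apply_le_mul_inner (hm : 0 < m) (hs : ∀ ξ η : E, ⟪L ξ, η⟫ = ⟪ξ, L η⟫)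
    (hnonneg : ∀ ξ : E, 0 ≤ ⟪L ξ, ξ⟫) (hle : ∀ ξ : E, ⟪L ξ, ξ⟫ ≤ m * ‖ξ‖ ^ 2) (ξ : E) :
    ‖L ξ‖ ^ 2 ≤ m * ⟪L ξ, ξ⟫ := by
  have hexpand : ⟪L (ξ - m⁻¹ • L ξ), ξ - m⁻¹ • L ξ⟫ =
      ⟪L ξ, ξ⟫ - 2 * m⁻¹ * ‖L ξ‖ ^ 2 + m⁻¹ ^ 2 * ⟪L (L ξ), L ξ⟫ := by
    simp only [map_sub, map_smul, inner_sub_left, inner_sub_right, real_inner_smul_left,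
      real_inner_smul_right]
    rw [hs (L ξ) ξ, real_inner_self_eq_norm_sq]
    ring
  have hquad : m⁻¹ ^ 2 * ⟪L (L ξ), L ξ⟫ ≤ m⁻¹ * ‖L ξ‖ ^ 2 := by
    calc m⁻¹ ^ 2 * ⟪L (L ξ), L ξ⟫ ≤ m⁻¹ ^ 2 * (m * ‖L ξ‖ ^ 2) := by gcongr; exact hle _
      _ = m⁻¹ * ‖L ξ‖ ^ 2 := by field_simp
  rw [← inv_mul_le_iff₀ hm]
  linarith [hnonneg (ξ - m⁻¹ • L ξ)]

theorem mul_norm_le_norm_apply (hL : ∀ ξ : E, m * ‖ξ‖ ^ 2 ≤ ⟪L ξ, ξ⟫) (ξ : E) :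
    m * ‖ξ‖ ≤ ‖L ξ‖ := by
  rcases (norm_nonneg ξ).eq_or_lt with h0 | h0
  · rw [← h0, mul_zero]
    exact norm_nonneg _
  · refine le_of_mul_le_mul_right ?_ h0
    calc m * ‖ξ‖ * ‖ξ‖ = m * ‖ξ‖ ^ 2 := by ring
      _ ≤ ‖L ξ‖ * ‖ξ‖ := (hL ξ).trans (real_inner_le_norm _ _)

theorem isInvertible_of_coercive [FiniteDimensional ℝ E] (hm : 0 < m)
    (hL : ∀ ξ : E, m * ‖ξ‖ ^ 2 ≤ ⟪L ξ, ξ⟫) : L.IsInvertible := by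
  have hinj : Function.Injective (L : E →ₗ[ℝ] E) := by
    refine (injective_iff_map_eq_zero _).2 fun ξ hξ => norm_le_zero_iff.1 ?_
    have hle := mul_norm_le_norm_apply hL ξ
    rw [show L ξ = 0 from hξ, norm_zero] at hle
    exact nonpos_of_mul_nonpos_right hle hm
  exact ⟨(LinearEquiv.ofInjectiveEndo _ hinj).toContinuousLinearEquiv, rfl⟩

theorem inner_inverse_mem_Icc [FiniteDimensional ℝ E] (hm : 0 < m)
    (hL : ∀ ξ : E, m * ‖ξ‖ ^ 2 ≤ ⟪L ξ, ξ⟫) (p : E) :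
    ⟪L.inverse p, p⟫ ∈ Set.Icc 0 (m⁻¹ * ‖p‖ ^ 2) := by
  obtain ⟨ξ, rfl⟩ := (isInvertible_of_coercive hm hL).bijective.surjective p
  rw [(isInvertible_of_coercive hm hL).inverse_apply_eq.2 rfl, real_inner_comm]
  refine ⟨(by positivity : 0 ≤ m * ‖ξ‖ ^ 2).trans (hL ξ), ?_⟩
  calc ⟪L ξ, ξ⟫ ≤ ‖L ξ‖ * ‖ξ‖ := real_inner_le_norm _ _
    _ ≤ ‖L ξ‖ * (m⁻¹ * ‖L ξ‖) := by
        gcongr; exact (le_inv_mul_iff₀ hm).2 (mul_norm_le_norm_apply hL ξ)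
    _ = m⁻¹ * ‖L ξ‖ ^ 2 := by ring

end InnerProductSpace

namespace IsDiffusionTensor

variable {U : Set Plane} {aMin aMax : ℝ} {A : Plane → Plane →L[ℝ] Plane}

theorem mono {S : Set Plane} (h : IsDiffusionTensor U aMin aMax A)
    (hS : volume.restrict S ≤ volume.restrict U) : IsDiffusionTensor S aMin aMax A :=
  ⟨h.meas.mono_measure hS, ae_mono hS h.symm, ae_mono hS h.lower, ae_mono hS h.upper⟩

theorem ae_nonneg (h : IsDiffusionTensor U aMin aMax A) (h0 : 0 < aMin) :
    ∀ᵐ x ∂(volume.restrict U), ∀ ξ : Plane, 0 ≤ ⟪A x ξ, ξ⟫ := by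
  filter_upwards [h.lower] with x hx ξ
  exact (by positivity : 0 ≤ aMin * ‖ξ‖ ^ 2).trans (hx ξ)

theorem ae_norm_sq_le (h : IsDiffusionTensor U aMin aMax A) (h0 : 0 < aMin) (h1 : aMin ≤ aMax) :
    ∀ᵐ x ∂(volume.restrict U), ∀ ξ : Plane, ‖A x ξ‖ ^ 2 ≤ aMax * ⟪A x ξ, ξ⟫ := by
  filter_upwards [h.ae_nonneg h0, h.symm, h.upper] with x hx hs hu ξ
  exact norm_sq_apply_le_mul_inner (h0.trans_le h1) hs hx hu ξ

theorem memLp (h : IsDiffusionTensor U aMin aMax A) (h0 : 0 < aMin) (h1 : aMin ≤ aMax)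
    {p : ENNReal} {G : Plane → Plane} (hG : MemLp G p (volume.restrict U)) :
    MemLp (fun x => A x (G x)) p (volume.restrict U) := by
  have hm : AEStronglyMeasurable (fun x => A x (G x)) (volume.restrict U) :=
    isBoundedBilinearMap_apply.continuous.comp_aestronglyMeasurable (h.meas.prodMk hG.1)
  have hmax : 0 < aMax := h0.trans_le h1
  refine hG.of_le_mul (c := aMax) hm ?_
  filter_upwards [h.ae_norm_sq_le h0 h1, h.upper] with x h2 h3
  refine le_of_sq_le_sq ?_ (by positivity)
  calc ‖A x (G x)‖ ^ 2 ≤ aMax * ⟪A x (G x), G x⟫ := h2 _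
    _ ≤ aMax * (aMax * ‖G x‖ ^ 2) := by gcongr; exact h3 _
    _ = (aMax * ‖G x‖) ^ 2 := by ring

theorem integrableOn_inner (h : IsDiffusionTensor U aMin aMax A) (h0 : 0 < aMin)
    (h1 : aMin ≤ aMax) {G : Plane → Plane} (hG : MemLp G 2 (volume.restrict U)) :
    IntegrableOn (fun x => ⟪A x (G x), G x⟫) U :=
  integrable_inner_of_memLp (h.memLp h0 h1 hG) hG

theorem integral_inner_nonneg (h : IsDiffusionTensor U aMin aMax A) (h0 : 0 < aMin)
    (G : Plane → Plane) : 0 ≤ ∫ x in U, ⟪A x (G x), G x⟫ := by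
  refine integral_nonneg_of_ae ?_
  filter_upwards [h.ae_nonneg h0] with x hx using hx _

theorem integral_norm_sq_le (h : IsDiffusionTensor U aMin aMax A) (h0 : 0 < aMin)
    (h1 : aMin ≤ aMax) {G : Plane → Plane} (hG : MemLp G 2 (volume.restrict U)) :
    ∫ x in U, ‖A x (G x)‖ ^ 2 ≤ aMax * ∫ x in U, ⟪A x (G x), G x⟫ := by
  have hAG := h.memLp h0 h1 hG
  rw [← integral_const_mul]
  refine integral_mono_ae ((memLp_two_iff_integrable_sq_norm hAG.1).1 hAG)
    ((h.integrableOn_inner h0 h1 hG).const_mul _) ?_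
  filter_upwards [h.ae_norm_sq_le h0 h1] with x hx using hx _

theorem ae_inner_inverse_mem_Icc (h : IsDiffusionTensor U aMin aMax A) (h0 : 0 < aMin) :
    ∀ᵐ x ∂(volume.restrict U), ∀ p : Plane,
      ⟪(A x).inverse p, p⟫ ∈ Set.Icc 0 (aMin⁻¹ * ‖p‖ ^ 2) := by
  filter_upwards [h.lower] with x hx using inner_inverse_mem_Icc h0 hx

end IsDiffusionTensor

/-! ### Broken test functions -/

theorem continuous_gradient {E : Type*} [NormedAddCommGroup E] [InnerProductSpace ℝ E]
    [CompleteSpace E] {w : E → ℝ} (hw : ContDiff ℝ 1 w) : Continuous (gradient w) :=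
  (InnerProductSpace.toDual ℝ E).symm.continuous.comp (hw.continuous_fderiv one_ne_zero)

namespace TriMesh

variable {T : TriMesh}

/-- The field equal to `F K` on each element `K`: broken Sobolev functions and their elementwise
gradients are represented in this way. On the edges of the mesh, a null set, the values from the
elements that meet there are added up. -/
noncomputable def glue {E : Type*} [AddCommMonoid E] (T : TriMesh) (F : Finset Plane → Plane → E)
    (x : Plane) : E :=
  ∑ K ∈ T.elems, (hull K).indicator (F K) x

theorem integral_glue {F : Finset Plane → Plane → ℝ}
    (hF : ∀ K ∈ T.elems, IntegrableOn (F K) (hull K)) :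
    ∫ x in T.domain, T.glue F x = ∑ K ∈ T.elems, ∫ x in hull K, F K x := by
  unfold glue
  rw [integral_finsetSum]
  · exact Finset.sum_congr rfl fun K hK => integral_domain_indicator hK _
  · exact fun K hK => ((integrable_indicator_iff (measurableSet_hull K)).2 (hF K hK)).integrableOn

theorem memLp_glue {E : Type*} [NormedAddCommGroup E] {F : Finset Plane → Plane → E} {p : ENNReal}
    (hF : ∀ K ∈ T.elems, MemLp (F K) p (volume.restrict (hull K))) :
    MemLp (T.glue F) p (volume.restrict T.domain) :=
  memLp_finsetSum _ fun K hK =>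
    ((memLp_indicator_iff_restrict (measurableSet_hull K)).2 (hF K hK)).restrict _

theorem integral_inner_glue {F : Finset Plane → Plane → Plane} {G : Plane → Plane}
    (h : ∀ K ∈ T.elems, IntegrableOn (fun x => ⟪G x, F K x⟫) (hull K)) :
    ∫ x in T.domain, ⟪G x, T.glue F x⟫ = ∑ K ∈ T.elems, ∫ x in hull K, ⟪G x, F K x⟫ := by
  rw [← integral_glue h]
  congr 1 with x
  rw [glue, glue, inner_sum]
  refine Finset.sum_congr rfl fun K _ => ?_
  by_cases hx : x ∈ hull K <;> simp [hx]

theorem integral_mul_glue {F : Finset Plane → Plane → ℝ} {G : Plane → ℝ}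
    (h : ∀ K ∈ T.elems, IntegrableOn (fun x => G x * F K x) (hull K)) :
    ∫ x in T.domain, G x * T.glue F x = ∑ K ∈ T.elems, ∫ x in hull K, G x * F K x := by
  rw [← integral_glue h]
  congr 1 with x
  rw [glue, glue, Finset.mul_sum]
  refine Finset.sum_congr rfl fun K _ => ?_
  by_cases hx : x ∈ hull K <;> simp [hx]

variable {w : Finset Plane → Plane → ℝ}

theorem integral_glue_green (hw : ∀ K, ContDiff ℝ 1 (w K)) {ψ : Plane → ℝ} (hψ : ContDiff ℝ 1 ψ)
    (z : Plane) :
    ∫ x in T.domain, (T.glue w x * fderiv ℝ ψ x z + ⟪T.glue (gradient <| w ·) x, z⟫ * ψ x) =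
      ∑ K ∈ T.elems, ∑ e ∈ edgesOf K,
        ∫ x, w K x * ψ x * ⟪z, outerNormal K e⟫ ∂(edgeMeasure e) := by
  have hmul : ∀ K, ContDiff ℝ 1 fun y => w K y * ψ y := fun K => (hw K).mul hψ
  have hleibniz : ∀ K x, fderiv ℝ (fun y => w K y * ψ y) x z =
      w K x * fderiv ℝ ψ x z + ⟪gradient (w K) x, z⟫ * ψ x := by
    intro K x
    rw [fderiv_fun_mul ((hw K).differentiable one_ne_zero x) (hψ.differentiable one_ne_zero x),
      inner_gradient_left]
    simp only [add_apply, smul_apply, smul_eq_mul]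
    ring
  have hglue : ∀ x, T.glue w x * fderiv ℝ ψ x z + ⟪T.glue (gradient <| w ·) x, z⟫ * ψ x =
      T.glue (fun K y => fderiv ℝ (fun y => w K y * ψ y) y z) x := by
    intro x
    simp only [glue]
    rw [sum_inner, Finset.sum_mul, Finset.sum_mul, ← Finset.sum_add_distrib]
    refine Finset.sum_congr rfl fun K _ => ?_
    by_cases hx : x ∈ hull K <;> simp [hx, hleibniz]
  simp only [hglue]
  rw [integral_glue]
  · refine Finset.sum_congr rfl fun K hK => ?_
    obtain ⟨a, b, c, h⟩ := T.exists_isTri hK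
    exact h.setIntegral_fderiv (hmul K) z
  · intro K _
    have := (hmul K).continuous_fderiv one_ne_zero
    exact integrableOn_hull_of_continuous (by fun_prop) K

/-- The functions `w K` on the elements `K` fit together to an `H¹` function with the trace `t`:
the jumps across the interior edges cancel in Green's formula. -/
def IsBrokenTrace (T : TriMesh) (w : Finset Plane → Plane → ℝ) (t : Plane → ℝ) : Prop :=
  (∀ e ∈ T.boundaryEdges, MemLp t 2 (edgeMeasure e)) ∧
  ∀ ψ : Plane → ℝ, ContDiff ℝ ∞ ψ → ∀ z : Plane,
    ∑ K ∈ T.elems, ∑ e ∈ edgesOf K, ∫ x, w K x * ψ x * ⟪z, outerNormal K e⟫ ∂(edgeMeasure e) =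
      ∑ e ∈ T.boundaryEdges, ∑ K ∈ T.adj e,
        ∫ x, t x * ψ x * ⟪z, outerNormal K e⟫ ∂(edgeMeasure e)

theorem IsBrokenTrace.hasWeakGradient {t : Plane → ℝ} (hw : ∀ K, ContDiff ℝ 1 (w K))
    (ht : T.IsBrokenTrace w t) :
    HasWeakGradient T.domain (T.glue w) (T.glue (gradient <| w ·)) := by
  intro ψ hψ _ hsupp z
  have hψ1 : ContDiff ℝ 1 ψ := hψ.of_le (by simp)
  have hgreen := integral_glue_green (T := T) hw hψ1 z
  have hbdry : ∑ e ∈ T.boundaryEdges, ∑ K ∈ T.adj e,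
      ∫ x, t x * ψ x * ⟪z, outerNormal K e⟫ ∂(edgeMeasure e) = 0 := by
    refine Finset.sum_eq_zero fun e he => Finset.sum_eq_zero fun K _ => ?_
    refine integral_eq_zero_of_ae ?_
    filter_upwards [ae_notMem_domain he] with x hx
    rw [image_eq_zero_of_notMem_tsupport fun h => hx (hsupp h), mul_zero, zero_mul, Pi.zero_apply]
  have hdψ : Continuous fun x => fderiv ℝ ψ x z := by
    have := hψ1.continuous_fderiv one_ne_zero
    fun_prop
  rw [ht.2 ψ hψ z, hbdry, integral_add] at hgreen
  · exact eq_neg_of_add_eq_zero_left hgreen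
  · exact (memLp_glue fun K _ => memLp_of_continuous_of_isCompact (isCompact_hull K)
      (hw K).continuous 2).integrable_mul (T.memLp_domain_of_continuous hdψ 2)
  · exact ((memLp_glue fun K _ => memLp_of_continuous_of_isCompact (isCompact_hull K)
      (continuous_gradient (hw K)) 2).inner_const z).integrable_mul
      (T.memLp_domain_of_continuous hψ.continuous 2)

theorem IsBrokenTrace.exists_H1 {t : Plane → ℝ} (hw : ∀ K, ContDiff ℝ 1 (w K))
    (ht : T.IsBrokenTrace w t) :
    ∃ v : H1 T.domain, v.val = T.glue w ∧ v.grad = T.glue (gradient <| w ·) ∧ IsTrace T v t :=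
  ⟨⟨T.glue w, T.glue (gradient <| w ·),
      memLp_glue fun K _ => memLp_of_continuous_of_isCompact (isCompact_hull K) (hw K).continuous 2,
      memLp_glue fun K _ => memLp_of_continuous_of_isCompact (isCompact_hull K)
        (continuous_gradient (hw K)) 2, ht.hasWeakGradient hw⟩,
    rfl, rfl, ht.1, fun ψ hψ z =>
      (integral_glue_green hw (hψ.of_le (by simp)) z).trans (ht.2 ψ hψ z)⟩

end TriMesh

/-! ### Residual bounds -/

theorem exists_ae_gradient_eq_of_affine {K : Finset Plane} {uh : Plane → ℝ} {l : Plane →ᵃ[ℝ] ℝ}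
    (h : ∀ x ∈ hull K, uh x = l x) :
    ∃ z : Plane, ∀ᵐ x ∂(volume.restrict (hull K)), gradient uh x = z := by
  have hfrontier : volume (frontier (hull K)) = 0 :=
    (convex_convexHull ℝ _).addHaar_frontier volume
  refine ⟨gradient (fun y => l y) 0, ?_⟩
  filter_upwards [ae_restrict_of_ae (measure_eq_zero_iff_ae_notMem.1 hfrontier),
    ae_restrict_mem (measurableSet_hull K)] with x hx hxK
  have hinterior : x ∈ interior (hull K) := by
    by_contra hn
    exact hx ⟨subset_closure hxK, hn⟩
  have heq : uh =ᶠ[nhds x] fun y => l y := by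
    filter_upwards [mem_interior_iff_mem_nhds.1 hinterior] with y hy using h y hy
  rw [heq.gradient.self_of_nhds, (hasGradientAt_affineMap l x).gradient,
    (hasGradientAt_affineMap l 0).gradient]

theorem memLp_gradient_of_affine {K : Finset Plane} {uh : Plane → ℝ} {l : Plane →ᵃ[ℝ] ℝ}
    (h : ∀ x ∈ hull K, uh x = l x) (p : ENNReal) :
    MemLp (gradient uh) p (volume.restrict (hull K)) := by
  obtain ⟨z, hz⟩ := exists_ae_gradient_eq_of_affine h
  exact (memLp_of_continuous_of_isCompact (isCompact_hull K) (continuous_const (y := z)) p).ae_eq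
    (hz.mono fun x hx => hx.symm)

theorem IsDiffusionTensor.abs_integral_inner_le {S : Set Plane} {aMin aMax B : ℝ}
    {A : Plane → Plane →L[ℝ] Plane} {G W : Plane → Plane} (h : IsDiffusionTensor S aMin aMax A)
    (h0 : 0 < aMin) (h1 : aMin ≤ aMax) (hS : MeasurableSet S) (hfin : volume S ≠ ⊤)
    (hG : MemLp G 2 (volume.restrict S)) (hW : MemLp W 2 (volume.restrict S)) (hB : 0 ≤ B)
    (hWB : ∀ x ∈ S, ‖W x‖ ≤ B) :
    |∫ x in S, ⟪A x (G x), W x⟫| ≤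
      √(aMax * ∫ x in S, ⟪A x (G x), G x⟫) * (B * √(volume.real S)) := by
  have hint : ∫ x in S, ‖W x‖ ^ 2 ≤ B ^ 2 * volume.real S := by
    calc ∫ x in S, ‖W x‖ ^ 2 ≤ ∫ _ in S, B ^ 2 :=
          setIntegral_mono_on ((memLp_two_iff_integrable_sq_norm hW.1).1 hW)
            (integrableOn_const hfin) hS fun x hx => by gcongr; exact hWB x hx
      _ = B ^ 2 * volume.real S := by rw [setIntegral_const, smul_eq_mul, mul_comm]
  calc |∫ x in S, ⟪A x (G x), W x⟫|
      ≤ √(∫ x in S, ‖A x (G x)‖ ^ 2) * √(∫ x in S, ‖W x‖ ^ 2) :=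
        abs_integral_inner_le_sqrt_mul_sqrt (h.memLp h0 h1 hG) hW
    _ ≤ √(aMax * ∫ x in S, ⟪A x (G x), G x⟫) * √(B ^ 2 * volume.real S) := by
        gcongr
        exact h.integral_norm_sq_le h0 h1 hG
    _ = _ := by rw [Real.sqrt_mul (sq_nonneg B), Real.sqrt_sq hB]

/-- The energy of the error on the element `K`. -/
noncomputable def elemError (A : Plane → Plane →L[ℝ] Plane) {U : Set Plane} (u : H1 U)
    (uh : Plane → ℝ) (K : Finset Plane) : ℝ :=
  ∫ x in hull K, ⟪A x (u.grad x - gradient uh x), u.grad x - gradient uh x⟫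

/-- The data of the diffusion problem and of its approximation, with the regularity of the mesh
expressed by areas. -/
structure IsSetting (T : TriMesh) (ΓD : Finset (Finset Plane)) (aMin aMax M : ℝ)
    (A : Plane → Plane →L[ℝ] Plane) (f g : Plane → ℝ) (u : H1 T.domain) (uh : Plane → ℝ)
    (qn : Finset Plane → Finset Plane → ℝ) : Prop where
  aMin_pos : 0 < aMin
  aMin_le : aMin ≤ aMax
  area : ∀ K ∈ T.elems, Metric.diam (hull K) ^ 2 ≤ M * volume.real (hull K)
  subset : ΓD ⊆ T.boundaryEdges
  tensor : IsDiffusionTensor T.domain aMin aMax A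
  weak : ∀ (v : H1 T.domain) (t : Plane → ℝ), MemV T ΓD v t →
    ∫ x in T.domain, ⟪A x (u.grad x), v.grad x⟫ =
      (∫ x in T.domain, f x * v.val x) +
        ∑ e ∈ T.neumannEdges ΓD, ∫ x, g x * t x ∂(edgeMeasure e)
  affine : ∀ K ∈ T.elems, ∃ l : Plane →ᵃ[ℝ] ℝ, ∀ x ∈ hull K, uh x = l x
  flux : ∀ K ∈ T.elems, HasNormalTrace K (feFlux A uh) (fun _ => 0) (fun e _ => qn K e)
  const : IsElementwiseConstant T f
  edgewise : IsEdgewiseAffine (T.neumannEdges ΓD) g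

namespace IsSetting

variable {T : TriMesh} {ΓD : Finset (Finset Plane)} {aMin aMax M : ℝ}
  {A : Plane → Plane →L[ℝ] Plane} {f g : Plane → ℝ} {u : H1 T.domain} {uh : Plane → ℝ}
  {qn : Finset Plane → Finset Plane → ℝ} {K : Finset Plane}

theorem aMax_pos (S : IsSetting T ΓD aMin aMax M A f g u uh qn) : 0 < aMax :=
  S.aMin_pos.trans_le S.aMin_le

theorem M_pos (S : IsSetting T ΓD aMin aMax M A f g u uh qn) (hK : K ∈ T.elems) : 0 < M := by
  obtain ⟨a, b, c, h⟩ := T.exists_isTri hK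
  exact two_pos.trans_le (h.two_le_of_diam_sq_le (S.area K hK))

theorem tensor_hull (S : IsSetting T ΓD aMin aMax M A f g u uh qn) (hK : K ∈ T.elems) :
    IsDiffusionTensor (hull K) aMin aMax A :=
  S.tensor.mono (TriMesh.restrict_hull_le hK)

theorem memLp_feFlux (S : IsSetting T ΓD aMin aMax M A f g u uh qn) (hK : K ∈ T.elems) :
    MemLp (feFlux A uh) 2 (volume.restrict (hull K)) := by
  obtain ⟨l, hl⟩ := S.affine K hK
  exact (S.tensor_hull hK).memLp S.aMin_pos S.aMin_le (memLp_gradient_of_affine hl 2)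

theorem memLp_error (S : IsSetting T ΓD aMin aMax M A f g u uh qn) (hK : K ∈ T.elems) :
    MemLp (fun x => u.grad x - gradient uh x) 2 (volume.restrict (hull K)) := by
  obtain ⟨l, hl⟩ := S.affine K hK
  exact (u.memLp_grad.mono_measure (TriMesh.restrict_hull_le hK)).sub
    (memLp_gradient_of_affine hl 2)

theorem elemError_nonneg (S : IsSetting T ΓD aMin aMax M A f g u uh qn) (hK : K ∈ T.elems) :
    0 ≤ elemError A u uh K :=
  (S.tensor_hull hK).integral_inner_nonneg S.aMin_pos _

theorem energyErrorSq_eq (S : IsSetting T ΓD aMin aMax M A f g u uh qn) :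
    energyErrorSq T A u uh = ∑ K ∈ T.elems, elemError A u uh K :=
  TriMesh.integral_domain fun _ hK =>
    (S.tensor_hull hK).integrableOn_inner S.aMin_pos S.aMin_le (S.memLp_error hK)

theorem abs_integral_error_le (S : IsSetting T ΓD aMin aMax M A f g u uh qn) (hK : K ∈ T.elems)
    {w : Plane → ℝ} {B : ℝ} (hw : ContDiff ℝ 1 w) (hB : 0 ≤ B)
    (hwB : ∀ x ∈ hull K, ‖gradient w x‖ ≤ B * √(M / (4 * volume.real (hull K)))) :
    |∫ x in hull K, ⟪A x (u.grad x - gradient uh x), gradient w x⟫| ≤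
      B / 2 * √(aMax * M) * √(elemError A u uh K) := by
  obtain ⟨a, b, c, h⟩ := T.exists_isTri hK
  have hv := h.volume_hull_pos
  have hscale : √(M / (4 * volume.real (hull K))) * √(volume.real (hull K)) = √M / 2 := by
    rw [← Real.sqrt_mul (div_nonneg (S.M_pos hK).le (by positivity)), div_mul_eq_mul_div,
      mul_div_mul_right _ _ hv.ne', Real.sqrt_div (S.M_pos hK).le,
      show (4 : ℝ) = 2 ^ 2 by norm_num, Real.sqrt_sq two_pos.le]
  refine ((S.tensor_hull hK).abs_integral_inner_le S.aMin_pos S.aMin_le (measurableSet_hull K)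
    (isCompact_hull K).measure_lt_top.ne (S.memLp_error hK)
    (memLp_of_continuous_of_isCompact (isCompact_hull K) (continuous_gradient hw) 2)
    (by positivity) hwB).trans_eq ?_
  rw [← elemError, Real.sqrt_mul S.aMax_pos.le, Real.sqrt_mul S.aMax_pos.le, mul_assoc B, hscale]
  ring

theorem integral_inner_feFlux (S : IsSetting T ΓD aMin aMax M A f g u uh qn) (hK : K ∈ T.elems)
    {w : Plane → ℝ} (hw : ContDiff ℝ ∞ w) :
    ∫ x in hull K, ⟪feFlux A uh x, gradient w x⟫ =
      ∑ e ∈ edgesOf K, ∫ x, w x * qn K e ∂(edgeMeasure e) := by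
  simpa only [zero_mul, mul_zero, add_zero, mul_comm] using S.flux K hK w hw

theorem residual_eq (S : IsSetting T ΓD aMin aMax M A f g u uh qn)
    {w : Finset Plane → Plane → ℝ} (hw : ∀ K, ContDiff ℝ ∞ (w K)) {t : Plane → ℝ}
    (ht : T.IsBrokenTrace w t) (hD : ∀ e ∈ ΓD, ∀ᵐ x ∂(edgeMeasure e), t x = 0) :
    ∑ K ∈ T.elems, ∫ x in hull K, ⟪A x (u.grad x - gradient uh x), gradient (w K) x⟫ =
      (∑ K ∈ T.elems, ∫ x in hull K, f x * w K x) +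
        (∑ e ∈ T.neumannEdges ΓD, ∫ x, g x * t x ∂(edgeMeasure e)) -
        ∑ K ∈ T.elems, ∑ e ∈ edgesOf K, ∫ x, w K x * qn K e ∂(edgeMeasure e) := by
  have hw1 : ∀ K, ContDiff ℝ 1 (w K) := fun K => (hw K).of_le (by simp)
  obtain ⟨v, hval, hgrad, htrace⟩ := ht.exists_H1 hw1
  have hflux : ∀ K ∈ T.elems, MemLp (fun x => A x (u.grad x)) 2 (volume.restrict (hull K)) :=
    fun K hK => (S.tensor_hull hK).memLp S.aMin_pos S.aMin_le
      (u.memLp_grad.mono_measure (TriMesh.restrict_hull_le hK))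
  have hdw : ∀ K, MemLp (gradient (w K)) 2 (volume.restrict (hull K)) := fun K =>
    memLp_of_continuous_of_isCompact (isCompact_hull K) (continuous_gradient (hw1 K)) 2
  have hfw : ∀ K ∈ T.elems, IntegrableOn (fun x => f x * w K x) (hull K) := by
    intro K hK
    obtain ⟨k, hk⟩ := S.const K hK
    exact (integrableOn_hull_of_continuous (continuous_const.mul (hw K).continuous) K).congr
      (hk.mono fun x hx => congrArg (· * w K x) hx.symm)
  have hweak := S.weak v t ⟨htrace, hD⟩
  rw [hval, hgrad, TriMesh.integral_inner_glue fun K hK =>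
    integrable_inner_of_memLp (hflux K hK) (hdw K), TriMesh.integral_mul_glue hfw] at hweak
  rw [← hweak, ← Finset.sum_sub_distrib]
  refine Finset.sum_congr rfl fun K hK => ?_
  rw [← S.integral_inner_feFlux hK (hw K), ← integral_sub
    (integrable_inner_of_memLp (hflux K hK) (hdw K))
    (integrable_inner_of_memLp (S.memLp_feFlux hK) (hdw K))]
  simp only [map_sub, inner_sub_left, feFlux]

theorem residual_eq_of_subset (S : IsSetting T ΓD aMin aMax M A f g u uh qn)
    {P : Finset (Finset Plane)} (hP : P ⊆ T.elems) {w : Finset Plane → Plane → ℝ}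
    (hw : ∀ K, ContDiff ℝ ∞ (w K)) {t : Plane → ℝ}
    (ht : T.IsBrokenTrace ((P : Set (Finset Plane)).indicator w) t)
    (hD : ∀ e ∈ ΓD, ∀ᵐ x ∂(edgeMeasure e), t x = 0) :
    ∑ K ∈ P, ∫ x in hull K, ⟪A x (u.grad x - gradient uh x), gradient (w K) x⟫ =
      (∑ K ∈ P, ∫ x in hull K, f x * w K x) +
        (∑ e ∈ T.neumannEdges ΓD, ∫ x, g x * t x ∂(edgeMeasure e)) -
        ∑ K ∈ P, ∑ e ∈ edgesOf K, ∫ x, w K x * qn K e ∂(edgeMeasure e) := by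
  have hsmooth : ∀ K, ContDiff ℝ ∞ ((P : Set (Finset Plane)).indicator w K) := by
    intro K
    by_cases hK : K ∈ (P : Set (Finset Plane))
    · rw [Set.indicator_of_mem hK]
      exact hw K
    · rw [Set.indicator_of_notMem hK]
      exact contDiff_const
  have h := S.residual_eq hsmooth ht hD
  rwa [Finset.sum_indicator_subset_of_eq_zero w
      (fun K v => ∫ x in hull K, ⟪A x (u.grad x - gradient uh x), gradient v x⟫) hP
      fun K => by simp [gradient],
    Finset.sum_indicator_subset_of_eq_zero w (fun K v => ∫ x in hull K, f x * v x) hP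
      fun K => by simp,
    Finset.sum_indicator_subset_of_eq_zero w
      (fun K v => ∑ e ∈ edgesOf K, ∫ x, v x * qn K e ∂(edgeMeasure e)) hP
      fun K => by simp] at h

end IsSetting

theorem TriMesh.isBrokenTrace_indicator_iff {T : TriMesh} {P : Finset (Finset Plane)}
    (hP : P ⊆ T.elems) {w : Finset Plane → Plane → ℝ} {t : Plane → ℝ} :
    T.IsBrokenTrace ((P : Set (Finset Plane)).indicator w) t ↔
      (∀ e ∈ T.boundaryEdges, MemLp t 2 (edgeMeasure e)) ∧
      ∀ ψ : Plane → ℝ, ContDiff ℝ ∞ ψ → ∀ z : Plane,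
        ∑ K ∈ P, ∑ e ∈ edgesOf K, ∫ x, w K x * (ψ x * ⟪z, outerNormal K e⟫) ∂(edgeMeasure e) =
          ∑ e ∈ T.boundaryEdges, ∑ K ∈ T.adj e,
            ∫ x, t x * ψ x * ⟪z, outerNormal K e⟫ ∂(edgeMeasure e) := by
  simp only [TriMesh.IsBrokenTrace]
  refine and_congr_right fun _ => forall₃_congr fun ψ _ z => ?_
  rw [Finset.sum_indicator_subset_of_eq_zero w (fun K v => ∑ e ∈ edgesOf K,
    ∫ x, v x * ψ x * ⟪z, outerNormal K e⟫ ∂(edgeMeasure e)) hP fun K => by simp]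
  simp only [mul_assoc]

namespace IsTri

variable {K : Finset Plane} {a b c : Plane}

theorem edgeBubble_eq_zero (h : IsTri K a b c) {e : Finset Plane} (he : e ∈ edgesOf K)
    (hne : e ≠ {a, b}) {x : Plane} (hx : x ∈ hull e) : edgeBubble K a b x = 0 := by
  rw [h.edgesOf_eq] at he
  simp only [Finset.mem_insert, Finset.mem_singleton] at he
  rcases he with rfl | rfl | rfl
  · exact absurd rfl hne
  · simp [edgeBubble, h.rotate.shape_edge hx]
  · simp [edgeBubble, h.flip.shape_edge hx]

theorem triBubble_eq_zero (h : IsTri K a b c) {e : Finset Plane} (he : e ∈ edgesOf K)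
    {x : Plane} (hx : x ∈ hull e) : triBubble K a b c x = 0 := by
  rw [h.edgesOf_eq] at he
  simp only [Finset.mem_insert, Finset.mem_singleton] at he
  rcases he with rfl | rfl | rfl
  · simp [triBubble, h.shape_edge hx]
  · simp [triBubble, h.rotate.shape_edge hx]
  · simp [triBubble, h.flip.shape_edge hx]

theorem sum_edgesOf_integral_edgeBubble (h : IsTri K a b c)
    (Φ : Finset Plane → Plane → ℝ) :
    ∑ e ∈ edgesOf K, ∫ x, edgeBubble K a b x * Φ e x ∂(edgeMeasure e) =
      ∫ x, edgeBubble K a b x * Φ {a, b} x ∂(edgeMeasure {a, b}) :=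
  Finset.sum_eq_single_of_mem _ h.mem_edgesOf fun _ he hne =>
    integral_edge_eq_zero fun _ hx => by rw [h.edgeBubble_eq_zero he hne hx, zero_mul]

theorem shape_eq_on_edge {J : Finset Plane} {d : Plane} (h : IsTri K a b c) (h' : IsTri J a b d)
    {x : Plane} (hx : x ∈ hull {a, b}) : shape K a x = shape J a x := by
  obtain ⟨s, _, rfl⟩ := (mem_hull_pair_iff c).1 hx
  have : baryPoint a b c s 0 = baryPoint a b d s 0 := by simp [baryPoint]
  rw [h.shape_a_bary, this, h'.shape_a_bary]

theorem edgeBubble_eq_on_edge {J : Finset Plane} {d : Plane} (h : IsTri K a b c)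
    (h' : IsTri J a b d) {x : Plane} (hx : x ∈ hull {a, b}) :
    edgeBubble K a b x = edgeBubble J a b x := by
  have hx' : x ∈ hull {b, a} := by rwa [Finset.pair_comm]
  rw [edgeBubble, edgeBubble, h.shape_eq_on_edge h' hx, h.swap.shape_eq_on_edge h'.swap hx']

theorem memLp_edgeBubble (h : IsTri K a b c) (p : ENNReal) :
    MemLp (edgeBubble K a b) p (edgeMeasure {a, b}) := by
  have := isFiniteMeasure_edgeMeasure h.mem_edgesOf
  refine MemLp.of_bound (contDiff_edgeBubble K a b).continuous.aestronglyMeasurable 8 ?_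
  filter_upwards [ae_edgeMeasure_mem {a, b}] with x hx
  refine h.abs_edgeBubble_le (convexHull_mono ?_ hx)
  exact Finset.coe_subset.2 (Finset.mem_powersetCard.1 h.mem_edgesOf).1

end IsTri

theorem ae_indicator_hull_eq (e : Finset Plane) (F : Plane → ℝ) :
    ∀ᵐ x ∂(edgeMeasure e), (hull e).indicator F x = F x :=
  (ae_edgeMeasure_mem e).mono fun _ hx => Set.indicator_of_mem hx F

namespace TriMesh

variable {T : TriMesh} {K : Finset Plane} {a b : Plane}

theorem adj_subset (e : Finset Plane) : T.adj e ⊆ T.elems := Finset.filter_subset _ _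

theorem isBrokenTrace_edgeBubble_zero (hab : a ≠ b) (hcard : (T.adj {a, b}).card = 2) :
    T.IsBrokenTrace ((T.adj {a, b} : Set (Finset Plane)).indicator (edgeBubble · a b)) 0 := by
  refine (isBrokenTrace_indicator_iff (adj_subset _)).2 ⟨fun _ _ => MemLp.zero, fun ψ _ z => ?_⟩
  obtain ⟨K, J, hKJ, hadj⟩ := Finset.card_eq_two.1 hcard
  have hK : K ∈ T.adj {a, b} := hadj ▸ Finset.mem_insert_self _ _
  have hJ : J ∈ T.adj {a, b} := hadj ▸ Finset.mem_insert_of_mem (Finset.mem_singleton_self _)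
  obtain ⟨c, h⟩ := T.exists_isTri_of_mem_adj hab hK
  obtain ⟨d, h'⟩ := T.exists_isTri_of_mem_adj hab hJ
  have hneg : ∫ x, edgeBubble J a b x * (ψ x * ⟪z, -outerNormal K {a, b}⟫) ∂(edgeMeasure {a, b}) =
      -∫ x, edgeBubble K a b x * (ψ x * ⟪z, outerNormal K {a, b}⟫) ∂(edgeMeasure {a, b}) := by
    rw [← integral_neg]
    refine integral_congr_ae ?_
    filter_upwards [ae_edgeMeasure_mem {a, b}] with x hx
    rw [h.edgeBubble_eq_on_edge h' hx, inner_neg_right, mul_neg, mul_neg]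
  simp only [Pi.zero_apply, zero_mul, integral_zero, Finset.sum_const_zero]
  rw [hadj, Finset.sum_pair hKJ, h.sum_edgesOf_integral_edgeBubble,
    h'.sum_edgesOf_integral_edgeBubble, outerNormal_neg hK hJ hKJ, hneg, add_neg_cancel]

theorem ae_indicator_hull_eq_zero {e e' : Finset Plane} (he : e ∈ T.edges) (he' : e' ∈ T.edges)
    (hne : e' ≠ e) (F : Plane → ℝ) : ∀ᵐ x ∂(edgeMeasure e'), (hull e).indicator F x = 0 :=
  (ae_notMem_hull he he' hne.symm).mono fun _ hx => Set.indicator_of_notMem hx F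

theorem isBrokenTrace_edgeBubble_indicator (hab : a ≠ b) (he : {a, b} ∈ T.boundaryEdges)
    (hadj : T.adj {a, b} = {K}) :
    T.IsBrokenTrace ((T.adj {a, b} : Set (Finset Plane)).indicator (edgeBubble · a b))
      ((hull {a, b}).indicator (edgeBubble K a b)) := by
  obtain ⟨c, h⟩ := T.exists_isTri_of_mem_adj hab (hadj ▸ Finset.mem_singleton_self K)
  have hzero : ∀ e ∈ T.boundaryEdges, e ≠ {a, b} → ∀ᵐ x ∂(edgeMeasure e),
      (hull {a, b}).indicator (edgeBubble K a b) x = 0 := fun e he' hne =>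
    ae_indicator_hull_eq_zero (mem_boundaryEdges.1 he).1 (mem_boundaryEdges.1 he').1 hne _
  refine (isBrokenTrace_indicator_iff (adj_subset _)).2 ⟨fun e he' => ?_, fun ψ _ z => ?_⟩
  · rcases eq_or_ne e {a, b} with rfl | hne
    · exact (h.memLp_edgeBubble 2).ae_eq ((ae_indicator_hull_eq _ _).mono fun _ => Eq.symm)
    · exact (MemLp.zero' (ε := ℝ)).ae_eq ((hzero e he' hne).mono fun _ => Eq.symm)
  · rw [Finset.sum_eq_single_of_mem _ he, hadj, Finset.sum_singleton, Finset.sum_singleton,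
      h.sum_edgesOf_integral_edgeBubble]
    · refine integral_congr_ae ?_
      filter_upwards [ae_indicator_hull_eq {a, b} (edgeBubble K a b)] with x hx
      rw [hx, mul_assoc]
    · exact fun e he' hne => Finset.sum_eq_zero fun J _ =>
        integral_eq_zero_of_ae ((hzero e he' hne).mono fun x hx => by simp [hx])

end TriMesh

namespace IsSetting

variable {T : TriMesh} {ΓD : Finset (Finset Plane)} {aMin aMax M : ℝ}
  {A : Plane → Plane →L[ℝ] Plane} {f g : Plane → ℝ} {u : H1 T.domain} {uh : Plane → ℝ}
  {qn : Finset Plane → Finset Plane → ℝ} {K : Finset Plane} {a b c : Plane}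

theorem integral_error_gradient_triBubble (S : IsSetting T ΓD aMin aMax M A f g u uh qn)
    (hK : K ∈ T.elems) (h : IsTri K a b c) :
    ∫ x in hull K, ⟪A x (u.grad x - gradient uh x), gradient (triBubble K a b c) x⟫ =
      ∫ x in hull K, f x * triBubble K a b c x := by
  have hP : {K} ⊆ T.elems := Finset.singleton_subset_iff.2 hK
  have hedge : ∀ e ∈ edgesOf K, ∀ Φ : Plane → ℝ,
      ∫ x, triBubble K a b c x * Φ x ∂(edgeMeasure e) = 0 := fun e he Φ =>
    integral_edge_eq_zero fun x hx => by rw [h.triBubble_eq_zero he hx, zero_mul]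
  have htrace : T.IsBrokenTrace ((({K} : Finset (Finset Plane)) : Set (Finset Plane)).indicator
      fun _ => triBubble K a b c) 0 := by
    refine (TriMesh.isBrokenTrace_indicator_iff hP).2 ⟨fun _ _ => MemLp.zero, fun ψ _ z => ?_⟩
    rw [Finset.sum_singleton, Finset.sum_eq_zero fun e he => hedge e he _]
    simp
  have hres := S.residual_eq_of_subset hP (fun _ => contDiff_triBubble K a b c) htrace
    fun _ _ => Filter.Eventually.of_forall fun _ => rfl
  rw [Finset.sum_singleton, Finset.sum_singleton, Finset.sum_singleton,
    Finset.sum_eq_zero fun e he => hedge e he _] at hres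
  simpa using hres

theorem abs_mul_volume_le (S : IsSetting T ΓD aMin aMax M A f g u uh qn) (hK : K ∈ T.elems)
    {k : ℝ} (hk : ∀ᵐ x ∂(volume.restrict (hull K)), f x = k) :
    |k| * volume.real (hull K) ≤ 90 * √(aMax * M) * √(elemError A u uh K) := by
  obtain ⟨a, b, c, h⟩ := T.exists_isTri hK
  have hM := S.area K hK
  have hload : ∫ x in hull K, f x * triBubble K a b c x = k * (volume.real (hull K) / 60) := by
    rw [← h.integral_triBubble, ← integral_const_mul]
    exact integral_congr_ae (hk.mono fun x hx => congrArg (· * triBubble K a b c x) hx)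
  have hbound := S.abs_integral_error_le hK ((contDiff_triBubble K a b c).of_le (by simp))
    zero_le_three fun x hx => h.norm_gradient_triBubble_le (h.rotate.norm_shapeGrad_le hM)
      (h.flip.norm_shapeGrad_le hM) (h.norm_shapeGrad_le hM) hx
  rw [S.integral_error_gradient_triBubble hK h, hload, abs_mul,
    abs_of_nonneg (div_nonneg measureReal_nonneg (by norm_num))] at hbound
  linarith

theorem abs_residual_edgeBubble_le (S : IsSetting T ΓD aMin aMax M A f g u uh qn) (hab : a ≠ b)
    (hK : K ∈ T.adj {a, b}) :
    |(∫ x in hull K, ⟪A x (u.grad x - gradient uh x), gradient (edgeBubble K a b) x⟫) -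
      ∫ x in hull K, f x * edgeBubble K a b x| ≤ 733 * √(aMax * M) * √(elemError A u uh K) := by
  obtain ⟨c, h⟩ := T.exists_isTri_of_mem_adj hab hK
  have hK' := (TriMesh.mem_adj.1 hK).1
  have hM := S.area K hK'
  have hgrad := S.abs_integral_error_le hK' ((contDiff_edgeBubble K a b).of_le (by simp))
    (by norm_num) fun x hx => h.norm_gradient_edgeBubble_le (h.rotate.norm_shapeGrad_le hM)
      (h.flip.norm_shapeGrad_le hM) hx
  obtain ⟨k, hk⟩ := S.const K hK'
  have hload : |∫ x in hull K, f x * edgeBubble K a b x| ≤ |k| * 8 * volume.real (hull K) := by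
    rw [← Real.norm_eq_abs]
    refine norm_setIntegral_le_of_norm_le_const_ae (isCompact_hull K).measure_lt_top ?_
    filter_upwards [hk, ae_restrict_mem (measurableSet_hull K)] with x hx hxK
    rw [hx, norm_mul, Real.norm_eq_abs, Real.norm_eq_abs]
    gcongr
    exact h.abs_edgeBubble_le hxK
  linarith [S.abs_mul_volume_le hK' hk, abs_sub
    (∫ x in hull K, ⟪A x (u.grad x - gradient uh x), gradient (edgeBubble K a b) x⟫)
    (∫ x in hull K, f x * edgeBubble K a b x)]

theorem abs_residual_edge_le (S : IsSetting T ΓD aMin aMax M A f g u uh qn) (hab : a ≠ b)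
    {t : Plane → ℝ} (hD : ∀ e ∈ ΓD, ∀ᵐ x ∂(edgeMeasure e), t x = 0)
    (ht : T.IsBrokenTrace ((T.adj {a, b} : Set (Finset Plane)).indicator (edgeBubble · a b)) t) :
    |(∑ e ∈ T.neumannEdges ΓD, ∫ x, g x * t x ∂(edgeMeasure e)) -
      (∑ K ∈ T.adj {a, b}, qn K {a, b}) * (‖b - a‖ / 2)| ≤
      ∑ K ∈ T.adj {a, b}, 733 * √(aMax * M) * √(elemError A u uh K) := by
  have hflux : ∀ K ∈ T.adj {a, b},
      ∑ e ∈ edgesOf K, ∫ x, edgeBubble K a b x * qn K e ∂(edgeMeasure e) =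
        qn K {a, b} * (‖b - a‖ / 2) := by
    intro K hK
    obtain ⟨c, h⟩ := T.exists_isTri_of_mem_adj hab hK
    rw [h.sum_edgesOf_integral_edgeBubble fun e _ => qn K e, integral_mul_const,
      h.integral_edge_edgeBubble, mul_comm]
  have hres := S.residual_eq_of_subset (TriMesh.adj_subset _)
    (fun K => contDiff_edgeBubble K a b) ht hD
  rw [Finset.sum_congr rfl hflux, ← Finset.sum_mul] at hres
  have hsum : (∑ e ∈ T.neumannEdges ΓD, ∫ x, g x * t x ∂(edgeMeasure e)) -
      (∑ K ∈ T.adj {a, b}, qn K {a, b}) * (‖b - a‖ / 2) =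
      ∑ K ∈ T.adj {a, b}, ((∫ x in hull K,
        ⟪A x (u.grad x - gradient uh x), gradient (edgeBubble K a b) x⟫) -
        ∫ x in hull K, f x * edgeBubble K a b x) := by
    rw [Finset.sum_sub_distrib]
    linarith
  rw [hsum]
  exact (Finset.abs_sum_le_sum_abs _ _).trans
    (Finset.sum_le_sum fun K hK => S.abs_residual_edgeBubble_le hab hK)

theorem abs_jump_le (S : IsSetting T ΓD aMin aMax M A f g u uh qn) (hab : a ≠ b)
    (hcard : (T.adj {a, b}).card = 2) :
    |(∑ K ∈ T.adj {a, b}, qn K {a, b}) * (‖b - a‖ / 2)| ≤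
      ∑ K ∈ T.adj {a, b}, 733 * √(aMax * M) * √(elemError A u uh K) := by
  simpa using S.abs_residual_edge_le hab (fun _ _ => Filter.Eventually.of_forall fun _ => rfl)
    (TriMesh.isBrokenTrace_edgeBubble_zero hab hcard)

theorem abs_neumann_residual_le (S : IsSetting T ΓD aMin aMax M A f g u uh qn) (hab : a ≠ b)
    (he : {a, b} ∈ T.neumannEdges ΓD) (hK : K ∈ T.adj {a, b}) :
    |(∫ x, g x * shape K a x ∂(edgeMeasure {a, b})) - qn K {a, b} * (‖b - a‖ / 2)| ≤
      733 * √(aMax * M) * √(elemError A u uh K) := by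
  obtain ⟨hboundary, hnotD⟩ := Finset.mem_sdiff.1 he
  have hadj : T.adj {a, b} = {K} := by
    obtain ⟨J, hJ⟩ := Finset.card_eq_one.1 (TriMesh.mem_boundaryEdges.1 hboundary).2
    rw [hJ] at hK ⊢
    rw [Finset.mem_singleton.1 hK]
  obtain ⟨c, h⟩ := T.exists_isTri_of_mem_adj hab hK
  have hzero : ∀ e ∈ T.boundaryEdges, e ≠ {a, b} → ∀ᵐ x ∂(edgeMeasure e),
      (hull {a, b}).indicator (edgeBubble K a b) x = 0 := fun e he' hne =>
    TriMesh.ae_indicator_hull_eq_zero (TriMesh.mem_boundaryEdges.1 hboundary).1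
      (TriMesh.mem_boundaryEdges.1 he').1 hne _
  have hbound := S.abs_residual_edge_le hab
    (fun e heD => hzero e (S.subset heD) fun heq => hnotD (heq ▸ heD))
    (TriMesh.isBrokenTrace_edgeBubble_indicator hab hboundary hadj)
  have hdata : ∑ e ∈ T.neumannEdges ΓD,
      ∫ x, g x * (hull {a, b}).indicator (edgeBubble K a b) x ∂(edgeMeasure e) =
      ∫ x, g x * shape K a x ∂(edgeMeasure {a, b}) := by
    obtain ⟨l, hl⟩ := S.edgewise _ he
    rw [Finset.sum_eq_single_of_mem _ he fun e he' hne => integral_eq_zero_of_ae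
      ((hzero e (Finset.mem_sdiff.1 he').1 hne).mono fun x hx => by simp [hx])]
    calc ∫ x, g x * (hull {a, b}).indicator (edgeBubble K a b) x ∂(edgeMeasure {a, b})
        = ∫ x, l x * edgeBubble K a b x ∂(edgeMeasure {a, b}) := by
          refine integral_congr_ae ?_
          filter_upwards [hl, ae_indicator_hull_eq _ _] with x hg ht
          rw [hg, ht]
      _ = ∫ x, l x * shape K a x ∂(edgeMeasure {a, b}) := h.integral_edge_affine_edgeBubble l
      _ = ∫ x, g x * shape K a x ∂(edgeMeasure {a, b}) :=
          integral_congr_ae (hl.mono fun x hx => congrArg (· * shape K a x) hx.symm)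
  rwa [hdata, hadj, Finset.sum_singleton, Finset.sum_singleton] at hbound

end IsSetting

/-! ### The nodal problems -/

theorem exists_sum_eq_and_abs_le {ι : Type*} [Finite ι] (𝒮 : Set (Finset ι)) :
    ∃ C : ℝ, 0 ≤ C ∧ ∀ (x : ι → ℝ) (B : ℝ), 0 ≤ B → (∀ s ∈ 𝒮, |∑ p ∈ s, x p| ≤ B) →
      ∃ x' : ι → ℝ, (∀ s ∈ 𝒮, ∑ p ∈ s, x' p = ∑ p ∈ s, x p) ∧ ∀ p, |x' p| ≤ C * B := by
  classical
  have := Fintype.ofFinite ι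
  let Φ : (ι → ℝ) →ₗ[ℝ] (𝒮 → ℝ) := LinearMap.pi fun s => ∑ p ∈ s.1, LinearMap.proj p
  have hΦ : ∀ x s, Φ x s = ∑ p ∈ s.1, x p := fun x s => by simp [Φ]
  obtain ⟨G, hG⟩ := Φ.rangeRestrict.exists_rightInverse_of_surjective
    (LinearMap.range_rangeRestrict Φ)
  refine ⟨‖G.toContinuousLinearMap‖, ContinuousLinearMap.opNorm_nonneg _, fun x B hB hx => ?_⟩
  refine ⟨G (Φ.rangeRestrict x), fun s hs => ?_, fun p => ?_⟩
  · rw [← hΦ _ ⟨s, hs⟩, ← hΦ _ ⟨s, hs⟩]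
    exact congrFun (congrArg Subtype.val (LinearMap.congr_fun hG (Φ.rangeRestrict x))) _
  · have hdata : ‖Φ.rangeRestrict x‖ ≤ B :=
      (pi_norm_le_iff_of_nonneg hB).2 fun s => (congrArg abs (hΦ x s)).trans_le (hx s s.2)
    calc |G (Φ.rangeRestrict x) p| ≤ ‖G (Φ.rangeRestrict x)‖ :=
          norm_le_pi_norm (G (Φ.rangeRestrict x)) p
      _ ≤ ‖G.toContinuousLinearMap‖ * ‖Φ.rangeRestrict x‖ :=
        G.toContinuousLinearMap.le_opNorm _
      _ ≤ ‖G.toContinuousLinearMap‖ * B := by gcongr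

/-- The constant is uniform because, up to relabelling the unknowns, there are only finitely many
such systems. -/
theorem exists_sum_eq_and_abs_le_of_card_le (n : ℕ) :
    ∃ C : ℝ, 0 ≤ C ∧ ∀ {α : Type*} (D : Finset α), D.card ≤ n → ∀ 𝒮 : Set (Finset α),
      (∀ s ∈ 𝒮, s ⊆ D) → ∀ (x : α → ℝ) (B : ℝ), 0 ≤ B → (∀ s ∈ 𝒮, |∑ p ∈ s, x p| ≤ B) →
      ∃ x' : α → ℝ, (∀ s ∈ 𝒮, ∑ p ∈ s, x' p = ∑ p ∈ s, x p) ∧ ∀ p ∈ D, |x' p| ≤ C * B := by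
  classical
  choose c hc0 hc using exists_sum_eq_and_abs_le (ι := Fin n)
  obtain ⟨C, hC⟩ := Finite.exists_le c
  refine ⟨C, (hc0 ∅).trans (hC ∅), fun {α} D hD 𝒮 h𝒮 x B hB hx => ?_⟩
  obtain ⟨j⟩ : Nonempty (D ↪ Fin n) :=
    Function.Embedding.nonempty_of_card_le (by simpa using hD)
  let y : Fin n → ℝ := Function.extend j (fun p => x p) 0
  let relabel (s : Finset α) : Finset (Fin n) := (s.subtype (· ∈ D)).map j
  have sum_relabel : ∀ (z : Fin n → ℝ) (w : α → ℝ), (∀ p : D, z (j p) = w p) →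
      ∀ s ∈ 𝒮, ∑ k ∈ relabel s, z k = ∑ p ∈ s, w p := fun z w hzw s hs => by
    rw [Finset.sum_map, ← Finset.sum_subtype_of_mem w fun p hp => h𝒮 s hs hp]
    exact Finset.sum_congr rfl fun p _ => hzw p
  have hy : ∀ s ∈ 𝒮, ∑ k ∈ relabel s, y k = ∑ p ∈ s, x p :=
    sum_relabel y x fun p => j.injective.extend_apply _ _ p
  obtain ⟨y', hsum, hle⟩ := hc (relabel '' 𝒮) y B hB
    (Set.forall_mem_image.2 fun s hs => (hy s hs).symm ▸ hx s hs)
  have hx' : ∀ p : D, Function.extend Subtype.val (fun p : D => y' (j p)) 0 (p : α) = y' (j p) :=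
    Subtype.val_injective.extend_apply _ _
  refine ⟨Function.extend Subtype.val (fun p : D => y' (j p)) 0, fun s hs => ?_, fun p hp => ?_⟩
  · rw [← sum_relabel y' _ (fun p => (hx' p).symm) s hs, ← hy s hs]
    exact hsum _ (Set.mem_image_of_mem _ hs)
  · rw [hx' ⟨p, hp⟩]
    exact (hle _).trans (mul_le_mul_of_nonneg_right (hC _) hB)

section Patch

variable {T : TriMesh} {ΓD : Finset (Finset Plane)} {i : Plane} {M : ℝ}

/-- The elements that have the vertex `i`. -/
abbrev Patch (T : TriMesh) (i : Plane) : Type := {K : Finset Plane // K ∈ T.elems ∧ i ∈ K}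

noncomputable instance : Fintype (Patch T i) :=
  Fintype.subtype {K ∈ T.elems | i ∈ K} fun _ => Finset.mem_filter

/-- Two elements of the patch of `i` are adjacent if they share an edge that contains `i`. -/
def patchGraph (T : TriMesh) (i : Plane) : SimpleGraph (Patch T i) where
  Adj K J := K ≠ J ∧ ∃ e, e ∈ edgesOf K.1 ∧ e ∈ edgesOf J.1 ∧ i ∈ e
  symm := ⟨fun _ _ ⟨h1, e, h2, h3, h4⟩ => ⟨h1.symm, e, h3, h2, h4⟩⟩
  loopless := ⟨fun _ h => h.1 rfl⟩

theorem edgeLength_le_diam {K e : Finset Plane} (hK : K ∈ T.elems) (he : e ∈ edgesOf K) :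
    edgeLength e ≤ Metric.diam (hull K) := by
  obtain ⟨a, b, ha, hb, hab, rfl⟩ := exists_pair_of_mem_edgesOf he
  obtain ⟨c, h⟩ := exists_isTri_of_pair (T.card_eq K hK) (T.indep K hK) ha hb hab
  rw [edgeLength_pair]
  exact h.norm_sub_le_diam

theorem edgeLength_pos {K e : Finset Plane} (he : e ∈ edgesOf K) : 0 < edgeLength e := by
  obtain ⟨a, b, -, -, hab, rfl⟩ := exists_pair_of_mem_edgesOf he
  rw [edgeLength_pair]
  exact norm_pos_iff.2 (sub_ne_zero.2 hab.symm)

theorem diam_le_edgeLength {K e : Finset Plane}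
    (hM : Metric.diam (hull K) ^ 2 ≤ M * volume.real (hull K))
    (hK : K ∈ T.elems) (he : e ∈ edgesOf K) :
    Metric.diam (hull K) ≤ M / 2 * edgeLength e := by
  obtain ⟨a, b, ha, hb, hab, rfl⟩ := exists_pair_of_mem_edgesOf he
  obtain ⟨c, h⟩ := exists_isTri_of_pair (T.card_eq K hK) (T.indep K hK) ha hb hab
  rw [edgeLength_pair]
  exact h.diam_hull_le hM

theorem diam_le_of_walk (hM2 : 2 ≤ M)
    (hM : ∀ K ∈ T.elems, Metric.diam (hull K) ^ 2 ≤ M * volume.real (hull K))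
    {K J : Patch T i} (p : (patchGraph T i).Walk K J) :
    Metric.diam (hull K.1) ≤ (M / 2) ^ p.length * Metric.diam (hull J.1) := by
  induction p with
  | nil => simp
  | @cons K I J hadj p ih =>
    obtain ⟨e, heK, heI, -⟩ := hadj.2
    calc Metric.diam (hull K.1) ≤ M / 2 * edgeLength e :=
          diam_le_edgeLength (hM K.1 K.2.1) K.2.1 heK
      _ ≤ M / 2 * ((M / 2) ^ p.length * Metric.diam (hull J.1)) := by
        gcongr
        exact (edgeLength_le_diam I.2.1 heI).trans ih
      _ = _ := by rw [SimpleGraph.Walk.length_cons, pow_succ', mul_assoc]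

theorem edgeLength_le_of_reachable (hM2 : 2 ≤ M)
    (hM : ∀ K ∈ T.elems, Metric.diam (hull K) ^ 2 ≤ M * volume.real (hull K)) {N : ℕ}
    (hN : Fintype.card (Patch T i) ≤ N) {K J : Patch T i} (h : (patchGraph T i).Reachable K J)
    {e e' : Finset Plane} (he : e ∈ edgesOf K.1) (he' : e' ∈ edgesOf J.1) :
    edgeLength e ≤ (M / 2) ^ (N + 1) * edgeLength e' := by
  obtain ⟨p⟩ := h
  have hlength : p.bypass.length ≤ N := p.bypass_isPath.length_lt.le.trans hN
  have hM1 : (1 : ℝ) ≤ M / 2 := by linarith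
  calc edgeLength e ≤ Metric.diam (hull K.1) := edgeLength_le_diam K.2.1 he
    _ ≤ (M / 2) ^ p.bypass.length * Metric.diam (hull J.1) := diam_le_of_walk hM2 hM p.bypass
    _ ≤ (M / 2) ^ N * (M / 2 * edgeLength e') := by
      gcongr
      exact diam_le_edgeLength (hM J.1 J.2.1) J.2.1 he'
    _ = _ := by rw [pow_succ, mul_assoc]

/-- The unknowns `(K, e)` of the nodal problem at `i` that belong to the element `K`. -/
noncomputable def elementUnknowns (i : Plane) (K : Finset Plane) :
    Finset (Finset Plane × Finset Plane) :=
  {K} ×ˢ {e ∈ edgesOf K | i ∈ e}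

open Classical in
/-- The unknowns `(K, e)` of the nodal problem at `i` that belong to the elements in the connected
component of `k` in the patch. -/
noncomputable def componentUnknowns (k : Patch T i) : Finset (Finset Plane × Finset Plane) :=
  ({K | (patchGraph T i).Reachable k K} : Finset (Patch T i)).biUnion
    fun K => elementUnknowns i K.1

/-- Each equation of the nodal problem at `i` prescribes the sum of the unknowns over a set of pairs
`(K, e)`; these are the sets that occur. -/
inductive IsNodalEquation (T : TriMesh) (ΓD : Finset (Finset Plane)) (i : Plane) :
    Finset (Finset Plane × Finset Plane) → Prop
  | opposite {e K J : Finset Plane} (hi : i ∈ e) (hK : K ∈ T.adj e) (hJ : J ∈ T.adj e)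
      (hne : K ≠ J) : IsNodalEquation T ΓD i {(K, e), (J, e)}
  | neumann {e K : Finset Plane} (he : e ∈ T.neumannEdges ΓD) (hi : i ∈ e) (hK : K ∈ T.adj e) :
      IsNodalEquation T ΓD i {(K, e)}
  | prolongation {K : Finset Plane} (hK : K ∈ T.elems) (hi : i ∈ K) :
      IsNodalEquation T ΓD i (elementUnknowns i K)

theorem mem_elementUnknowns {K J e : Finset Plane} :
    (J, e) ∈ elementUnknowns i K ↔ J = K ∧ e ∈ edgesOf K ∧ i ∈ e := by
  simp [elementUnknowns, and_comm, eq_comm]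

theorem sum_elementUnknowns (K : Finset Plane) (y : Finset Plane × Finset Plane → ℝ) :
    ∑ p ∈ elementUnknowns i K, y p = ∑ e ∈ edgesOf K with i ∈ e, y (K, e) := by
  rw [elementUnknowns, Finset.sum_product, Finset.sum_singleton]

theorem sum_pair_unknowns {K J : Finset Plane} (h : K ≠ J) (e : Finset Plane)
    (y : Finset Plane × Finset Plane → ℝ) :
    ∑ p ∈ ({(K, e), (J, e)} : Finset _), y p = y (K, e) + y (J, e) :=
  Finset.sum_pair fun h' => h (congrArg Prod.fst h')

theorem mem_of_mem_edge {K e : Finset Plane} (he : e ∈ edgesOf K) (hi : i ∈ e) : i ∈ K :=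
  (Finset.mem_powersetCard.1 he).1 hi

theorem mem_componentUnknowns {k : Patch T i} {K e : Finset Plane} :
    (K, e) ∈ componentUnknowns k ↔
      ∃ J : Patch T i, (patchGraph T i).Reachable k J ∧ J.1 = K ∧ e ∈ edgesOf K ∧ i ∈ e := by
  simp only [componentUnknowns, Finset.mem_biUnion, Finset.mem_filter, Finset.mem_univ, true_and,
    mem_elementUnknowns]
  exact exists_congr fun J => and_congr_right fun _ =>
    ⟨fun ⟨h, h'⟩ => ⟨h.symm, h ▸ h'⟩, fun ⟨h, h'⟩ => ⟨h.symm, h ▸ h'⟩⟩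

theorem TriMesh.card_edgesOf (T : TriMesh) {K : Finset Plane} (hK : K ∈ T.elems) :
    (edgesOf K).card = 3 := by
  rw [edgesOf, Finset.card_powersetCard, T.card_eq K hK]
  rfl

theorem card_componentUnknowns_le (k : Patch T i) :
    (componentUnknowns k).card ≤ Fintype.card (Patch T i) * 3 := by
  refine (Finset.card_biUnion_le_card_mul _ _ 3 fun K _ => ?_).trans
    (Nat.mul_le_mul_right 3 (Finset.card_le_univ _))
  rw [elementUnknowns, Finset.card_product, Finset.card_singleton, one_mul,
    ← T.card_edgesOf K.2.1]
  exact Finset.card_filter_le _ _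

theorem mem_componentUnknowns_of_mem_adj {k : Patch T i} {K J e : Finset Plane}
    (hJ : J ∈ T.adj e) (h : (K, e) ∈ componentUnknowns k) : (J, e) ∈ componentUnknowns k := by
  obtain ⟨I, hreach, rfl, heI, hi⟩ := mem_componentUnknowns.1 h
  obtain ⟨hJT, heJ⟩ := TriMesh.mem_adj.1 hJ
  refine mem_componentUnknowns.2 ⟨⟨J, hJT, mem_of_mem_edge heJ hi⟩, ?_, rfl, heJ, hi⟩
  by_cases hIJ : I = ⟨J, hJT, mem_of_mem_edge heJ hi⟩
  · rwa [← hIJ]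
  · exact hreach.trans (SimpleGraph.Adj.reachable ⟨hIJ, e, heI, heJ, hi⟩)

namespace IsNodalEquation

variable {s : Finset (Finset Plane × Finset Plane)}

theorem subset_or_disjoint_componentUnknowns (hs : IsNodalEquation T ΓD i s) (k : Patch T i) :
    s ⊆ componentUnknowns k ∨ Disjoint s (componentUnknowns k) := by
  suffices ∀ p ∈ s, p ∈ componentUnknowns k → s ⊆ componentUnknowns k by
    by_cases h : ∃ p ∈ s, p ∈ componentUnknowns k
    · exact Or.inl (h.elim fun p hp => this p hp.1 hp.2)
    · exact Or.inr (Finset.disjoint_left.2 fun p hp hp' => h ⟨p, hp, hp'⟩)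
  rintro ⟨I, e'⟩ hp hpk ⟨J, e⟩ hq
  cases hs with
  | @opposite e₀ K₁ K₂ _ h₁ h₂ _ =>
    simp only [Finset.mem_insert, Finset.mem_singleton, Prod.mk.injEq] at hp hq
    obtain rfl : e = e' := by
      rw [hq.elim And.right And.right, hp.elim And.right And.right]
    refine mem_componentUnknowns_of_mem_adj ?_ hpk
    rcases hq with ⟨rfl, rfl⟩ | ⟨rfl, rfl⟩ <;> assumption
  | neumann => rwa [Finset.mem_singleton.1 hq, ← Finset.mem_singleton.1 hp]
  | prolongation =>
    obtain ⟨rfl, heI, -⟩ := mem_elementUnknowns.1 hp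
    obtain ⟨rfl, heJ, hi⟩ := mem_elementUnknowns.1 hq
    obtain ⟨J', hreach, hJ', -⟩ := mem_componentUnknowns.1 hpk
    exact mem_componentUnknowns.2 ⟨J', hreach, hJ', heJ, hi⟩

end IsNodalEquation

section NodalSolution

variable {A : Plane → Plane →L[ℝ] Plane} {f g uh : Plane → ℝ}
  {qn b b' : Finset Plane → Finset Plane → ℝ}

theorem IsNodalSolution.of_sum_eq (h : IsNodalSolution T ΓD A f g uh i b)
    (hsum : ∀ s, IsNodalEquation T ΓD i s → ∑ p ∈ s, b' p.1 p.2 = ∑ p ∈ s, b p.1 p.2) :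
    IsNodalSolution T ΓD A f g uh i b' where
  opposite e he hi K hK J hJ hne := by
    have := hsum _ (.opposite hi hK hJ hne)
    rw [sum_pair_unknowns hne, sum_pair_unknowns hne, h.opposite e he hi K hK J hJ hne] at this
    linarith
  neumann e he hi K hK := by
    have := hsum _ (.neumann he hi hK)
    rw [Finset.sum_singleton, Finset.sum_singleton] at this
    exact this.trans (h.neumann e he hi K hK)
  prolongation K hK hi := by
    have := hsum _ (.prolongation hK hi)
    rw [sum_elementUnknowns, sum_elementUnknowns] at this
    exact this.trans (h.prolongation K hK hi)

/-- The contribution of the edge `e` to the cost of the nodal problem at `i`. -/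
noncomputable def edgeCost (T : TriMesh) (qn : Finset Plane → Finset Plane → ℝ) (i : Plane)
    (b : Finset Plane → Finset Plane → ℝ) (e : Finset Plane) : ℝ :=
  ((T.adj e).card : ℝ)⁻¹ * ∑ K ∈ T.adj e, (b K e - meanFlux T qn i K e) ^ 2 / edgeLength e ^ 2

theorem edgeCost_nonneg (e : Finset Plane) : 0 ≤ edgeCost T qn i b e := by
  unfold edgeCost
  positivity

theorem edgeCost_le {e : Finset Plane} (he : e ∈ T.edges) {c : ℝ}
    (h : ∀ K ∈ T.adj e, (b K e - meanFlux T qn i K e) ^ 2 / edgeLength e ^ 2 ≤ c) :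
    edgeCost T qn i b e ≤ c := by
  obtain ⟨K, hK⟩ := TriMesh.mem_edges.1 he
  have hcard : ((T.adj e).card : ℝ) ≠ 0 :=
    Nat.cast_ne_zero.2 (Finset.card_ne_zero_of_mem (TriMesh.mem_adj.2 hK))
  calc edgeCost T qn i b e ≤ ((T.adj e).card : ℝ)⁻¹ * ∑ _K ∈ T.adj e, c :=
        mul_le_mul_of_nonneg_left (Finset.sum_le_sum h) (by positivity)
    _ = c := by rw [Finset.sum_const, nsmul_eq_mul, inv_mul_cancel_left₀ hcard]

theorem half_mul_le_edgeCost {K e : Finset Plane} (hK : K ∈ T.adj e) :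
    1 / 2 * ((b K e - meanFlux T qn i K e) ^ 2 / edgeLength e ^ 2) ≤ edgeCost T qn i b e := by
  have hpos : (0 : ℝ) < (T.adj e).card := Nat.cast_pos.2 (Finset.card_pos.2 ⟨K, hK⟩)
  have hle : ((T.adj e).card : ℝ) ≤ 2 := by exact_mod_cast T.card_adj_le e
  have hinv : (1 / 2 : ℝ) ≤ ((T.adj e).card : ℝ)⁻¹ := by
    rw [one_div]
    exact inv_anti₀ hpos hle
  exact mul_le_mul hinv (Finset.single_le_sum (f := fun K => (b K e - meanFlux T qn i K e) ^ 2 /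
    edgeLength e ^ 2) (fun _ _ => by positivity) hK) (by positivity) (by positivity)

/-- The edges at `i` in the connected component of `k` in the patch. -/
noncomputable def componentEdges (k : Patch T i) : Finset (Finset Plane) :=
  (componentUnknowns k).image Prod.snd

theorem mem_componentEdges {k : Patch T i} {e : Finset Plane} :
    e ∈ componentEdges k ↔ ∃ K, (K, e) ∈ componentUnknowns k := by
  simp [componentEdges]

theorem componentEdges_subset (k : Patch T i) :
    componentEdges k ⊆ {e ∈ T.edges | i ∈ e} := fun e he => by
  obtain ⟨K, hK⟩ := mem_componentEdges.1 he
  obtain ⟨J, -, rfl, heJ, hi⟩ := mem_componentUnknowns.1 hK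
  exact Finset.mem_filter.2 ⟨TriMesh.mem_edges.2 ⟨J.1, J.2.1, heJ⟩, hi⟩

theorem sum_componentEdges_edgeCost_le (k : Patch T i)
    (hcost : nodalCost T qn i b ≤ nodalCost T qn i b')
    (heq : ∀ K e, (K, e) ∉ componentUnknowns k → b' K e = b K e) :
    ∑ e ∈ componentEdges k, edgeCost T qn i b e ≤
      ∑ e ∈ componentEdges k, edgeCost T qn i b' e := by
  have hsplit : ∀ b, nodalCost T qn i b =
      ∑ e ∈ {e ∈ T.edges | i ∈ e} \ componentEdges k, edgeCost T qn i b e +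
        ∑ e ∈ componentEdges k, edgeCost T qn i b e := fun b =>
    (Finset.sum_sdiff (componentEdges_subset k)).symm
  have hoff : ∑ e ∈ {e ∈ T.edges | i ∈ e} \ componentEdges k, edgeCost T qn i b e =
      ∑ e ∈ {e ∈ T.edges | i ∈ e} \ componentEdges k, edgeCost T qn i b' e := by
    refine Finset.sum_congr rfl fun e he => congrArg _ (Finset.sum_congr rfl fun K _ => ?_)
    rw [heq K e fun h => (Finset.mem_sdiff.1 he).2 (mem_componentEdges.2 ⟨K, h⟩)]
  rw [hsplit b, hsplit b', hoff] at hcost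
  exact le_of_add_le_add_left hcost

/-- Each nodal equation involves a single connected component of the patch, so a solution can be
changed on one component without regard to the others. -/
theorem exists_isNodalSolution_bounded (n : ℕ) : ∃ C : ℝ, 0 ≤ C ∧
    ∀ {T : TriMesh} {ΓD : Finset (Finset Plane)} {A : Plane → Plane →L[ℝ] Plane}
      {f g uh : Plane → ℝ} {i : Plane} {b : Finset Plane → Finset Plane → ℝ}
      (m : Finset Plane → Finset Plane → ℝ) (B : ℝ) (k : Patch T i),
      Fintype.card (Patch T i) ≤ n → 0 ≤ B → IsNodalSolution T ΓD A f g uh i b →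
      (∀ s, IsNodalEquation T ΓD i s → |∑ p ∈ s, (b p.1 p.2 - m p.1 p.2)| ≤ B) →
      ∃ b', IsNodalSolution T ΓD A f g uh i b' ∧
        (∀ K e, (K, e) ∉ componentUnknowns k → b' K e = b K e) ∧
        ∀ K e, (K, e) ∈ componentUnknowns k → |b' K e - m K e| ≤ C * B := by
  obtain ⟨C, hC0, hC⟩ := exists_sum_eq_and_abs_le_of_card_le (n * 3)
  refine ⟨C, hC0, fun {T ΓD A f g uh i b} m B k hn hB hb hsmall => ?_⟩
  obtain ⟨x, hsum, hx⟩ := hC (componentUnknowns k)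
    ((card_componentUnknowns_le k).trans (Nat.mul_le_mul_right 3 hn))
    {s | IsNodalEquation T ΓD i s ∧ s ⊆ componentUnknowns k} (fun s hs => hs.2)
    (fun p => b p.1 p.2 - m p.1 p.2) B hB fun s hs => hsmall s hs.1
  let b' (K e : Finset Plane) : ℝ :=
    if (K, e) ∈ componentUnknowns k then m K e + x (K, e) else b K e
  have hin : ∀ p ∈ componentUnknowns k, b' p.1 p.2 = m p.1 p.2 + x p := fun p hp => if_pos hp
  have hout : ∀ p ∉ componentUnknowns k, b' p.1 p.2 = b p.1 p.2 := fun p hp => if_neg hp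
  refine ⟨b', hb.of_sum_eq fun s hs => ?_, fun K e h => hout (K, e) h, fun K e h => ?_⟩
  · rcases hs.subset_or_disjoint_componentUnknowns k with h | h
    · rw [Finset.sum_congr rfl fun p hp => hin p (h hp), Finset.sum_add_distrib, hsum s ⟨hs, h⟩,
        Finset.sum_sub_distrib, add_sub_cancel]
    · exact Finset.sum_congr rfl fun p hp => hout p (Finset.disjoint_left.1 h hp)
  · rw [hin (K, e) h, add_sub_cancel_left]
    exact hx _ h

theorem edgeCost_le_of_mem_componentEdges (hM2 : 2 ≤ M)
    (hM : ∀ K ∈ T.elems, Metric.diam (hull K) ^ 2 ≤ M * volume.real (hull K)) {N : ℕ}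
    (hN : Fintype.card (Patch T i) ≤ N) {k : Patch T i} {e₀ : Finset Plane}
    (he₀ : e₀ ∈ edgesOf k.1) {c : ℝ}
    (h : ∀ K e, (K, e) ∈ componentUnknowns k → |b K e - meanFlux T qn i K e| ≤ c)
    {e : Finset Plane} (he : e ∈ componentEdges k) :
    edgeCost T qn i b e ≤ (c * (M / 2) ^ (N + 1)) ^ 2 / edgeLength e₀ ^ 2 := by
  obtain ⟨K, hK⟩ := mem_componentEdges.1 he
  refine edgeCost_le (Finset.mem_filter.1 (componentEdges_subset k he)).1 fun J hJ => ?_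
  have hJk := mem_componentUnknowns_of_mem_adj hJ hK
  obtain ⟨I, hreach, rfl, heI, -⟩ := mem_componentUnknowns.1 hJk
  have hl₀ := edgeLength_pos he₀
  have hl := edgeLength_pos heI
  have hcmp := edgeLength_le_of_reachable hM2 hM hN hreach he₀ heI
  have hsq := sq_le_sq' (abs_le.1 (h _ _ hJk)).1 (abs_le.1 (h _ _ hJk)).2
  rw [div_le_div_iff₀ (by positivity) (by positivity)]
  calc (b I.1 e - meanFlux T qn i I.1 e) ^ 2 * edgeLength e₀ ^ 2
      ≤ c ^ 2 * ((M / 2) ^ (N + 1) * edgeLength e) ^ 2 := by gcongr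
    _ = _ := by ring

/-- The cost of the optimal defects is at most that of a competitor bounded by the residuals of
`b^m` in the nodal equations. -/
theorem exists_nodal_bound (M : ℝ) (hM2 : 2 ≤ M) (N : ℕ) : ∃ C : ℝ, 0 ≤ C ∧
    ∀ {T : TriMesh} {ΓD : Finset (Finset Plane)} {A : Plane → Plane →L[ℝ] Plane}
      {f g uh : Plane → ℝ} {qn b : Finset Plane → Finset Plane → ℝ} {i : Plane} {B : ℝ},
      (∀ K ∈ T.elems, Metric.diam (hull K) ^ 2 ≤ M * volume.real (hull K)) →
      Fintype.card (Patch T i) ≤ N → 0 ≤ B → IsNodalSolution T ΓD A f g uh i b →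
      (∀ b', IsNodalSolution T ΓD A f g uh i b' → nodalCost T qn i b ≤ nodalCost T qn i b') →
      (∀ s, IsNodalEquation T ΓD i s →
        |∑ p ∈ s, (b p.1 p.2 - meanFlux T qn i p.1 p.2)| ≤ B) →
      ∀ K ∈ T.elems, ∀ e ∈ edgesOf K, i ∈ e → |b K e - meanFlux T qn i K e| ≤ C * B := by
  obtain ⟨C, hC0, hC⟩ := exists_isNodalSolution_bounded N
  refine ⟨√(2 * (N * 3 : ℕ)) * (C * (M / 2) ^ (N + 1)), by positivity, ?_⟩
  intro T ΓD A f g uh qn b i B hM hN hB hb hmin hsmall K hK e he hi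
  let k : Patch T i := ⟨K, hK, mem_of_mem_edge he hi⟩
  obtain ⟨b', hb', heq, hle⟩ := hC (meanFlux T qn i) B k hN hB hb hsmall
  have hek : e ∈ componentEdges k := mem_componentEdges.2
    ⟨K, mem_componentUnknowns.2 ⟨k, SimpleGraph.Reachable.refl _, rfl, he, hi⟩⟩
  have hcard : (componentEdges k).card ≤ N * 3 :=
    Finset.card_image_le.trans ((card_componentUnknowns_le k).trans (Nat.mul_le_mul_right 3 hN))
  have hl := edgeLength_pos he
  have hcost : 1 / 2 * ((b K e - meanFlux T qn i K e) ^ 2 / edgeLength e ^ 2) ≤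
      (N * 3 : ℕ) * ((C * B * (M / 2) ^ (N + 1)) ^ 2 / edgeLength e ^ 2) :=
    calc _ ≤ edgeCost T qn i b e := half_mul_le_edgeCost (TriMesh.mem_adj.2 ⟨hK, he⟩)
      _ ≤ ∑ e ∈ componentEdges k, edgeCost T qn i b e :=
        Finset.single_le_sum (fun e _ => edgeCost_nonneg e) hek
      _ ≤ ∑ e ∈ componentEdges k, edgeCost T qn i b' e :=
        sum_componentEdges_edgeCost_le k (hmin b' hb') heq
      _ ≤ (componentEdges k).card • ((C * B * (M / 2) ^ (N + 1)) ^ 2 / edgeLength e ^ 2) :=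
        Finset.sum_le_card_nsmul _ _ _ fun e' he' =>
          edgeCost_le_of_mem_componentEdges hM2 hM hN he hle he'
      _ ≤ _ := by
        rw [nsmul_eq_mul]
        gcongr
  refine abs_le_of_sq_le_sq ?_ (by positivity)
  rw [mul_div_assoc', mul_div_assoc', div_le_div_iff_of_pos_right (by positivity)] at hcost
  rw [mul_pow, mul_pow, Real.sq_sqrt (by positivity)]
  linarith

end NodalSolution

end Patch

theorem exists_eq_pair_of_mem {K e : Finset Plane} {i : Plane} (he : e ∈ edgesOf K) (hi : i ∈ e) :
    ∃ j, i ≠ j ∧ e = {i, j} := by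
  obtain ⟨a, b, -, -, hab, rfl⟩ := exists_pair_of_mem_edgesOf he
  rcases Finset.mem_insert.1 hi with rfl | hi
  · exact ⟨b, hab, rfl⟩
  · obtain rfl := Finset.mem_singleton.1 hi
    exact ⟨a, hab.symm, Finset.pair_comm _ _⟩

namespace TriMesh

variable {T : TriMesh} {K J e : Finset Plane} {i : Plane}

theorem integral_edge_shape (hK : K ∈ T.adj e) (hi : i ∈ e) :
    ∫ x, shape K i x ∂(edgeMeasure e) = edgeLength e / 2 := by
  obtain ⟨j, hij, rfl⟩ := exists_eq_pair_of_mem (mem_adj.1 hK).2 hi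
  obtain ⟨c, h⟩ := T.exists_isTri_of_mem_adj hij hK
  rw [h.integral_edge_shape, edgeLength_pair]

theorem shape_eq_zero (hK : K ∈ T.adj e) (hi : i ∉ e) {x : Plane} (hx : x ∈ hull e) :
    shape K i x = 0 := by
  obtain ⟨hKT, heK⟩ := mem_adj.1 hK
  refine convexHull_min (t := {x | shape K i x = 0}) (fun y hy => ?_) (convex_shape_eq_zero K i) hx
  have hyi : y ≠ i := fun h => hi (h ▸ hy)
  rw [Set.mem_ofPred_eq, shape_apply (T.indep K hKT) i ((Finset.mem_powersetCard.1 heK).1 hy),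
    if_neg hyi]

theorem adj_eq_singleton_or (hK : K ∈ T.adj e) :
    T.adj e = {K} ∨ ∃ J, K ≠ J ∧ T.adj e = {K, J} := by
  by_cases hJ : ∃ J ∈ T.adj e, K ≠ J
  · obtain ⟨J, hJ, hne⟩ := hJ
    refine Or.inr ⟨J, hne, (Finset.eq_of_subset_of_card_le ?_ ?_).symm⟩
    · exact Finset.insert_subset hK (Finset.singleton_subset_iff.2 hJ)
    · rw [Finset.card_pair hne]
      exact T.card_adj_le e
  · push Not at hJ
    exact Or.inl (Finset.eq_singleton_iff_unique_mem.2 ⟨hK, fun J hJ' => (hJ J hJ').symm⟩)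

end TriMesh

section MeanFlux

variable {T : TriMesh} {qn : Finset Plane → Finset Plane → ℝ} {K J e : Finset Plane} {i : Plane}

theorem meanFlux_eq (hK : K ∈ T.adj e) (hi : i ∈ e) : meanFlux T qn i K e = edgeLength e / 2 *
    (((T.adj e).card : ℝ)⁻¹ * ∑ J ∈ T.adj e, if J = K then qn J e else -qn J e) := by
  rw [meanFlux, integral_mul_const, TriMesh.integral_edge_shape hK hi]

theorem meanFlux_of_adj_eq_singleton (h : T.adj e = {K}) (hi : i ∈ e) :
    meanFlux T qn i K e = qn K e * (edgeLength e / 2) := by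
  rw [meanFlux_eq (h ▸ Finset.mem_singleton_self K) hi, h]
  simp [mul_comm]

theorem meanFlux_of_adj_eq_pair (hne : K ≠ J) (h : T.adj e = {K, J}) (hi : i ∈ e) :
    meanFlux T qn i K e = edgeLength e / 4 * (qn K e - qn J e) := by
  rw [meanFlux_eq (h ▸ Finset.mem_insert_self K {J}) hi, h, Finset.card_pair hne,
    Finset.sum_pair hne, if_pos rfl, if_neg hne.symm]
  push_cast
  ring

theorem meanFlux_neg (hK : K ∈ T.adj e) (hJ : J ∈ T.adj e) (hne : K ≠ J) (hi : i ∈ e) :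
    meanFlux T qn i J e = -meanFlux T qn i K e := by
  rcases TriMesh.adj_eq_singleton_or hK with h | ⟨J', hne', h⟩
  · exact absurd (Finset.mem_singleton.1 (h ▸ hJ)).symm hne
  · obtain rfl : J = J' := by
      simpa [hne.symm] using (h ▸ hJ : J ∈ ({K, J'} : Finset (Finset Plane)))
    rw [meanFlux_of_adj_eq_pair hne h hi,
      meanFlux_of_adj_eq_pair hne.symm (h.trans (Finset.pair_comm K J)) hi]
    ring

end MeanFlux

/-- The energy of the error on the patch of the vertex `i`. -/
noncomputable def patchError (T : TriMesh) (A : Plane → Plane →L[ℝ] Plane) (u : H1 T.domain)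
    (uh : Plane → ℝ) (i : Plane) : ℝ :=
  ∑ K ∈ T.elems with i ∈ K, elemError A u uh K

namespace IsSetting

variable {T : TriMesh} {ΓD : Finset (Finset Plane)} {aMin aMax M : ℝ}
  {A : Plane → Plane →L[ℝ] Plane} {f g : Plane → ℝ} {u : H1 T.domain} {uh : Plane → ℝ}
  {qn : Finset Plane → Finset Plane → ℝ} {K e : Finset Plane} {i : Plane}
  {b : Finset Plane → Finset Plane → ℝ}

theorem patchError_nonneg (S : IsSetting T ΓD aMin aMax M A f g u uh qn) (i : Plane) :
    0 ≤ patchError T A u uh i :=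
  Finset.sum_nonneg fun _ hK => S.elemError_nonneg (Finset.mem_filter.1 hK).1

theorem sqrt_elemError_le (S : IsSetting T ΓD aMin aMax M A f g u uh qn) (hK : K ∈ T.elems)
    (hi : i ∈ K) : √(elemError A u uh K) ≤ √(patchError T A u uh i) :=
  Real.sqrt_le_sqrt <| Finset.single_le_sum (f := elemError A u uh)
    (fun _ hK => S.elemError_nonneg (Finset.mem_filter.1 hK).1) (Finset.mem_filter.2 ⟨hK, hi⟩)

theorem sqrt_mul_sqrt_elemError_le (S : IsSetting T ΓD aMin aMax M A f g u uh qn)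
    (hK : K ∈ T.adj e) (hi : i ∈ e) {c : ℝ} (hc : 0 ≤ c) :
    c * √(elemError A u uh K) ≤ c * √(patchError T A u uh i) :=
  mul_le_mul_of_nonneg_left (S.sqrt_elemError_le (TriMesh.mem_adj.1 hK).1
    (mem_of_mem_edge (TriMesh.mem_adj.1 hK).2 hi)) hc

theorem abs_sub_meanFlux_le (S : IsSetting T ΓD aMin aMax M A f g u uh qn) (hK : K ∈ T.adj e)
    (hi : i ∈ e) : |qn K e * (edgeLength e / 2) - meanFlux T qn i K e| ≤
      733 * √(aMax * M) * √(patchError T A u uh i) := by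
  rcases TriMesh.adj_eq_singleton_or hK with hadj | ⟨J, hne, hadj⟩
  · rw [meanFlux_of_adj_eq_singleton hadj hi, sub_self, abs_zero]
    positivity
  have hJ : J ∈ T.adj e := by simp [hadj]
  have hdiff : qn K e * (edgeLength e / 2) - meanFlux T qn i K e =
      1 / 2 * ((qn K e + qn J e) * (edgeLength e / 2)) := by
    rw [meanFlux_of_adj_eq_pair hne hadj hi]
    ring
  obtain ⟨j, hij, rfl⟩ := exists_eq_pair_of_mem (TriMesh.mem_adj.1 hK).2 hi
  have hjump := S.abs_jump_le hij (by rw [hadj, Finset.card_pair hne])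
  rw [hadj, Finset.sum_pair hne, Finset.sum_pair hne, ← edgeLength_pair] at hjump
  rw [hdiff, abs_mul, abs_of_pos one_half_pos]
  linarith [S.sqrt_mul_sqrt_elemError_le hK hi (by positivity : 0 ≤ 733 * √(aMax * M)),
    S.sqrt_mul_sqrt_elemError_le hJ hi (by positivity : 0 ≤ 733 * √(aMax * M))]

theorem integral_inner_feFlux_shapeGrad (S : IsSetting T ΓD aMin aMax M A f g u uh qn)
    (hK : K ∈ T.elems) (i : Plane) : ∫ x in hull K, ⟪feFlux A uh x, shapeGrad K i⟫ =
      ∑ e ∈ edgesOf K with i ∈ e, qn K e * (edgeLength e / 2) := by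
  have hgreen := S.integral_inner_feFlux hK (contDiff_shape K i)
  simp only [gradient_shape] at hgreen
  rw [hgreen, Finset.sum_filter]
  refine Finset.sum_congr rfl fun e he => ?_
  have hadj : K ∈ T.adj e := TriMesh.mem_adj.2 ⟨hK, he⟩
  split_ifs with hie
  · rw [integral_mul_const, TriMesh.integral_edge_shape hadj hie, mul_comm]
  · exact integral_edge_eq_zero fun x hx => by
      rw [TriMesh.shape_eq_zero hadj hie hx, zero_mul]

theorem nodalLoad_eq (S : IsSetting T ΓD aMin aMax M A f g u uh qn) (hK : K ∈ T.elems)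
    (hi : i ∈ K) {k : ℝ} (hk : ∀ᵐ x ∂(volume.restrict (hull K)), f x = k) :
    nodalLoad A f uh K i = (∑ e ∈ edgesOf K with i ∈ e, qn K e * (edgeLength e / 2)) -
      k * (volume.real (hull K) / 3) := by
  obtain ⟨j, l, h⟩ := exists_isTri_of_mem (T.card_eq K hK) (T.indep K hK) hi
  have hae : (fun x => f x * shape K i x) =ᵐ[volume.restrict (hull K)]
      fun x => k * shape K i x := hk.mono fun x hx => congrArg (· * shape K i x) hx
  rw [nodalLoad, integral_sub, S.integral_inner_feFlux_shapeGrad hK, integral_congr_ae hae,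
    integral_const_mul, h.integral_shape]
  · exact integrable_inner_of_memLp (S.memLp_feFlux hK)
      (memLp_of_continuous_of_isCompact (isCompact_hull K) continuous_const 2)
  · exact (integrableOn_hull_of_continuous (continuous_const.mul (continuous_shape K i)) K).congr
      hae.symm

theorem sum_nodal_sub (S : IsSetting T ΓD aMin aMax M A f g u uh qn) (hK : K ∈ T.elems)
    (hi : i ∈ K) {k : ℝ} (hk : ∀ᵐ x ∂(volume.restrict (hull K)), f x = k)
    (hb : IsNodalSolution T ΓD A f g uh i b) :
    ∑ e ∈ edgesOf K with i ∈ e, (b K e - qn K e * (edgeLength e / 2)) =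
      -(k * (volume.real (hull K) / 3)) := by
  rw [Finset.sum_sub_distrib, hb.prolongation K hK hi, S.nodalLoad_eq hK hi hk]
  ring

theorem abs_neumann_sub_meanFlux_le (S : IsSetting T ΓD aMin aMax M A f g u uh qn)
    (hb : IsNodalSolution T ΓD A f g uh i b) (he : e ∈ T.neumannEdges ΓD) (hi : i ∈ e)
    (hK : K ∈ T.adj e) :
    |b K e - meanFlux T qn i K e| ≤ 733 * √(aMax * M) * √(patchError T A u uh i) := by
  obtain ⟨J, hJ⟩ := Finset.card_eq_one.1
    (TriMesh.mem_boundaryEdges.1 (Finset.mem_sdiff.1 he).1).2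
  obtain rfl : K = J := Finset.mem_singleton.1 (hJ ▸ hK)
  rw [meanFlux_of_adj_eq_singleton hJ hi, hb.neumann e he hi K hK]
  refine le_trans ?_ (S.sqrt_mul_sqrt_elemError_le hK hi (by positivity))
  obtain ⟨j, hij, rfl⟩ := exists_eq_pair_of_mem (TriMesh.mem_adj.1 hK).2 hi
  rw [edgeLength_pair]
  exact S.abs_neumann_residual_le hij he hK

theorem abs_sum_edgesOf_sub_meanFlux_le (S : IsSetting T ΓD aMin aMax M A f g u uh qn)
    (hb : IsNodalSolution T ΓD A f g uh i b) (hK : K ∈ T.elems) (hi : i ∈ K) :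
    |∑ e ∈ edgesOf K with i ∈ e, (b K e - meanFlux T qn i K e)| ≤
      2229 * √(aMax * M) * √(patchError T A u uh i) := by
  obtain ⟨k, hk⟩ := S.const K hK
  have hsplit : ∑ e ∈ edgesOf K with i ∈ e, (b K e - meanFlux T qn i K e) =
      -(k * (volume.real (hull K) / 3)) +
        ∑ e ∈ edgesOf K with i ∈ e, (qn K e * (edgeLength e / 2) - meanFlux T qn i K e) := by
    rw [← S.sum_nodal_sub hK hi hk hb, ← Finset.sum_add_distrib]
    exact Finset.sum_congr rfl fun e _ => by ring
  have hload : |k * (volume.real (hull K) / 3)| ≤ 30 * √(aMax * M) * √(patchError T A u uh i) := by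
    rw [abs_mul, abs_of_nonneg (by positivity : 0 ≤ volume.real (hull K) / 3)]
    linarith [S.abs_mul_volume_le hK hk, mul_le_mul_of_nonneg_left (S.sqrt_elemError_le hK hi)
      (by positivity : 0 ≤ 90 * √(aMax * M))]
  have hcard : (({e ∈ edgesOf K | i ∈ e} : Finset _).card : ℝ) ≤ 3 := by
    exact_mod_cast (Finset.card_filter_le _ _).trans (T.card_edgesOf hK).le
  have hflux : |∑ e ∈ edgesOf K with i ∈ e,
      (qn K e * (edgeLength e / 2) - meanFlux T qn i K e)| ≤
        3 * (733 * √(aMax * M) * √(patchError T A u uh i)) :=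
    calc _ ≤ ∑ e ∈ edgesOf K with i ∈ e, |qn K e * (edgeLength e / 2) - meanFlux T qn i K e| :=
          Finset.abs_sum_le_sum_abs _ _
      _ ≤ _ := Finset.sum_le_card_nsmul _ _ _ fun e he =>
          S.abs_sub_meanFlux_le (TriMesh.mem_adj.2 ⟨hK, (Finset.mem_filter.1 he).1⟩)
            (Finset.mem_filter.1 he).2
      _ ≤ _ := by
        rw [nsmul_eq_mul]
        gcongr
  rw [hsplit]
  refine (abs_add_le _ _).trans ?_
  rw [abs_neg]
  linarith

theorem abs_sum_sub_meanFlux_le (S : IsSetting T ΓD aMin aMax M A f g u uh qn)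
    (hb : IsNodalSolution T ΓD A f g uh i b) {s : Finset (Finset Plane × Finset Plane)}
    (hs : IsNodalEquation T ΓD i s) :
    |∑ p ∈ s, (b p.1 p.2 - meanFlux T qn i p.1 p.2)| ≤
      2229 * √(aMax * M) * √(patchError T A u uh i) := by
  cases hs with
  | @opposite e K J hi hK hJ hne =>
    rw [sum_pair_unknowns hne,
      hb.opposite e (TriMesh.mem_edges.2 ⟨K, TriMesh.mem_adj.1 hK⟩) hi K hK J hJ hne,
      meanFlux_neg hK hJ hne hi, ← neg_sub', add_neg_cancel, abs_zero]
    positivity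
  | neumann he hi hK =>
    rw [Finset.sum_singleton]
    refine (S.abs_neumann_sub_meanFlux_le hb he hi hK).trans ?_
    gcongr
    norm_num
  | prolongation hK hi =>
    rw [sum_elementUnknowns]
    exact S.abs_sum_edgesOf_sub_meanFlux_le hb hK hi

end IsSetting

theorem exists_traction_bound (M : ℝ) (hM2 : 2 ≤ M) (N : ℕ) : ∃ C : ℝ, 0 ≤ C ∧
    ∀ {T : TriMesh} {ΓD : Finset (Finset Plane)} {aMin aMax : ℝ} {A : Plane → Plane →L[ℝ] Plane}
      {f g : Plane → ℝ} {u : H1 T.domain} {uh : Plane → ℝ} {qn : Finset Plane → Finset Plane → ℝ}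
      {i : Plane} {b : Finset Plane → Finset Plane → ℝ},
      IsSetting T ΓD aMin aMax M A f g u uh qn → Fintype.card (Patch T i) ≤ N →
      IsNodalSolution T ΓD A f g uh i b →
      (∀ b', IsNodalSolution T ΓD A f g uh i b' → nodalCost T qn i b ≤ nodalCost T qn i b') →
      ∀ K ∈ T.elems, ∀ e ∈ edgesOf K, i ∈ e → |b K e - qn K e * (edgeLength e / 2)| ≤
        C * (√(aMax * M) * √(patchError T A u uh i)) := by
  obtain ⟨C, hC0, hC⟩ := exists_nodal_bound M hM2 N
  refine ⟨C * 2229 + 733, by positivity, ?_⟩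
  intro T ΓD aMin aMax A f g u uh qn i b S hN hb hmin K hK e he hi
  have hdefect := hC S.area hN (by positivity) hb hmin
    (fun s hs => S.abs_sum_sub_meanFlux_le hb hs) K hK e he hi
  have hmean := S.abs_sub_meanFlux_le (TriMesh.mem_adj.2 ⟨hK, he⟩) hi
  rw [abs_sub_comm] at hmean
  linarith [abs_sub_le (b K e) (meanFlux T qn i K e) (qn K e * (edgeLength e / 2))]

/-! ### Fields with prescribed normal traces -/

section NormalTrace

variable {T : TriMesh} {K : Finset Plane} {q q' : Plane → Plane} {d d' : Plane → ℝ}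
  {t t' : Finset Plane → Plane → ℝ}

theorem HasNormalTrace.congr (h : HasNormalTrace K q d t)
    (hd : d =ᵐ[volume.restrict (hull K)] d') (ht : ∀ e ∈ edgesOf K, t e =ᵐ[edgeMeasure e] t' e) :
    HasNormalTrace K q d' t' := by
  intro ψ hψ
  calc ∫ x in hull K, (⟪q x, gradient ψ x⟫ + d' x * ψ x)
      = ∫ x in hull K, (⟪q x, gradient ψ x⟫ + d x * ψ x) :=
        integral_congr_ae (hd.mono fun x hx => by simp only [hx])
    _ = ∑ e ∈ edgesOf K, ∫ x, t e x * ψ x ∂(edgeMeasure e) := h ψ hψ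
    _ = _ := Finset.sum_congr rfl fun e he =>
        integral_congr_ae ((ht e he).mono fun x hx => by simp only [hx])

theorem integrableOn_inner_gradient (hq : MemLp q 2 (volume.restrict (hull K))) {ψ : Plane → ℝ}
    (hψ : ContDiff ℝ 1 ψ) : IntegrableOn (fun x => ⟪q x, gradient ψ x⟫) (hull K) :=
  integrable_inner_of_memLp hq
    (memLp_of_continuous_of_isCompact (isCompact_hull K) (continuous_gradient hψ) 2)

theorem integrableOn_mul_hull (hd : MemLp d 2 (volume.restrict (hull K))) {ψ : Plane → ℝ}
    (hψ : Continuous ψ) : IntegrableOn (fun x => d x * ψ x) (hull K) :=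
  hd.integrable_mul (memLp_of_continuous_of_isCompact (isCompact_hull K) hψ 2)

theorem HasNormalTrace.add (h : HasNormalTrace K q d t) (h' : HasNormalTrace K q' d' t')
    (hq : MemLp q 2 (volume.restrict (hull K))) (hq' : MemLp q' 2 (volume.restrict (hull K)))
    (hd : MemLp d 2 (volume.restrict (hull K))) (hd' : MemLp d' 2 (volume.restrict (hull K)))
    (ht : ∀ e ∈ edgesOf K, Continuous (t e)) (ht' : ∀ e ∈ edgesOf K, Continuous (t' e)) :
    HasNormalTrace K (fun x => q x + q' x) (fun x => d x + d' x) (fun e x => t e x + t' e x) := by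
  intro ψ hψ
  have hψ1 : ContDiff ℝ 1 ψ := hψ.of_le (by simp)
  have hsplit : ∀ x, ⟪q x + q' x, gradient ψ x⟫ + (d x + d' x) * ψ x =
      (⟪q x, gradient ψ x⟫ + d x * ψ x) + (⟪q' x, gradient ψ x⟫ + d' x * ψ x) := fun x => by
    rw [inner_add_left]
    ring
  have hint : IntegrableOn (fun x => ⟪q x, gradient ψ x⟫ + d x * ψ x) (hull K) :=
    (integrableOn_inner_gradient hq hψ1).add (integrableOn_mul_hull hd hψ.continuous)
  have hint' : IntegrableOn (fun x => ⟪q' x, gradient ψ x⟫ + d' x * ψ x) (hull K) :=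
    (integrableOn_inner_gradient hq' hψ1).add (integrableOn_mul_hull hd' hψ.continuous)
  simp only [hsplit]
  rw [integral_add hint hint', h ψ hψ, h' ψ hψ, ← Finset.sum_add_distrib]
  refine Finset.sum_congr rfl fun e he => ?_
  simp only [add_mul]
  exact (integral_add (integrable_edgeMeasure he ((ht e he).mul hψ.continuous))
    (integrable_edgeMeasure he ((ht' e he).mul hψ.continuous))).symm

theorem TriMesh.notMem_interior_hull {e : Finset Plane} (hK : K ∈ T.adj e) {x : Plane}
    (hx : x ∈ hull e) : x ∉ interior (hull K) := by
  obtain ⟨a, b, _, _, hab, rfl⟩ := exists_pair_of_mem_edgesOf (mem_adj.1 hK).2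
  obtain ⟨c, h⟩ := T.exists_isTri_of_mem_adj hab hK
  exact fun hi => h.hull_notMem_nhds hx (mem_interior_iff_mem_nhds.1 hi)

theorem HasNormalTrace.hasWeakDiv (h : HasNormalTrace K q d t) (hK : K ∈ T.elems)
    (hq : MemLp q 2 (volume.restrict (hull K))) (hd : MemLp d 2 (volume.restrict (hull K))) :
    HasWeakDiv K q d := by
  intro ψ hψ _ hsupp
  have hboundary : ∑ e ∈ edgesOf K, ∫ x, t e x * ψ x ∂(edgeMeasure e) = 0 := by
    refine Finset.sum_eq_zero fun e he => integral_edge_eq_zero fun x hx => ?_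
    have hx' := TriMesh.notMem_interior_hull (TriMesh.mem_adj.2 ⟨hK, he⟩) hx
    rw [image_eq_zero_of_notMem_tsupport fun h => hx' (hsupp h), mul_zero]
  have hgreen := h ψ hψ
  rw [hboundary, integral_add (integrableOn_inner_gradient hq (hψ.of_le (by simp)))
    (integrableOn_mul_hull hd hψ.continuous)] at hgreen
  exact eq_neg_of_add_eq_zero_left hgreen

end NormalTrace

/-- The vertex of the triangle `K` opposite to the edge `e`, written as the sum of the vertices
outside `e` so as to be total. -/
noncomputable def oppVertex (K e : Finset Plane) : Plane := ∑ z ∈ K \ e, z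

theorem IsTri.oppVertex_eq {K : Finset Plane} {a b c : Plane} (h : IsTri K a b c) :
    oppVertex K {a, b} = c := by
  have hs : K \ {a, b} = {c} := by
    ext x
    simp only [Finset.mem_sdiff, h.mem, Finset.mem_insert, Finset.mem_singleton]
    have h1 := h.ac.symm
    have h2 := h.bc.symm
    grind
  rw [oppVertex, hs, Finset.sum_singleton]

/-- The affine field on `K` whose normal component on each edge `e` is
`∑_{i ∈ e} κ e i φ_i / |e|`: the normal component of `φ_i (i - z)`, with `z` opposite to `e`,
vanishes on the two other edges. -/
noncomputable def edgeField (K : Finset Plane) (κ : Finset Plane → Plane → ℝ) (x : Plane) : Plane :=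
  ∑ e ∈ edgesOf K, ∑ i ∈ e,
    (κ e i / (2 * volume.real (hull K)) * shape K i x) • (i - oppVertex K e)

section EdgeField

variable {T : TriMesh} {K e : Finset Plane} {κ : Finset Plane → Plane → ℝ} {ψ : Plane → ℝ}

theorem continuous_edgeField (K : Finset Plane) (κ : Finset Plane → Plane → ℝ) :
    Continuous (edgeField K κ) :=
  continuous_finsetSum _ fun _ _ => continuous_finsetSum _ fun i _ =>
    (continuous_const.mul (continuous_shape K i)).smul continuous_const

theorem TriMesh.setIntegral_shape_mul_fderiv_add (hK : K ∈ T.adj e) {i : Plane} (hi : i ∈ e)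
    (hψ : ContDiff ℝ 1 ψ) :
    ∫ x in hull K, (shape K i x * fderiv ℝ ψ x (i - oppVertex K e) + ψ x) =
      2 * volume.real (hull K) * ((edgeLength e)⁻¹ * ∫ x, shape K i x * ψ x ∂(edgeMeasure e)) := by
  obtain ⟨j, hij, rfl⟩ := exists_eq_pair_of_mem (mem_adj.1 hK).2 hi
  obtain ⟨c, h⟩ := T.exists_isTri_of_mem_adj hij hK
  have hs := contDiff_shape K i
  have hd : ∀ x, fderiv ℝ (fun y => shape K i y * ψ y) x (i - c) =
      shape K i x * fderiv ℝ ψ x (i - c) + ψ x := by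
    intro x
    have h1 : fderiv ℝ (fun y => shape K i y) x (i - c) = 1 := by
      rw [← inner_gradient_left, gradient_shape, inner_shapeGrad, h.shape_aa, h.shape_ac, sub_zero]
    rw [fderiv_fun_mul (hs.differentiable (by simp) x) (hψ.differentiable (by simp) x)]
    simp [h1]
  have h' : IsTri K c j i := h.rotate.swap
  have h0 : ∫ x, shape K i x * ψ x ∂(edgeMeasure {c, j}) = 0 :=
    integral_edge_eq_zero fun x hx => by rw [h'.shape_edge hx, zero_mul]
  rw [h.oppVertex_eq]
  simp only [← hd]
  rw [h'.setIntegral_fderiv_eq_integral_edge (F := fun y => shape K i y * ψ y)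
    ((hs.of_le (by simp)).mul hψ), h0, Finset.pair_comm j i, edgeLength_pair, norm_sub_rev]
  ring

theorem inner_edgeField_gradient_add (x : Plane) :
    ⟪edgeField K κ x, gradient ψ x⟫ +
        (∑ e ∈ edgesOf K, ∑ i ∈ e, κ e i) / (2 * volume.real (hull K)) * ψ x =
      ∑ e ∈ edgesOf K, ∑ i ∈ e, κ e i / (2 * volume.real (hull K)) *
        (shape K i x * fderiv ℝ ψ x (i - oppVertex K e) + ψ x) := by
  simp only [real_inner_comm, inner_gradient_left, edgeField, map_sum, map_smul, smul_eq_mul,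
    Finset.sum_div, Finset.sum_mul, mul_add, Finset.sum_add_distrib, mul_assoc]

theorem hasNormalTrace_edgeField (hK : K ∈ T.elems) (κ : Finset Plane → Plane → ℝ) :
    HasNormalTrace K (edgeField K κ)
      (fun _ => (∑ e ∈ edgesOf K, ∑ i ∈ e, κ e i) / (2 * volume.real (hull K)))
      (fun e x => (∑ i ∈ e, κ e i * shape K i x) / edgeLength e) := by
  intro ψ hψ
  obtain ⟨a, b, c, h⟩ := T.exists_isTri hK
  have hv := h.volume_hull_pos
  have hψc := hψ.continuous
  have hdψ := hψ.continuous_fderiv (by simp)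
  have hφ := fun i => continuous_shape K i
  have hint : ∀ e i, IntegrableOn (fun x => κ e i / (2 * volume.real (hull K)) *
      (shape K i x * fderiv ℝ ψ x (i - oppVertex K e) + ψ x)) (hull K) := fun e i => by
    have := hφ i
    exact integrableOn_hull_of_continuous (by fun_prop) K
  simp only [inner_edgeField_gradient_add]
  rw [integral_finsetSum _ fun e _ => integrable_finsetSum _ fun i _ => hint e i]
  refine Finset.sum_congr rfl fun e he => ?_
  simp only [Finset.sum_div, Finset.sum_mul]
  rw [integral_finsetSum _ fun i _ => hint e i, integral_finsetSum]
  · refine Finset.sum_congr rfl fun i hi => ?_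
    rw [integral_const_mul, TriMesh.setIntegral_shape_mul_fderiv_add
      (TriMesh.mem_adj.2 ⟨hK, he⟩) hi (hψ.of_le (by simp))]
    simp only [mul_div_right_comm, mul_assoc]
    rw [integral_const_mul]
    field_simp
  · intro i _
    have := hφ i
    exact integrable_edgeMeasure he (by fun_prop)

theorem norm_edgeField_term_le (hK : K ∈ T.adj e) {i : Plane} (hi : i ∈ e) {k Y : ℝ} (hk : |k| ≤ Y)
    {x : Plane} (hx : x ∈ hull K) :
    ‖(k / (2 * volume.real (hull K)) * shape K i x) • (i - oppVertex K e)‖ ≤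
      Y / (2 * volume.real (hull K)) * Metric.diam (hull K) := by
  obtain ⟨j, hij, rfl⟩ := exists_eq_pair_of_mem (TriMesh.mem_adj.1 hK).2 hi
  obtain ⟨c, h⟩ := T.exists_isTri_of_mem_adj hij hK
  have hv := h.volume_hull_pos
  obtain ⟨h0, h1⟩ := h.shape_mem_Icc hx
  have hY : 0 ≤ Y := (abs_nonneg _).trans hk
  have hdiam := h.rotate.rotate.norm_sub_le_diam
  calc ‖(k / (2 * volume.real (hull K)) * shape K i x) • (i - oppVertex K {i, j})‖
      = |k| / (2 * volume.real (hull K)) * shape K i x * ‖i - c‖ := by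
        rw [norm_smul, h.oppVertex_eq, Real.norm_eq_abs, abs_mul, abs_div, abs_of_nonneg h0,
          abs_of_pos (by positivity : 0 < 2 * volume.real (hull K))]
    _ ≤ Y / (2 * volume.real (hull K)) * 1 * Metric.diam (hull K) := by gcongr
    _ = _ := by rw [mul_one]

theorem norm_edgeField_le (hK : K ∈ T.elems) {Y : ℝ}
    (hκ : ∀ e ∈ edgesOf K, ∀ i ∈ e, |κ e i| ≤ Y) {x : Plane} (hx : x ∈ hull K) :
    ‖edgeField K κ x‖ ≤ 3 * Y * Metric.diam (hull K) / volume.real (hull K) := by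
  calc ‖edgeField K κ x‖ ≤ ∑ e ∈ edgesOf K, ∑ i ∈ e,
        Y / (2 * volume.real (hull K)) * Metric.diam (hull K) :=
        norm_sum_le_of_le _ fun e he => norm_sum_le_of_le _ fun i hi =>
          norm_edgeField_term_le (TriMesh.mem_adj.2 ⟨hK, he⟩) hi (hκ e he i hi) hx
    _ = ∑ e ∈ edgesOf K, 2 • (Y / (2 * volume.real (hull K)) * Metric.diam (hull K)) :=
        Finset.sum_congr rfl fun e he => by
          rw [Finset.sum_const, (Finset.mem_powersetCard.1 he).2]
    _ = _ := by
        rw [Finset.sum_const, T.card_edgesOf hK]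
        simp only [nsmul_eq_mul, Nat.cast_ofNat]
        ring

theorem integral_norm_sq_edgeField_le (hK : K ∈ T.elems) {M : ℝ}
    (hM : Metric.diam (hull K) ^ 2 ≤ M * volume.real (hull K)) {Y : ℝ}
    (hκ : ∀ e ∈ edgesOf K, ∀ i ∈ e, |κ e i| ≤ Y) :
    ∫ x in hull K, ‖edgeField K κ x‖ ^ 2 ≤ 9 * M * Y ^ 2 := by
  obtain ⟨a, b, c, h⟩ := T.exists_isTri hK
  have hv := h.volume_hull_pos
  calc ∫ x in hull K, ‖edgeField K κ x‖ ^ 2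
      ≤ ∫ x in hull K, (3 * Y * Metric.diam (hull K) / volume.real (hull K)) ^ 2 :=
        setIntegral_mono_on
          (integrableOn_hull_of_continuous ((continuous_edgeField K κ).norm.pow 2) K)
          (integrableOn_hull_of_continuous continuous_const K) (measurableSet_hull K)
          fun x hx => pow_le_pow_left₀ (norm_nonneg _) (norm_edgeField_le hK hκ hx) 2
    _ = 9 * Y ^ 2 * (Metric.diam (hull K) ^ 2 / volume.real (hull K)) := by
        rw [setIntegral_const, smul_eq_mul]
        field_simp
        ring
    _ ≤ 9 * Y ^ 2 * M := by
        gcongr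
        rwa [div_le_iff₀ hv]
    _ = _ := by ring

end EdgeField

/-- The coefficients, in the basis `φ_i / |e|`, `i ∈ e`, of the affine function `l` on the edge `e`
whose moments `∫_e l φ_i` are `y i`. They are `4 y_i - 2 y_j`, since the mass matrix of an edge has
the entries `|e| / 3` and `|e| / 6`. -/
def momentCoeff (e : Finset Plane) (y : Plane → ℝ) (i : Plane) : ℝ := 6 * y i - 2 * ∑ j ∈ e, y j

section MomentCoeff

variable {T : TriMesh} {K e : Finset Plane} {y : Plane → ℝ}

theorem sum_momentCoeff (he : e ∈ edgesOf K) :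
    ∑ i ∈ e, momentCoeff e y i = 2 * ∑ i ∈ e, y i := by
  simp only [momentCoeff, Finset.sum_sub_distrib, ← Finset.mul_sum, Finset.sum_const,
    (Finset.mem_powersetCard.1 he).2, nsmul_eq_mul, Nat.cast_ofNat]
  ring

theorem abs_momentCoeff_le (he : e ∈ edgesOf K) {Y : ℝ} (hy : ∀ i ∈ e, |y i| ≤ Y) {i : Plane}
    (hi : i ∈ e) : |momentCoeff e y i| ≤ 10 * Y := by
  have hsum : |∑ j ∈ e, y j| ≤ 2 * Y := by
    calc |∑ j ∈ e, y j| ≤ ∑ j ∈ e, |y j| := Finset.abs_sum_le_sum_abs _ _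
      _ ≤ e.card • Y := Finset.sum_le_card_nsmul _ _ Y hy
      _ = 2 * Y := by rw [(Finset.mem_powersetCard.1 he).2, nsmul_eq_mul, Nat.cast_ofNat]
  have hyi := hy i hi
  rw [abs_le] at hsum hyi ⊢
  rw [momentCoeff]
  constructor <;> linarith

theorem TriMesh.affine_eq_sum_momentCoeff (hK : K ∈ T.adj e) (l : Plane →ᵃ[ℝ] ℝ)
    (hl : ∀ i ∈ e, ∫ x, l x * shape K i x ∂(edgeMeasure e) = y i) {x : Plane} (hx : x ∈ hull e) :
    l x = (∑ i ∈ e, momentCoeff e y i * shape K i x) / edgeLength e := by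
  obtain ⟨a, a', _, _, hab, rfl⟩ := exists_pair_of_mem_edgesOf (mem_adj.1 hK).2
  obtain ⟨c, h⟩ := T.exists_isTri_of_mem_adj hab hK
  have ha := hl a (by simp)
  have ha' := hl a' (by simp)
  have hL : 0 < edgeLength {a, a'} := edgeLength_pos h.mem_edgesOf
  rw [h.integral_edge_affine_shape, ← edgeLength_pair] at ha
  rw [Finset.pair_comm, h.swap.integral_edge_affine_shape, ← edgeLength_pair,
    Finset.pair_comm] at ha'
  obtain ⟨s, _, rfl⟩ := (mem_hull_pair_iff c).1 hx
  simp only [momentCoeff, Finset.sum_pair hab, h.shape_a_bary, h.shape_b_bary, ← ha, ← ha']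
  rw [apply_baryPoint]
  field_simp
  ring

end MomentCoeff

/-! ### Comparison with a corrected finite element flux -/

/-- The moment `∫_e (ĝ_K - q_h · n_K) φ_i`, in terms of the projections `b i K e = ∫_e ĝ_K φ_i` and
of the constant values `qn K e` of `q_h · n_K`. -/
noncomputable def tractionDefect (qn : Finset Plane → Finset Plane → ℝ)
    (b : Plane → Finset Plane → Finset Plane → ℝ) (K e : Finset Plane) (i : Plane) : ℝ :=
  b i K e - qn K e * (edgeLength e / 2)

/-- The affine field on `K` whose normal trace is `ĝ_K - q_h · n_K`. -/
noncomputable def fluxCorrection (qn : Finset Plane → Finset Plane → ℝ)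
    (b : Plane → Finset Plane → Finset Plane → ℝ) (K : Finset Plane) : Plane → Plane :=
  edgeField K fun e => momentCoeff e (tractionDefect qn b K e)

/-- The traction `gK` on the boundary of `K` is affine on each edge `e`, with moments
`∫_e gK φ_i = b i K e`. -/
def HasTractionMoments (b : Plane → Finset Plane → Finset Plane → ℝ) (K : Finset Plane)
    (gK : Finset Plane → Plane → ℝ) : Prop :=
  ∀ e ∈ edgesOf K, ∃ l : Plane →ᵃ[ℝ] ℝ, gK e =ᵐ[edgeMeasure e] l ∧
    ∀ i ∈ e, ∫ x, l x * shape K i x ∂(edgeMeasure e) = b i K e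

section Traction

variable {T : TriMesh} {ΓD : Finset (Finset Plane)} {A : Plane → Plane →L[ℝ] Plane}
  {f g uh : Plane → ℝ} {qn : Finset Plane → Finset Plane → ℝ} {K e : Finset Plane}
  {b : Plane → Finset Plane → Finset Plane → ℝ} {ghat : Finset Plane → Finset Plane → Plane → ℝ}
  {gK : Finset Plane → Plane → ℝ}

theorem coe_sum_smul_affineMap {ι : Type*} (s : Finset ι) (k : ι → ℝ) (l : ι → Plane →ᵃ[ℝ] ℝ)
    (x : Plane) : (∑ j ∈ s, k j • l j) x = ∑ j ∈ s, k j * l j x := by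
  classical
  induction s using Finset.induction_on with
  | empty => simp
  | insert j s hj ih => simp [Finset.sum_insert hj, ih]

theorem hasTractionMoments_of_equilibrated (hg : IsEdgewiseAffine (T.neumannEdges ΓD) g)
    (hb : ∀ K ∈ T.elems, ∀ i ∈ K, IsNodalSolution T ΓD A f g uh i (b i))
    (hgN : ∀ e ∈ T.neumannEdges ΓD, ∀ K ∈ T.adj e, ∀ x ∈ hull e, ghat K e x = g x)
    (hgE : ∀ e ∈ T.edges, e ∉ T.neumannEdges ΓD → ∀ K ∈ T.adj e,
      (∃ c : Plane → ℝ, ∀ x ∈ hull e, ghat K e x = ∑ j ∈ e, c j * shape K j x) ∧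
      ∀ i ∈ e, ∫ x, ghat K e x * shape K i x ∂(edgeMeasure e) = b i K e)
    (hK : K ∈ T.elems) : HasTractionMoments b K (ghat K) := by
  intro e he
  have hadj : K ∈ T.adj e := TriMesh.mem_adj.2 ⟨hK, he⟩
  suffices h : (∃ l : Plane →ᵃ[ℝ] ℝ, ghat K e =ᵐ[edgeMeasure e] l) ∧
      ∀ i ∈ e, ∫ x, ghat K e x * shape K i x ∂(edgeMeasure e) = b i K e by
    obtain ⟨⟨l, hl⟩, hmom⟩ := h
    refine ⟨l, hl, fun i hi => ?_⟩
    rw [← hmom i hi]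
    exact integral_congr_ae (hl.mono fun x hx => by simp only [hx])
  by_cases heN : e ∈ T.neumannEdges ΓD
  · have hgg : ghat K e =ᵐ[edgeMeasure e] g := by
      filter_upwards [ae_edgeMeasure_mem e] with x hx using hgN e heN K hadj x hx
    obtain ⟨l, hl⟩ := hg e heN
    refine ⟨⟨l, hgg.trans hl⟩, fun i hi => ?_⟩
    rw [(hb K hK i (mem_of_mem_edge he hi)).neumann e heN hi K hadj]
    exact integral_congr_ae (hgg.mono fun x hx => by simp only [hx])
  · obtain ⟨⟨k, hk⟩, hmom⟩ := hgE e (TriMesh.mem_edges.2 ⟨K, hK, he⟩) heN K hadj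
    refine ⟨⟨∑ j ∈ e, k j • shape K j, ?_⟩, hmom⟩
    filter_upwards [ae_edgeMeasure_mem e] with x hx
    rw [hk x hx, coe_sum_smul_affineMap]

theorem HasTractionMoments.ae_eq_add (h : HasTractionMoments b K gK) (hK : K ∈ T.adj e) (q : ℝ) :
    gK e =ᵐ[edgeMeasure e] fun x => q +
      (∑ i ∈ e, momentCoeff e (fun j => b j K e - q * (edgeLength e / 2)) i * shape K i x) /
        edgeLength e := by
  have he := (TriMesh.mem_adj.1 hK).2
  obtain ⟨l, hl, hmom⟩ := h e he
  have hmom' : ∀ i ∈ e, ∫ x, (l - AffineMap.const ℝ Plane q) x * shape K i x ∂(edgeMeasure e) =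
      b i K e - q * (edgeLength e / 2) := by
    intro i hi
    have hs := continuous_shape K i
    have hlc := l.continuous_of_finiteDimensional
    rw [← hmom i hi, ← TriMesh.integral_edge_shape hK hi, ← integral_const_mul,
      ← integral_sub (integrable_edgeMeasure he (by fun_prop))
        (integrable_edgeMeasure he (by fun_prop))]
    exact integral_congr_ae (.of_forall fun x => sub_mul _ _ _)
  filter_upwards [hl, ae_edgeMeasure_mem e] with x hx hxe
  rw [hx, ← TriMesh.affine_eq_sum_momentCoeff hK _ hmom' hxe]
  exact (add_sub_cancel q (l x)).symm

end Traction

theorem card_patch (T : TriMesh) (i : Plane) :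
    Fintype.card (Patch T i) = ({K ∈ T.elems | i ∈ K} : Finset _).card :=
  Fintype.card_of_subtype _ fun K => by rw [Finset.mem_filter]

namespace IsSetting

variable {T : TriMesh} {ΓD : Finset (Finset Plane)} {aMin aMax M : ℝ}
  {A : Plane → Plane →L[ℝ] Plane} {f g : Plane → ℝ} {u : H1 T.domain} {uh : Plane → ℝ}
  {qn : Finset Plane → Finset Plane → ℝ} {K : Finset Plane}
  {b : Plane → Finset Plane → Finset Plane → ℝ} {gK : Finset Plane → Plane → ℝ}
  {qhat : Plane → Plane}

theorem sum_tractionDefect (S : IsSetting T ΓD aMin aMax M A f g u uh qn) (hK : K ∈ T.elems)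
    {k : ℝ} (hk : ∀ᵐ x ∂(volume.restrict (hull K)), f x = k)
    (hb : ∀ i ∈ K, IsNodalSolution T ΓD A f g uh i (b i)) :
    ∑ e ∈ edgesOf K, ∑ i ∈ e, tractionDefect qn b K e i = -(k * volume.real (hull K)) := by
  have hswap : ∑ e ∈ edgesOf K, ∑ i ∈ e, tractionDefect qn b K e i =
      ∑ i ∈ K, ∑ e ∈ edgesOf K with i ∈ e, tractionDefect qn b K e i := by
    refine Finset.sum_comm' fun e i => ?_
    rw [Finset.mem_filter]
    exact ⟨fun ⟨he, hi⟩ => ⟨⟨he, hi⟩, mem_of_mem_edge he hi⟩, fun ⟨⟨he, hi⟩, _⟩ => ⟨he, hi⟩⟩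
  have hnode : ∀ i ∈ K, ∑ e ∈ edgesOf K with i ∈ e, tractionDefect qn b K e i =
      -(k * (volume.real (hull K) / 3)) := fun i hi => S.sum_nodal_sub hK hi hk (hb i hi)
  rw [hswap, Finset.sum_congr rfl hnode, Finset.sum_const, T.card_eq K hK, nsmul_eq_mul,
    Nat.cast_ofNat]
  ring

theorem hasNormalTrace_add_fluxCorrection (S : IsSetting T ΓD aMin aMax M A f g u uh qn)
    (hK : K ∈ T.elems) (hb : ∀ i ∈ K, IsNodalSolution T ΓD A f g uh i (b i))
    (hg : HasTractionMoments b K gK) :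
    HasNormalTrace K (fun x => feFlux A uh x + fluxCorrection qn b K x) (fun x => -f x) gK := by
  obtain ⟨_, _, _, h⟩ := T.exists_isTri hK
  have hv := h.volume_hull_pos
  obtain ⟨k, hk⟩ := S.const K hK
  have hsum : ∑ e ∈ edgesOf K, ∑ i ∈ e, momentCoeff e (tractionDefect qn b K e) i =
      -(2 * volume.real (hull K) * k) := by
    rw [Finset.sum_congr rfl fun e he => sum_momentCoeff he, ← Finset.mul_sum,
      S.sum_tractionDefect hK hk hb]
    ring
  have hcompact := isCompact_hull K
  refine ((S.flux K hK).add (hasNormalTrace_edgeField hK _) (S.memLp_feFlux hK)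
    (memLp_of_continuous_of_isCompact hcompact (continuous_edgeField K _) 2)
    (memLp_of_continuous_of_isCompact hcompact continuous_const 2)
    (memLp_of_continuous_of_isCompact hcompact continuous_const 2)
    (fun _ _ => continuous_const) fun e _ => ?_).congr ?_ fun e he => ?_
  · exact (continuous_finsetSum _ fun i _ =>
      continuous_const.mul (continuous_shape K i)).div_const _
  · filter_upwards [hk] with x hx
    rw [hsum, hx]
    field_simp
    ring
  · exact (hg.ae_eq_add (TriMesh.mem_adj.2 ⟨hK, he⟩) (qn K e)).symm

theorem isAdmissibleFlux_add_fluxCorrection (S : IsSetting T ΓD aMin aMax M A f g u uh qn)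
    (hK : K ∈ T.elems) (hb : ∀ i ∈ K, IsNodalSolution T ΓD A f g uh i (b i))
    (hg : HasTractionMoments b K gK) :
    IsAdmissibleFlux f gK K (fun x => feFlux A uh x + fluxCorrection qn b K x) := by
  have hcompact := isCompact_hull K
  have hp : MemLp (fun x => feFlux A uh x + fluxCorrection qn b K x) 2
      (volume.restrict (hull K)) :=
    (S.memLp_feFlux hK).add
      (memLp_of_continuous_of_isCompact hcompact (continuous_edgeField K _) 2)
  obtain ⟨k, hk⟩ := S.const K hK
  have hf : MemLp (fun x => -f x) 2 (volume.restrict (hull K)) :=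
    (memLp_of_continuous_of_isCompact hcompact (continuous_const (y := -k)) 2).ae_eq
      (hk.mono fun x hx => congrArg Neg.neg hx.symm)
  have htrace := S.hasNormalTrace_add_fluxCorrection hK hb hg
  exact ⟨hp, htrace.hasWeakDiv hK hp hf, htrace⟩

theorem fluxNormSq_fluxCorrection_le (S : IsSetting T ΓD aMin aMax M A f g u uh qn)
    (hK : K ∈ T.elems) {Y : ℝ} (hY : ∀ e ∈ edgesOf K, ∀ i ∈ e, |tractionDefect qn b K e i| ≤ Y) :
    fluxNormSq A (hull K) (fluxCorrection qn b K) ≤ aMin⁻¹ * (9 * M * (10 * Y) ^ 2) := by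
  have h0 := S.aMin_pos
  have hcoeff : ∀ e ∈ edgesOf K, ∀ i ∈ e, |momentCoeff e (tractionDefect qn b K e) i| ≤ 10 * Y :=
    fun e he _ hi => abs_momentCoeff_le he (hY e he) hi
  have hinv := (S.tensor_hull hK).ae_inner_inverse_mem_Icc h0
  calc fluxNormSq A (hull K) (fluxCorrection qn b K)
      ≤ ∫ x in hull K, aMin⁻¹ * ‖fluxCorrection qn b K x‖ ^ 2 :=
        integral_mono_of_nonneg (hinv.mono fun x hx => (hx _).1)
          ((integrableOn_hull_of_continuous ((continuous_edgeField K _).norm.pow 2) K).const_mul _)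
          (hinv.mono fun x hx => (hx _).2)
    _ = aMin⁻¹ * ∫ x in hull K, ‖fluxCorrection qn b K x‖ ^ 2 := integral_const_mul _ _
    _ ≤ aMin⁻¹ * (9 * M * (10 * Y) ^ 2) := by
        gcongr
        exact integral_norm_sq_edgeField_le hK (S.area K hK) hcoeff

theorem fluxNormSq_sub_feFlux_le (S : IsSetting T ΓD aMin aMax M A f g u uh qn) (hK : K ∈ T.elems)
    (hb : ∀ i ∈ K, IsNodalSolution T ΓD A f g uh i (b i)) (hg : HasTractionMoments b K gK)
    (hmin : ∀ p, IsAdmissibleFlux f gK K p →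
      fluxNormSq A (hull K) (fun x => qhat x - feFlux A uh x) ≤
        fluxNormSq A (hull K) (fun x => p x - feFlux A uh x))
    {c : ℝ} (hc0 : 0 ≤ c) (hc : ∀ e ∈ edgesOf K, ∀ i ∈ e,
      |tractionDefect qn b K e i| ≤ c * (√(aMax * M) * √(patchError T A u uh i))) :
    fluxNormSq A (hull K) (fun x => qhat x - feFlux A uh x) ≤
      900 * c ^ 2 * aMin⁻¹ * aMax * M ^ 2 * ∑ i ∈ K, patchError T A u uh i := by
  have hpatch : ∀ i ∈ K, 0 ≤ patchError T A u uh i := fun i _ => S.patchError_nonneg i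
  have hY : ∀ e ∈ edgesOf K, ∀ i ∈ e, |tractionDefect qn b K e i| ≤
      c * (√(aMax * M) * √(∑ i ∈ K, patchError T A u uh i)) := by
    intro e he i hi
    refine (hc e he i hi).trans ?_
    gcongr
    exact Finset.single_le_sum hpatch (mem_of_mem_edge he hi)
  have hprod : 0 ≤ aMax * M := mul_nonneg S.aMax_pos.le (S.M_pos hK).le
  calc fluxNormSq A (hull K) (fun x => qhat x - feFlux A uh x)
      ≤ fluxNormSq A (hull K) (fun x => feFlux A uh x + fluxCorrection qn b K x - feFlux A uh x) :=
        hmin _ (S.isAdmissibleFlux_add_fluxCorrection hK hb hg)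
    _ = fluxNormSq A (hull K) (fluxCorrection qn b K) := by simp only [add_sub_cancel_left]
    _ ≤ _ := S.fluxNormSq_fluxCorrection_le hK hY
    _ = _ := by
        rw [mul_pow, mul_pow, mul_pow, Real.sq_sqrt hprod, Real.sq_sqrt (Finset.sum_nonneg hpatch)]
        ring

theorem creSq_le (S : IsSetting T ΓD aMin aMax M A f g u uh qn) (qhat : Plane → Plane) :
    creSq T A uh qhat ≤ 1 / 2 * ∑ K ∈ T.elems,
      fluxNormSq A (hull K) (fun x => qhat x - feFlux A uh x) := by
  refine mul_le_mul_of_nonneg_left ?_ (by norm_num)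
  by_cases hint : IntegrableOn (fun x => ⟪(A x).inverse (qhat x - feFlux A uh x),
      qhat x - feFlux A uh x⟫) T.domain
  · exact (TriMesh.integral_domain fun K hK =>
      Integrable.mono_measure hint (TriMesh.restrict_hull_le hK)).le
  · rw [fluxNormSq, integral_undef hint]
    exact Finset.sum_nonneg fun K hK => integral_nonneg_of_ae <|
      ((S.tensor_hull hK).ae_inner_inverse_mem_Icc S.aMin_pos).mono fun x hx => (hx _).1

theorem sum_patchError_le (S : IsSetting T ΓD aMin aMax M A f g u uh qn) {N : ℕ}
    (hN : ∀ i, Fintype.card (Patch T i) ≤ N) :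
    ∑ K ∈ T.elems, ∑ i ∈ K, patchError T A u uh i ≤ 3 * N * energyErrorSq T A u uh := by
  set V := T.elems.biUnion id
  have hswap : ∀ F : Finset Plane → Plane → ℝ,
      ∑ K ∈ T.elems, ∑ i ∈ K, F K i = ∑ i ∈ V, ∑ K ∈ T.elems with i ∈ K, F K i := fun F =>
    Finset.sum_comm' fun K i => by simp only [V, Finset.mem_biUnion, Finset.mem_filter, id]; tauto
  calc ∑ K ∈ T.elems, ∑ i ∈ K, patchError T A u uh i
      = ∑ i ∈ V, Fintype.card (Patch T i) * patchError T A u uh i := by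
        simp only [hswap, Finset.sum_const, card_patch, nsmul_eq_mul]
    _ ≤ ∑ i ∈ V, N * patchError T A u uh i :=
        Finset.sum_le_sum fun i _ =>
          mul_le_mul_of_nonneg_right (Nat.cast_le.2 (hN i)) (S.patchError_nonneg i)
    _ = N * ∑ K ∈ T.elems, ∑ _i ∈ K, elemError A u uh K := by
        rw [hswap, Finset.mul_sum]
        rfl
    _ = N * ∑ K ∈ T.elems, 3 * elemError A u uh K := by
        congr 1
        refine Finset.sum_congr rfl fun K hK => ?_
        rw [Finset.sum_const, T.card_eq K hK, nsmul_eq_mul, Nat.cast_ofNat]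
    _ = 3 * N * energyErrorSq T A u uh := by
        rw [S.energyErrorSq_eq, ← Finset.mul_sum]
        ring

theorem card_patch_le (S : IsSetting T ΓD aMin aMax M A f g u uh qn) (hM : 0 < M) (i : Plane) :
    Fintype.card (Patch T i) ≤ ⌈Real.pi * M⌉₊ := by
  rw [card_patch]
  exact_mod_cast (TriMesh.card_le_of_forall_mem hM S.area fun K hK => Finset.mem_filter.1 hK).trans
    (Nat.le_ceil (Real.pi * M))

theorem creSq_le_of_forall_le (S : IsSetting T ΓD aMin aMax M A f g u uh qn) {C : ℝ} (hC : 0 ≤ C)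
    {N : ℕ} (hN : ∀ i, Fintype.card (Patch T i) ≤ N)
    (h : ∀ K ∈ T.elems, fluxNormSq A (hull K) (fun x => qhat x - feFlux A uh x) ≤
      C * ∑ i ∈ K, patchError T A u uh i) :
    creSq T A uh qhat ≤ 1 / 2 * (C * (3 * N)) * energyErrorSq T A u uh :=
  calc creSq T A uh qhat
      ≤ 1 / 2 * ∑ K ∈ T.elems, fluxNormSq A (hull K) (fun x => qhat x - feFlux A uh x) :=
        S.creSq_le qhat
    _ ≤ 1 / 2 * ∑ K ∈ T.elems, C * ∑ i ∈ K, patchError T A u uh i := by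
        gcongr with K hK
        exact h K hK
    _ = 1 / 2 * (C * ∑ K ∈ T.elems, ∑ i ∈ K, patchError T A u uh i) := by rw [← Finset.mul_sum]
    _ ≤ 1 / 2 * (C * (3 * N * energyErrorSq T A u uh)) := by
        gcongr
        exact S.sum_patchError_le hN
    _ = 1 / 2 * (C * (3 * N)) * energyErrorSq T A u uh := by ring

end IsSetting

end HybridFlux

theorem theorem1_general (γ₀ aMin aMax : ℝ) (haMin : 0 < aMin) (haMax : aMin ≤ aMax) :
    ∃ C : ℝ, ∀ (T : TriMesh) (ΓD : Finset (Finset Plane)) (A : Plane → Plane →L[ℝ] Plane)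
      (f g : Plane → ℝ) (u : H1 T.domain) (uh : Plane → ℝ)
      (qn : Finset Plane → Finset Plane → ℝ) (qhat : Plane → Plane),
      T.IsRegular γ₀ →
      ΓD ⊆ T.boundaryEdges →
      IsDiffusionTensor T.domain aMin aMax A →
      (∀ (v : H1 T.domain) (t : Plane → ℝ), MemV T ΓD v t →
        ∫ x in T.domain, ⟪A x (u.grad x), v.grad x⟫ =
          (∫ x in T.domain, f x * v.val x) +
            ∑ e ∈ T.neumannEdges ΓD, ∫ x, g x * t x ∂(edgeMeasure e)) →
      (∀ K ∈ T.elems, ∃ l : Plane →ᵃ[ℝ] ℝ, ∀ x ∈ hull K, uh x = l x) →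
      (∀ K ∈ T.elems, HasNormalTrace K (feFlux A uh) (fun _ => 0) (fun e _ => qn K e)) →
      IsElementwiseConstant T f →
      IsEdgewiseAffine (T.neumannEdges ΓD) g →
      IsHybridFlux T ΓD A f g uh qn qhat →
      creSq T A uh qhat ≤ C * energyErrorSq T A u uh := by
  set M := max (areaConst γ₀) 2
  have hM2 : 2 ≤ M := le_max_right _ _
  have hM0 : 0 < M := two_pos.trans_le hM2
  have hmax : 0 < aMax := haMin.trans_le haMax
  obtain ⟨c, hc0, hc⟩ := exists_traction_bound M hM2 ⌈Real.pi * M⌉₊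
  refine ⟨1 / 2 * (900 * c ^ 2 * aMin⁻¹ * aMax * M ^ 2 * (3 * ⌈Real.pi * M⌉₊)), ?_⟩
  rintro T ΓD A f g u uh qn qhat hreg hsub hA hu huh hflux hf hg ⟨ghat, ⟨b, hb, hgN, hgE⟩, hqhat⟩
  have harea : ∀ K ∈ T.elems, Metric.diam (hull K) ^ 2 ≤ M * volume.real (hull K) := fun K hK =>
    (hreg.diam_sq_le hK).trans (mul_le_mul_of_nonneg_right (le_max_left _ _) measureReal_nonneg)
  have S : IsSetting T ΓD aMin aMax M A f g u uh qn :=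
    ⟨haMin, haMax, harea, hsub, hA, hu, huh, hflux, hf, hg⟩
  refine S.creSq_le_of_forall_le (by positivity) (S.card_patch_le hM0) fun K hK => ?_
  have hnodal : ∀ K ∈ T.elems, ∀ i ∈ K, IsNodalSolution T ΓD A f g uh i (b i) :=
    fun K hK i hi => (hb K hK i hi).1
  have hmoments : HasTractionMoments b K (ghat K) :=
    hasTractionMoments_of_equilibrated hg hnodal hgN hgE hK
  refine S.fluxNormSq_sub_feFlux_le hK (hnodal K hK) hmoments (hqhat K hK).2 hc0 fun e he i hi => ?_
  obtain ⟨hsol, hmin⟩ := hb K hK i (mem_of_mem_edge he hi)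
  exact hc S (S.card_patch_le hM0 i) hsol hmin K hK e he hi

theorem theorem1 (γ₀ aMin aMax : ℝ) (haMin : 0 < aMin) (haMax : aMin ≤ aMax) :
    ∃ C : ℝ, ∀ (T : TriMesh) (ΓD : Finset (Finset Plane)) (A : Plane → Plane →L[ℝ] Plane)
      (f g : Plane → ℝ) (u : H1 T.domain) (uh : Plane → ℝ)
      (qn : Finset Plane → Finset Plane → ℝ) (qhat : Plane → Plane),
      T.IsRegular γ₀ →
      ΓD.Nonempty → ΓD ⊆ T.boundaryEdges →
      IsDiffusionTensor T.domain aMin aMax A →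
      IsWeakSolution T ΓD A f g u →
      IsFESolution T ΓD A f g uh →
      -- `div (A∇u_h) = 0` on each triangle
      (∀ K ∈ T.elems, HasWeakDiv K (feFlux A uh) (fun _ => 0)) →
      -- the normal flux of `q_h` from each triangle is constant on each edge, with value `qn K e`
      (∀ K ∈ T.elems, HasNormalTrace K (feFlux A uh) (fun _ => 0) (fun e _ => qn K e)) →
      IsElementwiseConstant T f →
      IsEdgewiseAffine (T.neumannEdges ΓD) g →
      IsHybridFlux T ΓD A f g uh qn qhat →
      creSq T A uh qhat ≤ C * energyErrorSq T A u uh := by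
  obtain ⟨C, hC⟩ := theorem1_general γ₀ aMin aMax haMin haMax
  exact ⟨C, fun T ΓD A f g u uh qn qhat hreg _ hsub hA hu huh _ =>
    hC T ΓD A f g u uh qn qhat hreg hsub hA hu.2 huh.1.1⟩
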